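/- Let $L$ be a finite-dimensional restricted Lie algebra over a field $\mathbb{F}$ of prime characteristic $p$, with $p$-map $x\mapsto x^{[p]}$. Let $u(L)$ denote its restricted universal enveloping algebra, i.e. the quotient of the universal enveloping algebra of $L$ by the two-sided ideal generated by all $x^p-x^{[p]}$ ($x\in L$). Let $P_L(\mathbb{F})$ denote the projective cover of the one-dimensional trivial $u(L)$-module $\mathbb{F}$, i.e. a projective $u(L)$-module with an epimorphism onto $\mathbb{F}$ whose kernel is contained in the radical of $P_L(\mathbb{F})$. A torus of $L$ is an abelian $p$-subalgebra $T$ of $L$ each of whose elements $x$ is semisimple, i.e. lies in the $p$-subalgebra $\langle x^{[p]}\rangle_p$ generated by $x^{[p]}$; let $\mathrm{MT}(L)$ be the largest dimension of a torus of $L$. One says that $L$ has maximal $0$-PIM if $\dim_{\mathbb{F}}P_L(\mathbb{F})=p^{\dim_{\mathbb{F}}L-\mathrm{MT}(L)}$. Lemma. Let $I$ be a $p$-ideal of $L$, i.e. an ideal with $x^{[p]}\in I$ for all $x\in I$; regard $I$ and $L/I$ as restricted Lie algebras with the induced $p$-maps. Then $L$ has maximal $0$-PIM if, and only if, both $I$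 and $L/I$ have maximal $0$-PIM. -/

import Mathlib

universe u v

noncomputable section

namespace RestrictedLie

section Jacobson

variable {L : Type v} [LieRing L]

/-- `adCoeff x y n j` is the coefficient of `X ^ j` in `(ad (X x + y)) ^ n (x)`, computed in the Lie
ring `L[X]` of polynomials with coefficients in `L`. -/
def adCoeff (x y : L) : ℕ → ℕ → L
  | 0, 0 => x
  | 0, _ + 1 => 0
  | n + 1, 0 => ⁅y, adCoeff x y n 0⁆
  | n + 1, j + 1 => ⁅y, adCoeff x y n (j + 1)⁆ + ⁅x, adCoeff x y n j⁆

/-- The Lie polynomials `s_i(x, y)`, `1 ≤ i ≤ p - 1`, determined by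
`(ad (X x + y)) ^ (p - 1) (x) = ∑ i, i * s_i(x, y) * X ^ (i - 1)`. -/
def jacobsonS (F : Type u) [Field F] [LieAlgebra F L] (p i : ℕ) (x y : L) : L :=
  (i : F)⁻¹ • adCoeff x y (p - 1) (i - 1)

lemma map_adCoeff {L' : Type*} [LieRing L'] (f : L → L') (h0 : f 0 = 0)
    (hadd : ∀ x y, f (x + y) = f x + f y) (hlie : ∀ x y, f ⁅x, y⁆ = ⁅f x, f y⁆) (x y : L) :
    ∀ n j, f (adCoeff x y n j) = adCoeff (f x) (f y) n j
  | 0, 0 => rfl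
  | 0, _ + 1 => h0
  | n + 1, 0 => by simp only [adCoeff, hlie, map_adCoeff f h0 hadd hlie x y n 0]
  | n + 1, j + 1 => by
      simp only [adCoeff, hadd, hlie, map_adCoeff f h0 hadd hlie x y n (j + 1),
        map_adCoeff f h0 hadd hlie x y n j]

lemma adCoeff_mem {F : Type u} [Field F] [LieAlgebra F L] (I : LieIdeal F L) (x : L) {y : L}
    (hy : y ∈ I) : ∀ n j, adCoeff x y (n + 1) j ∈ I
  | n, 0 => lie_mem_left F L I _ _ hy
  | 0, 0 + 1 => by simp [adCoeff]
  | 0, j + 1 + 1 => by simp [adCoeff]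
  | n + 1, j + 1 => add_mem (lie_mem_left F L I _ _ hy) (lie_mem_right F L I _ _ (adCoeff_mem I x hy n j))

end Jacobson

/-- A `p`-map `x ↦ x^[p]` on the Lie algebra `L` over the field `F` (of characteristic `p`); the pair
of `L` and a `p`-map is a restricted Lie algebra. -/
structure PMap (p : ℕ) (F : Type u) (L : Type v) [Field F] [LieRing L] [LieAlgebra F L] where
  toFun : L → L
  ad_toFun : ∀ x y : L, ⁅toFun x, y⁆ = ((LieAlgebra.ad F L x) ^ p) y
  smul_toFun : ∀ (a : F) (x : L), toFun (a • x) = a ^ p • toFun x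
  add_toFun : ∀ x y : L,
    toFun (x + y) = toFun x + toFun y + ∑ i ∈ Finset.Icc 1 (p - 1), jacobsonS F p i x y

namespace PMap

variable {p : ℕ} {F : Type u} {L : Type v} [Field F] [LieRing L] [LieAlgebra F L]

/-- A `p`-subalgebra: a Lie subalgebra closed under the `p`-map. -/
def IsPSubalgebra (P : PMap p F L) (K : LieSubalgebra F L) : Prop :=
  ∀ x ∈ K, P.toFun x ∈ K

/-- A `p`-ideal: a Lie ideal closed under the `p`-map. -/
def IsPIdeal (P : PMap p F L) (I : LieIdeal F L) : Prop :=
  ∀ x ∈ I, P.toFun x ∈ I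

/-- The `p`-subalgebra `⟨S⟩_p` generated by a subset `S`. -/
def pSpan (P : PMap p F L) (S : Set L) : LieSubalgebra F L :=
  sInf {K | S ⊆ K ∧ P.IsPSubalgebra K}

/-- `x` is semisimple if it lies in the `p`-subalgebra generated by `x^[p]`. -/
def IsSemisimpleElement (P : PMap p F L) (x : L) : Prop :=
  x ∈ P.pSpan {P.toFun x}

/-- A torus: an abelian `p`-subalgebra all of whose elements are semisimple. -/
def IsTorus (P : PMap p F L) (T : LieSubalgebra F L) : Prop :=
  P.IsPSubalgebra T ∧ IsLieAbelian T ∧ ∀ x ∈ T, P.IsSemisimpleElement x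

/-- `MT(L)`, the largest dimension of a torus of `L` (for finite-dimensional `L`). -/
def maxTorusDim (P : PMap p F L) : ℕ :=
  sSup {n | ∃ T : LieSubalgebra F L, P.IsTorus T ∧ Module.finrank F T = n}

/-- The restricted structure on a `p`-ideal. -/
def restrict (P : PMap p F L) (I : LieIdeal F L) (hI : P.IsPIdeal I) : PMap p F I where
  toFun x := ⟨P.toFun x, hI x x.2⟩
  ad_toFun x y := by
    have key : ∀ (n : ℕ), ((((LieAlgebra.ad F I x) ^ n) y : I) : L)
        = ((LieAlgebra.ad F L x) ^ n) (y : L) := by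
      intro n
      induction n with
      | zero => simp
      | succ n ih => rw [pow_succ', pow_succ', Module.End.mul_apply, Module.End.mul_apply, ← ih]; rfl
    apply Subtype.ext
    rw [key, ← P.ad_toFun]
    rfl
  smul_toFun a x := Subtype.ext (P.smul_toFun a x)
  add_toFun x y := by
    apply Subtype.ext
    have h := P.add_toFun (x : L) (y : L)
    have e : ∀ i, ((jacobsonS F p i x y : I) : L) = jacobsonS F p i (x : L) (y : L) := by
      intro i
      have := map_adCoeff (fun z : I => (z : L)) rfl (fun _ _ => rfl) (fun _ _ => rfl) x y
        (p - 1) (i - 1)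
      simp only [jacobsonS, ← this]
      rfl
    simp only [← e] at h
    refine h.trans ?_
    simp

lemma mk_toFun_eq [Fact p.Prime] (P : PMap p F L) (I : LieIdeal F L) (hI : P.IsPIdeal I) (x y : L)
    (hxy : x - y ∈ I) :
    (LieSubmodule.Quotient.mk (P.toFun x) : L ⧸ I) = LieSubmodule.Quotient.mk (P.toFun y) := by
  have hp : p - 1 = (p - 2) + 1 := by have := (Fact.out : p.Prime).two_le; omega
  have h := P.add_toFun y (x - y)
  rw [add_sub_cancel] at h
  refine (Submodule.Quotient.eq I.toSubmodule).2 ?_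
  have e : ∀ a b c : L, a + b + c - a = b + c := fun a b c => by abel
  rw [h, e]
  refine add_mem (hI _ hxy) (sum_mem fun i _ => I.smul_mem _ ?_)
  rw [hp]
  exact adCoeff_mem I y hxy _ _

/-- The restricted structure on the quotient by a `p`-ideal: `(x + I)^[p] = x^[p] + I`. -/
def quotient [Fact p.Prime] (P : PMap p F L) (I : LieIdeal F L) (hI : P.IsPIdeal I) :
    PMap p F (L ⧸ I) where
  toFun q := Quotient.liftOn' q (fun x => (LieSubmodule.Quotient.mk (P.toFun x) : L ⧸ I))
    (fun x y h => P.mk_toFun_eq I hI x y ((Submodule.quotientRel_def _).1 h))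
  ad_toFun := by
    intro x y
    induction x using Quotient.inductionOn' with | h x => ?_
    induction y using Quotient.inductionOn' with | h y => ?_
    have key : ∀ n : ℕ, ((LieAlgebra.ad F (L ⧸ I) (LieSubmodule.Quotient.mk x)) ^ n)
        (LieSubmodule.Quotient.mk y)
        = LieSubmodule.Quotient.mk (((LieAlgebra.ad F L x) ^ n) y) := by
      intro n
      induction n with
      | zero => simp
      | succ n ih => rw [pow_succ', pow_succ', Module.End.mul_apply, Module.End.mul_apply, ih]; rfl
    refine Eq.trans ?_ (key p).symm
    rw [← P.ad_toFun]
    rfl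
  smul_toFun := by
    intro a x
    induction x using Quotient.inductionOn' with | h x => ?_
    exact congrArg (LieSubmodule.Quotient.mk (N := I)) (P.smul_toFun a x)
  add_toFun := by
    intro x y
    induction x using Quotient.inductionOn' with | h x => ?_
    induction y using Quotient.inductionOn' with | h y => ?_
    have h := congrArg (LieSubmodule.Quotient.mk' I) (P.add_toFun x y)
    rw [map_add, map_add, map_sum] at h
    refine h.trans ?_
    refine congrArg₂ (· + ·) rfl (Finset.sum_congr rfl fun i _ => ?_)
    have := map_adCoeff (fun z : L => (LieSubmodule.Quotient.mk z : L ⧸ I)) rfl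
      (fun _ _ => rfl) (fun _ _ => rfl) x y (p - 1) (i - 1)
    exact congrArg (fun z => (i : F)⁻¹ • z) this

/-- The relations `x ^ p = x^[p]`, `x ∈ L`, in the universal enveloping algebra. -/
inductive EnvelopingRel (P : PMap p F L) :
    UniversalEnvelopingAlgebra F L → UniversalEnvelopingAlgebra F L → Prop
  | pow (x : L) : EnvelopingRel P (UniversalEnvelopingAlgebra.ι F x ^ p)
      (UniversalEnvelopingAlgebra.ι F (P.toFun x))

/-- The restricted universal enveloping algebra `u(L) = u(L, 0)`. -/
abbrev Enveloping (P : PMap p F L) : Type (max u v) := RingQuot P.EnvelopingRel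

section Augmentation

attribute [local instance 100] LieRing.ofAssociativeRing

/-- The augmentation `u(L) → F`, the algebra homomorphism that vanishes on `L`. -/
def augmentation [Fact p.Prime] (P : PMap p F L) : P.Enveloping →ₐ[F] F :=
  RingQuot.liftAlgHom F ⟨UniversalEnvelopingAlgebra.lift F (0 : L →ₗ⁅F⁆ F), by
    rintro _ _ ⟨x⟩
    simp [(Fact.out : p.Prime).ne_zero]⟩

end Augmentation

/-- The one-dimensional trivial module `F` of `L`, on which `u(L)` acts by the augmentation. -/
def TrivialModule (_P : PMap p F L) : Type u := F

instance (P : PMap p F L) : AddCommGroup P.TrivialModule := inferInstanceAs (AddCommGroup F)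

instance [Fact p.Prime] (P : PMap p F L) : Module P.Enveloping P.TrivialModule :=
  Module.compHom F P.augmentation.toRingHom

end PMap

/-- `π : Q → M` is a projective cover of the `A`-module `M`: `Q` is projective, `π` is surjective, and
the kernel of `π` is contained in the radical of `Q`. -/
structure IsProjectiveCover {A : Type*} [Ring A] {Q M : Type*} [AddCommGroup Q] [Module A Q]
    [AddCommGroup M] [Module A M] (π : Q →ₗ[A] M) : Prop where
  projective : Module.Projective A Q
  surjective : Function.Surjective π
  ker_le : LinearMap.ker π ≤ Module.jacobson A Q

/-- `L` has maximal `0`-PIM: the projective cover of the trivial `u(L)`-module `F` (which exists and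
is unique up to isomorphism for finite-dimensional `L`) has dimension `p ^ (dim L - MT(L))`. -/
def PMap.HasMaximalZeroPIM {p : ℕ} [Fact p.Prime] {F : Type u} {L : Type v} [Field F] [LieRing L]
    [LieAlgebra F L] (P : PMap p F L) : Prop :=
  ∃ (Q : Type (max u v)) (_ : AddCommGroup Q) (_ : Module F Q) (_ : Module P.Enveloping Q)
    (_ : IsScalarTower F P.Enveloping Q) (π : Q →ₗ[P.Enveloping] P.TrivialModule),
    IsProjectiveCover π ∧ Module.finrank F Q = p ^ (Module.finrank F L - P.maxTorusDim)

end RestrictedLie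

end

noncomputable section
set_option linter.unusedSectionVars false

namespace RestrictedLie

/-! ### Jacobson's formula in associative algebras of characteristic `p` -/

section JacobsonFormula

attribute [local instance 100] LieRing.ofAssociativeRing

/-! Write d(L) for the dimension of the projective cover of the trivial `u(L)`-module. Three facts
give the equivalence: d is multiplicative, d(L) = d(I) d(L/I); MT is additive, MT(L) = MT(I) +
MT(L/I); and always d(L) ≤ p^(dim L - MT(L)). A product of two positive integers bounded by two
others attains the product of the bounds exactly when both bounds are attained.

Multiplicativity (`finrank_span_eq_mul`). The covers are realised as A f and B e for idempotents in
A = `u(L)` and B = `u(I)`. Because ad(x), x ∈ L, acts on the image of B by derivations, A e lies in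
B e A. Hence the restriction of A f to B has only trivial modules in its top. Its coinvariants are C
q(f), where C = `u(L/I)` and q : A → C. As A is projective over B, A f is a direct sum of dim C q(f)
copies of B e.

Projectivity of A over B comes from a dimension count, hence from the restricted PBW theorem
`finrank_enveloping`. Truncated monomials span, which bounds dim `u(L)` above. For the lower bound,
L acts by invariant vector fields on truncated affine space F[x_1, …, x_n]/(x_i^p), n = dim L. They
are dual to a flat coframe built by successive gauge transformations with truncated exponentials,
and `u(L)` separates functions at the origin.

The bound on d (`IsTorus.finrank_span_le`). For a torus T there is g in `u(L)` with augmentation 1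
and T g = 0. Then `u(L)` g is spanned by p^(dim L - dim T) elements and maps onto the projective
cover.

Additivity (`maxTorusDim_eq_add`). A torus splits into its image in L/I and its trace on I.
Conversely, enlarge a maximal torus of I to a largest torus T inside the preimage of a maximal torus
T₁ of L/I. An element over T₁ can be corrected by I so that it centralizes T; some iterated p-th
power of it then lies in T, and semisimplicity in T₁ brings the element itself back into the image
of T. -/

lemma cast_choose_prime_sub_one (F : Type*) [Field F] (p : ℕ) [Fact p.Prime] [CharP F p] :
    ∀ k : ℕ, k < p → ((p - 1).choose k : F) = (-1) ^ k
  | 0, _ => by simp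
  | k + 1, hk => by
      have hp : p = (p - 1) + 1 := (Nat.sub_add_cancel (Fact.out : p.Prime).one_le).symm
      have h : ((p.choose (k + 1) : ℕ) : F) = 0 :=
        (CharP.cast_eq_zero_iff F p _).2 ((Fact.out : p.Prime).dvd_choose_self (by omega) hk)
      rw [hp, Nat.choose_succ_succ, Nat.cast_add,
        cast_choose_prime_sub_one F p k (by omega)] at h
      rw [pow_succ]
      linear_combination h

/-- The binomial coefficient contributes (-1)^k and the power of -b contributes (-1)^(p-1-k);
together they give (-1)^(p-1) = 1, also for p = 2. -/
lemma Commute.sub_pow_prime_sub_one {F E : Type*} [Field F] (p : ℕ) [Fact p.Prime] [CharP F p]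
    [Ring E] [Algebra F E] {a b : E} (h : Commute a b) :
    (a - b) ^ (p - 1) = ∑ k ∈ Finset.range p, a ^ k * b ^ (p - 1 - k) := by
  have hp : p = (p - 1) + 1 := (Nat.sub_add_cancel (Fact.out : p.Prime).one_le).symm
  rw [sub_eq_add_neg, h.neg_right.add_pow, ← hp]
  refine Finset.sum_congr rfl fun k hk => ?_
  have hk' := Finset.mem_range.1 hk
  have e : ((p - 1).choose k : E) = (-1) ^ k := by
    rw [← map_natCast (algebraMap F E), cast_choose_prime_sub_one F p k hk']; simp
  have e2 : (-1 : E) ^ (p - 1) = 1 := by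
    have h1 : (-1 : F) ^ (p - 1) = 1 := by
      have := neg_one_pow_char F p
      rw [hp, pow_succ] at this
      simpa using this
    simpa using congrArg (algebraMap F E) h1
  rw [e, neg_pow, mul_assoc, mul_assoc, ((Commute.neg_one_left (b ^ (p - 1 - k))).pow_left k).symm.eq,
    ← mul_assoc ((-1 : E) ^ _), ← pow_add, Nat.sub_add_cancel (by omega), e2, one_mul]

/-- The iterated commutator `(ad z) ^ n (c)`. -/
def iterComm {A : Type*} [Ring A] (z c : A) : ℕ → A
  | 0 => c
  | n + 1 => z * iterComm z c n - iterComm z c n * z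

/-- ad z is the difference of the commuting operators of left and right multiplication by z. The sum
on the right is also the derivative of z^p in the direction c. -/
lemma iterComm_prime_sub_one {F A : Type*} [Field F] (p : ℕ) [Fact p.Prime] [CharP F p]
    [Ring A] [Algebra F A] (z c : A) :
    iterComm z c (p - 1) = ∑ k ∈ Finset.range p, z ^ k * c * z ^ (p - 1 - k) := by
  have h : ∀ n, iterComm z c n = ((LinearMap.mulLeft F z - LinearMap.mulRight F z) ^ n) c := by
    intro n
    induction n with
    | zero => rfl
    | succ n ih => rw [pow_succ', Module.End.mul_apply, ← ih]; rfl
  rw [h, Commute.sub_pow_prime_sub_one (F := F) p (LinearMap.commute_mulLeft_right (R := F) z z),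
    LinearMap.sum_apply]
  refine Finset.sum_congr rfl fun k _ => ?_
  simp [LinearMap.pow_mulLeft, LinearMap.pow_mulRight, mul_assoc]

open Polynomial in
lemma coeff_iterComm {A : Type*} [Ring A] (x y : A) :
    ∀ n j, (iterComm (C x * X + C y) (C x) n).coeff j = adCoeff x y n j
  | 0, 0 => by simp [iterComm, adCoeff]
  | 0, j + 1 => by simp [iterComm, adCoeff]
  | n + 1, 0 => by
      simp [iterComm, adCoeff, ← coeff_iterComm x y n, LieRing.of_associative_ring_bracket,
        add_mul, mul_add, mul_assoc]
  | n + 1, j + 1 => by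
      have h : X * iterComm (C x * X + C y) (C x) n = iterComm (C x * X + C y) (C x) n * X :=
        X_mul
      simp only [iterComm, adCoeff, ← coeff_iterComm x y n, LieRing.of_associative_ring_bracket,
        add_mul, mul_add, mul_assoc, coeff_sub, coeff_add, coeff_C_mul, h]
      rw [← mul_assoc, coeff_mul_X, coeff_mul_X, coeff_mul_C, coeff_mul_C]
      abel

open Polynomial in
lemma derivative_pow_eq_sum {A : Type*} [Ring A] (z : A[X]) (n : ℕ) :
    derivative (z ^ n) = ∑ k ∈ Finset.range n, z ^ k * derivative z * z ^ (n - 1 - k) := by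
  induction n with
  | zero => simp
  | succ n ih =>
    rw [pow_succ, derivative_mul, ih, Finset.sum_range_succ, Finset.sum_mul]
    congr 1
    · refine Finset.sum_congr rfl fun k hk => ?_
      have := Finset.mem_range.1 hk
      rw [mul_assoc, ← pow_succ]
      congr 2; omega
    · simp

open Polynomial in
/-- Jacobson's formula for `(x + y) ^ p` in an associative algebra of characteristic `p`. -/
lemma add_pow_eq_add_sum_jacobsonS {F A : Type*} [Field F] (p : ℕ) [Fact p.Prime] [CharP F p]
    [Ring A] [Algebra F A] (x y : A) :
    (x + y) ^ p = x ^ p + y ^ p + ∑ i ∈ Finset.Icc 1 (p - 1), jacobsonS F p i x y := by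
  have hp : p = (p - 1) + 1 := (Nat.sub_add_cancel (Fact.out : p.Prime).one_le).symm
  set z : A[X] := C x * X + C y with hz
  have hdz : derivative z = C x := by simp [hz]
  -- The derivative of z^p is (ad z)^(p-1)(x); comparing coefficients of X^(i-1) determines i times
  -- the coefficient of X^i in z^p, and i is invertible in F.
  have hcoeff : ∀ i, 1 ≤ i → i ≤ p - 1 → (z ^ p).coeff i = jacobsonS F p i x y := by
    intro i h1 h2
    have hi : (i : F) ≠ 0 := fun h => by
      have := Nat.le_of_dvd (by omega) ((CharP.cast_eq_zero_iff F p i).1 h); omega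
    have h := congrArg (fun f => coeff f (i - 1)) (derivative_pow_eq_sum z p)
    simp only [hdz] at h
    rw [← iterComm_prime_sub_one (F := F) p z (C x), coeff_iterComm, coeff_derivative] at h
    have e : ((i - 1 : ℕ) : A) + 1 = algebraMap F A i := by
      rw [map_natCast, ← Nat.cast_add_one, Nat.sub_add_cancel h1]
    rw [e, Nat.sub_add_cancel h1, ← Algebra.commutes, ← Algebra.smul_def] at h
    rw [jacobsonS, ← h, smul_smul, inv_mul_cancel₀ hi, one_smul]
  have hdeg : (z ^ p).natDegree ≤ p := by
    refine natDegree_pow_le.trans ?_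
    have : z.natDegree ≤ 1 := natDegree_linear_le
    nlinarith
  have h0 : (z ^ p).coeff 0 = y ^ p := by
    rw [← constantCoeff_apply, map_pow]; simp [hz]
  have hpp : (z ^ p).coeff p = x ^ p := by
    have h := coeff_pow_of_natDegree_le (p := z) (m := p) (n := 1) natDegree_linear_le
    rw [mul_one] at h
    rw [h]; simp [hz]
  have hev : (z ^ p).eval 1 = (x + y) ^ p := by
    have h := map_pow (eval₂RingHom' (RingHom.id A) 1 (fun a => Commute.one_right a)) z p
    refine h.trans (congrArg (· ^ p) ?_)
    simp [hz]
  rw [← hev, eval_eq_sum_range' (Nat.lt_succ_of_le hdeg)]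
  simp only [one_pow, mul_one]
  rw [Finset.sum_range_succ, hpp, Finset.range_eq_Ico, Finset.sum_eq_sum_Ico_succ_bot
    (Fact.out : p.Prime).pos, h0]
  have : Finset.Ico (0 + 1) p = Finset.Icc 1 (p - 1) := by ext; simp; omega
  rw [this, Finset.sum_congr rfl fun i hi =>
    hcoeff i (Finset.mem_Icc.1 hi).1 (Finset.mem_Icc.1 hi).2]
  abel

end JacobsonFormula

namespace PMap

variable {p : ℕ} {F : Type u} {L : Type v} [Field F] [LieRing L] [LieAlgebra F L]

/-! ### The restricted enveloping algebra and its universal property -/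

section Enveloping

attribute [local instance 100] LieRing.ofAssociativeRing

/-- The canonical map `L → u(L)`. -/
def incl (P : PMap p F L) : L →ₗ[F] P.Enveloping :=
  (RingQuot.mkAlgHom F P.EnvelopingRel).toLinearMap ∘ₗ
    (UniversalEnvelopingAlgebra.ι F : L →ₗ⁅F⁆ UniversalEnvelopingAlgebra F L).toLinearMap

lemma incl_lie (P : PMap p F L) (x y : L) :
    P.incl ⁅x, y⁆ = P.incl x * P.incl y - P.incl y * P.incl x := by
  have h : UniversalEnvelopingAlgebra.ι F ⁅x, y⁆ = UniversalEnvelopingAlgebra.ι F x *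
      UniversalEnvelopingAlgebra.ι F y - UniversalEnvelopingAlgebra.ι F y *
      UniversalEnvelopingAlgebra.ι F x := by
    rw [LieHom.map_lie, LieRing.of_associative_ring_bracket]
  exact (congrArg (RingQuot.mkAlgHom F P.EnvelopingRel) h).trans (by rw [map_sub, map_mul, map_mul]; rfl)

lemma incl_pow (P : PMap p F L) (x : L) : P.incl x ^ p = P.incl (P.toFun x) := by
  have := RingQuot.mkAlgHom_rel F (EnvelopingRel.pow (P := P) x)
  rw [map_pow] at this
  exact this

/-- The universal property of `u(L)`. -/
lemma exists_envelopingHom (P : PMap p F L) {A : Type*} [Ring A] [Algebra F A] (f : L →ₗ[F] A)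
    (hlie : ∀ x y, f ⁅x, y⁆ = f x * f y - f y * f x) (hpow : ∀ x, f x ^ p = f (P.toFun x)) :
    ∃ g : P.Enveloping →ₐ[F] A, ∀ x, g (P.incl x) = f x := by
  let f' : L →ₗ⁅F⁆ A := { f with map_lie' := fun {x y} => hlie x y }
  refine ⟨RingQuot.liftAlgHom F ⟨UniversalEnvelopingAlgebra.lift F f', ?_⟩, fun x => ?_⟩
  · rintro _ _ ⟨x⟩
    rw [map_pow, UniversalEnvelopingAlgebra.lift_ι_apply, UniversalEnvelopingAlgebra.lift_ι_apply]
    exact hpow x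
  · exact (RingQuot.liftAlgHom_mkAlgHom_apply _ _ _ _).trans
      (UniversalEnvelopingAlgebra.lift_ι_apply F f' x)

lemma envelopingHom_ext (P : PMap p F L) {A : Type*} [Ring A] [Algebra F A]
    {g h : P.Enveloping →ₐ[F] A} (hgh : ∀ x, g (P.incl x) = h (P.incl x)) : g = h := by
  apply RingQuot.ringQuot_ext'
  apply UniversalEnvelopingAlgebra.hom_ext
  ext x
  exact hgh x

lemma augmentation_incl [Fact p.Prime] (P : PMap p F L) (x : L) :
    P.augmentation (P.incl x) = 0 :=
  (RingQuot.liftAlgHom_mkAlgHom_apply _ _ _ _).trans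
    (UniversalEnvelopingAlgebra.lift_ι_apply F (0 : L →ₗ⁅F⁆ F) x)

/-- The universal property yields a homomorphism from `u(L)` into this subalgebra; followed by the
inclusion it fixes L, so it is the identity. -/
lemma adjoin_range_incl (P : PMap p F L) : Algebra.adjoin F (Set.range P.incl) = ⊤ := by
  set S := Algebra.adjoin F (Set.range P.incl)
  let f : L →ₗ[F] S := P.incl.codRestrict (Subalgebra.toSubmodule S)
    (fun x => Algebra.subset_adjoin ⟨x, rfl⟩)
  obtain ⟨g, hg⟩ := P.exists_envelopingHom f (fun x y => Subtype.ext (P.incl_lie x y))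
    (fun x => Subtype.ext (P.incl_pow x))
  have h : S.val.comp g = AlgHom.id F _ := P.envelopingHom_ext fun x => by
    simp [hg]; rfl
  refine eq_top_iff.2 fun a _ => ?_
  have := DFunLike.congr_fun h a
  rw [AlgHom.id_apply] at this
  rw [← this]
  exact (g a).2

end Enveloping

end PMap
end RestrictedLie

namespace RestrictedLie
namespace PMap

variable {p : ℕ} {F : Type u} {L : Type v} [Field F] [LieRing L] [LieAlgebra F L]

/-! ### Truncated ordered monomials span the enveloping algebra -/

section Spanning

/-- The span of the truncated powers `x ^ a`, `a < p`, in `u(L)`. -/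
def powSpan (P : PMap p F L) (x : L) : Submodule F P.Enveloping :=
  Submodule.span F ((fun a : ℕ => P.incl x ^ a) '' Set.Iio p)

/-- The span of the truncated ordered monomials in the elements of a list. -/
def monSpan (P : PMap p F L) (l : List L) : Submodule F P.Enveloping :=
  (l.map P.powSpan).prod

/-- The subspace `F + L` of `u(L)`. -/
def degreeLEOne (P : PMap p F L) : Submodule F P.Enveloping :=
  1 ⊔ LinearMap.range P.incl

lemma monSpan_append (P : PMap p F L) (l l' : List L) :
    P.monSpan (l ++ l') = P.monSpan l * P.monSpan l' := by
  simp [monSpan]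

lemma pow_mem_powSpan (P : PMap p F L) (x : L) {a : ℕ} (ha : a < p) :
    P.incl x ^ a ∈ P.powSpan x :=
  Submodule.subset_span ⟨a, ha, rfl⟩

open scoped Pointwise in
lemma exists_monSpan_eq_span (P : PMap p F L) (l : List L) :
    ∃ s : Finset P.Enveloping, s.card ≤ p ^ l.length ∧ P.monSpan l = Submodule.span F s := by
  classical
  induction l with
  | nil => exact ⟨{1}, by simp, by simp [monSpan, Submodule.one_eq_span]⟩
  | cons x l ih =>
    obtain ⟨s, hs, h⟩ := ih
    refine ⟨(Finset.range p).image (fun a => P.incl x ^ a) * s, ?_, ?_⟩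
    · refine Finset.card_mul_le.trans ?_
      rw [List.length_cons, pow_succ']
      exact Nat.mul_le_mul (Finset.card_image_le.trans (Finset.card_range p).le) hs
    · have e : P.monSpan (x :: l) = P.powSpan x * P.monSpan l := by simp [monSpan]
      rw [e, h, powSpan, Submodule.span_mul_span]
      congr 1
      ext; simp [Set.mem_mul]

lemma finite_monSpan (P : PMap p F L) (l : List L) : Module.Finite F (P.monSpan l) := by
  obtain ⟨s, -, h⟩ := P.exists_monSpan_eq_span l
  rw [h]; infer_instance

lemma finrank_monSpan_le (P : PMap p F L) (l : List L) :
    Module.finrank F (P.monSpan l) ≤ p ^ l.length := by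
  obtain ⟨s, hs, h⟩ := P.exists_monSpan_eq_span l
  rw [h]; exact (finrank_span_finset_le_card s).trans hs

lemma one_le_degreeLEOne (P : PMap p F L) : 1 ≤ P.degreeLEOne := le_sup_left

lemma incl_mem_degreeLEOne (P : PMap p F L) (x : L) : P.incl x ∈ P.degreeLEOne :=
  Submodule.mem_sup_right ⟨x, rfl⟩

lemma degreeLEOne_pow_mono (P : PMap p F L) : Monotone fun n => P.degreeLEOne ^ n :=
  pow_right_mono₀ P.one_le_degreeLEOne

lemma prod_mem_degreeLEOne_pow (P : PMap p F L) (w : List L) :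
    (w.map P.incl).prod ∈ P.degreeLEOne ^ w.length := by
  induction w with
  | nil => exact ⟨1, by simp⟩
  | cons x w ih =>
    rw [List.map_cons, List.prod_cons, List.length_cons, pow_succ']
    exact Submodule.mul_mem_mul (P.incl_mem_degreeLEOne x) ih

lemma exists_mem_degreeLEOne_pow (P : PMap p F L) (a : P.Enveloping) :
    ∃ n, a ∈ P.degreeLEOne ^ n := by
  have ha : a ∈ Algebra.adjoin F (Set.range P.incl) := by rw [P.adjoin_range_incl]; trivial
  induction ha using Algebra.adjoin_induction with
  | mem x hx =>
    obtain ⟨y, rfl⟩ := hx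
    exact ⟨1, by simpa using P.incl_mem_degreeLEOne y⟩
  | algebraMap r => exact ⟨0, by simp⟩
  | add x y _ _ hx hy =>
    obtain ⟨m, hm⟩ := hx
    obtain ⟨n, hn⟩ := hy
    exact ⟨max m n, add_mem (P.degreeLEOne_pow_mono (le_max_left m n) hm)
      (P.degreeLEOne_pow_mono (le_max_right m n) hn)⟩
  | mul x y _ _ hx hy =>
    obtain ⟨m, hm⟩ := hx
    obtain ⟨n, hn⟩ := hy
    exact ⟨m + n, by rw [pow_add]; exact Submodule.mul_mem_mul hm hn⟩

/-- Interchanging two neighbours costs a word in which they are replaced by their bracket, which is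
one letter shorter. -/
lemma prod_sub_prod_mem_of_perm (P : PMap p F L) {w w' : List L} (h : w.Perm w') :
    (w.map P.incl).prod - (w'.map P.incl).prod ∈ P.degreeLEOne ^ (w.length - 1) := by
  induction h with
  | nil => simp
  | @cons x l l' hl ih =>
    -- For an empty tail the truncated exponent `l.length - 1` is 0 rather than -1, so adding a
    -- letter would not raise it correctly; there both words coincide.
    rcases Nat.eq_zero_or_pos l.length with h0 | h0
    · have h1 : l = [] := List.length_eq_zero_iff.1 h0
      have h2 : l' = [] := by subst h1; exact List.nil_perm.1 hl
      simp [h1, h2]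
    · rw [List.map_cons, List.map_cons, List.prod_cons, List.prod_cons, ← mul_sub,
        List.length_cons, Nat.add_sub_cancel]
      have := Submodule.mul_mem_mul (P.incl_mem_degreeLEOne x) ih
      rwa [← pow_succ', Nat.sub_add_cancel h0] at this
  | swap x y l =>
    have e : ((y :: x :: l).map P.incl).prod - ((x :: y :: l).map P.incl).prod
        = P.incl ⁅y, x⁆ * (l.map P.incl).prod := by
      simp only [List.map_cons, List.prod_cons, incl_lie, sub_mul, mul_assoc]
    rw [e, List.length_cons, List.length_cons, Nat.add_sub_cancel, pow_succ']
    exact Submodule.mul_mem_mul (P.incl_mem_degreeLEOne _) (P.prod_mem_degreeLEOne_pow l)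
  | @trans l1 l2 l3 h1 h2 ih1 ih2 =>
    rw [← h1.length_eq] at ih2
    simpa using add_mem ih1 ih2

lemma degreeLEOne_pow_le_span (P : PMap p F L) {l : List L}
    (hl : Submodule.span F {x | x ∈ l} = ⊤) (n : ℕ) :
    P.degreeLEOne ^ n ≤ Submodule.span F
      {a | ∃ w : List L, w.length ≤ n ∧ (∀ x ∈ w, x ∈ l) ∧ (w.map P.incl).prod = a} := by
  have hV : P.degreeLEOne ≤ Submodule.span F ({1} ∪ P.incl '' {x | x ∈ l}) := by
    rw [Submodule.span_union, ← Submodule.one_eq_span, Submodule.span_image, hl,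
      Submodule.map_top]
    exact le_rfl
  induction n with
  | zero =>
    rw [pow_zero, Submodule.one_eq_span]
    exact Submodule.span_mono (by rintro _ rfl; exact ⟨[], by simp⟩)
  | succ n ih =>
    rw [pow_succ']
    refine (mul_le_mul' hV ih).trans ?_
    rw [Submodule.span_mul_span]
    refine Submodule.span_mono ?_
    rintro _ ⟨a, ha, b, ⟨w, hw, hwl, rfl⟩, rfl⟩
    rcases ha with rfl | ⟨x, hx, rfl⟩
    · exact ⟨w, by omega, hwl, by simp⟩
    · refine ⟨x :: w, by simp; omega, ?_, by simp⟩
      intro y hy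
      rcases List.mem_cons.1 hy with rfl | hy
      exacts [hx, hwl y hy]

lemma prod_flatten_replicate_mem_monSpan (P : PMap p F L) (c : L → ℕ) (l : List L)
    (hc : ∀ x ∈ l, c x < p) :
    (((l.map fun x => List.replicate (c x) x).flatten).map P.incl).prod ∈ P.monSpan l := by
  induction l with
  | nil => exact ⟨1, by simp⟩
  | cons x l ih =>
    have e : P.monSpan (x :: l) = P.powSpan x * P.monSpan l := by simp [monSpan]
    rw [e, List.map_cons, List.flatten_cons, List.map_append, List.prod_append]
    refine Submodule.mul_mem_mul ?_ (ih fun y hy => hc y (List.mem_cons_of_mem _ hy))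
    simpa using P.pow_mem_powSpan x (hc x (by simp))

lemma perm_flatten_replicate_count {α : Type*} [DecidableEq α] {l w : List α} (hl : l.Nodup)
    (hw : ∀ x ∈ w, x ∈ l) :
    w.Perm ((l.map fun x => List.replicate (w.count x) x).flatten) := by
  have key : ∀ (a : α) (l : List α), l.Nodup →
      ((l.map fun x => List.replicate (w.count x) x).flatten).count a
        = if a ∈ l then w.count a else 0 := by
    intro a l hl
    induction l with
    | nil => simp
    | cons x l ih =>
      rw [List.nodup_cons] at hl
      rw [List.map_cons, List.flatten_cons, List.count_append, ih hl.2, List.count_replicate]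
      by_cases h : x = a
      · subst h; simp [hl.1]
      · simp [h, Ne.symm h]
  rw [List.perm_iff_count]
  intro a
  rw [key a l hl]
  split_ifs with h
  · rfl
  · exact List.count_eq_zero_of_not_mem fun h' => h (hw a h')

/-- The truncated ordered monomials in a spanning list span `u(L)`. -/
theorem monSpan_eq_top [Fact p.Prime] (P : PMap p F L) {l : List L} (hn : l.Nodup)
    (hl : Submodule.span F {x | x ∈ l} = ⊤) : P.monSpan l = ⊤ := by
  classical
  have hone : 1 ∈ P.monSpan l := by
    simpa using P.prod_flatten_replicate_mem_monSpan (fun _ => 0) l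
      (fun _ _ => (Fact.out : p.Prime).pos)
  have key : ∀ n, P.degreeLEOne ^ n ≤ P.monSpan l := by
    intro n
    induction n with
    | zero => rw [pow_zero, Submodule.one_le]; exact hone
    | succ n ih =>
      refine (P.degreeLEOne_pow_le_span hl (n + 1)).trans (Submodule.span_le.2 ?_)
      rintro _ ⟨w, hw, hwl, rfl⟩
      have hmono : P.degreeLEOne ^ (w.length - 1) ≤ P.monSpan l :=
        (P.degreeLEOne_pow_mono (by omega : w.length - 1 ≤ n)).trans ih
      have hperm : ∀ w' : List L, w.Perm w' → (w'.map P.incl).prod ∈ P.monSpan l →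
          (w.map P.incl).prod ∈ P.monSpan l := by
        intro w' h h'
        simpa using add_mem (hmono (P.prod_sub_prod_mem_of_perm h)) h'
      by_cases hc : ∀ x ∈ l, w.count x < p
      · exact hperm _ (perm_flatten_replicate_count hn hwl)
          (P.prod_flatten_replicate_mem_monSpan (fun x => w.count x) l hc)
      · push Not at hc
        obtain ⟨x, -, hx⟩ := hc
        -- A letter occurring at least p times: collect p copies in front and replace x^p by x^[p],
        -- which shortens the word by p - 1 ≥ 1.
        obtain ⟨r, hr⟩ := (List.replicate_sublist_iff.2 hx).exists_perm_append
        refine hperm _ hr (hmono ?_)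
        have hlen := hr.length_eq
        rw [List.length_append, List.length_replicate] at hlen
        rw [List.map_append, List.prod_append, List.map_replicate, List.prod_replicate, incl_pow]
        have h2 := (Fact.out : p.Prime).two_le
        refine P.degreeLEOne_pow_mono (by omega : 1 + r.length ≤ w.length - 1) ?_
        simp only [pow_add, pow_one]
        exact Submodule.mul_mem_mul (P.incl_mem_degreeLEOne _) (P.prod_mem_degreeLEOne_pow r)
  refine eq_top_iff.2 fun a _ => ?_
  obtain ⟨n, hn⟩ := P.exists_mem_degreeLEOne_pow a
  exact key n hn

/-- A list enumerating a basis. -/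
lemma exists_list_span_eq {V : Type*} [AddCommGroup V] [Module F V] (W : Submodule F V)
    [FiniteDimensional F W] :
    ∃ l : List V, l.Nodup ∧ (∀ x ∈ l, x ∈ W) ∧ Submodule.span F {x | x ∈ l} = W ∧
      l.length = Module.finrank F W ∧ ∀ x ∈ l, x ≠ 0 := by
  classical
  let b := Module.finBasis F W
  have hb : LinearIndependent F (fun i => (b i : V)) :=
    b.linearIndependent.map' W.subtype (Submodule.ker_subtype W)
  have hset : {x | x ∈ List.ofFn fun i => (b i : V)} = Set.range fun i => (b i : V) := by
    ext; simp [List.mem_ofFn]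
  refine ⟨List.ofFn fun i => (b i : V), List.nodup_ofFn.2 hb.injective, ?_, ?_, by simp, ?_⟩
  · simp only [List.mem_ofFn]
    rintro _ ⟨i, rfl⟩
    exact (b i).2
  · rw [hset]
    have := congrArg (Submodule.map W.subtype) b.span_eq
    rw [Submodule.map_span, Submodule.map_top, Submodule.range_subtype, ← Set.range_comp] at this
    exact this
  · simp only [List.mem_ofFn]
    rintro _ ⟨i, rfl⟩
    exact hb.ne_zero i

/-- For complementary subspaces, bases concatenate to a spanning list. -/
lemma monSpan_append_eq_top [Fact p.Prime] (P : PMap p F L) {W W' : Submodule F L}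
    (hW : IsCompl W W') {l l' : List L} (hn : l.Nodup) (hn' : l'.Nodup)
    (hl0 : ∀ x ∈ l, x ≠ 0)
    (hl : Submodule.span F {x | x ∈ l} = W) (hl' : Submodule.span F {x | x ∈ l'} = W') :
    P.monSpan (l ++ l') = ⊤ := by
  refine P.monSpan_eq_top (List.nodup_append.2 ⟨hn, hn', ?_⟩) ?_
  · rintro x hx _ hx' rfl
    refine hl0 x hx (Submodule.disjoint_def.1 hW.disjoint x ?_ ?_)
    · rw [← hl]; exact Submodule.subset_span hx
    · rw [← hl']; exact Submodule.subset_span hx'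
  · have : {x | x ∈ l ++ l'} = {x | x ∈ l} ∪ {x | x ∈ l'} := by ext; simp
    rw [this, Submodule.span_union, hl, hl', hW.sup_eq_top]

instance finite_enveloping [Fact p.Prime] [FiniteDimensional F L] (P : PMap p F L) :
    Module.Finite F P.Enveloping := by
  obtain ⟨l, hn, -, hl, -, -⟩ := exists_list_span_eq (F := F) (⊤ : Submodule F L)
  have := P.finite_monSpan l
  rw [P.monSpan_eq_top hn hl] at this
  exact Module.finite_def.2 (Module.Finite.iff_fg.1 this)

end Spanning

end PMap
end RestrictedLie

namespace RestrictedLie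

/-! ### Truncated polynomial rings as group algebras, with their derivations -/

section TruncRing

/-- The truncated polynomial ring `F[x_j : j ∈ J] / (x_j ^ p)`, presented as the group algebra of the
elementary abelian group `(ℤ/p)^J` with `x_j = t_j - 1`. -/
abbrev TruncRing (p : ℕ) (F : Type*) [Field F] (J : Type*) : Type _ :=
  AddMonoidAlgebra F (J → ZMod p)

namespace TruncRing

open AddMonoidAlgebra

variable {p : ℕ} [hp : Fact p.Prime] {F : Type*} [Field F] [CharP F p] {J : Type*}

variable (p F) in
/-- The inclusion of the prime field. -/
def primeHom : ZMod p →+* F := ZMod.castHom (dvd_refl p) F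

lemma linearMap_ext {M : Type*} [AddCommGroup M] [Module F M] {f g : TruncRing p F J →ₗ[F] M}
    (h : ∀ a, f (single a 1) = g (single a 1)) : f = g := by
  refine AddMonoidAlgebra.lhom_ext' fun a => LinearMap.ext_ring ?_
  exact h a

instance : CharP (TruncRing p F J) p :=
  charP_of_injective_algebraMap (algebraMap F (TruncRing p F J)).injective p

variable (p F) in
/-- The augmentation `x_j ↦ 0`. -/
def ev : TruncRing p F J →ₐ[F] F := AddMonoidAlgebra.lift F F (J → ZMod p) 1

@[simp] lemma ev_single (a : J → ZMod p) (r : F) : ev p F (single a r) = r := by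
  simp [ev, AddMonoidAlgebra.lift_single]

/-- Frobenius is additive and every group element has p-th power 1. In particular the augmentation
ideal consists of nilpotents and the ring is local. -/
lemma pow_prime_eq (r : TruncRing p F J) :
    r ^ p = algebraMap F _ (ev p F r ^ p) := by
  induction r using AddMonoidAlgebra.induction_linear with
  | zero => simp [hp.out.ne_zero]
  | add f g hf hg => rw [add_pow_char, hf, hg, map_add, add_pow_char, map_add]
  | single a b =>
    rw [AddMonoidAlgebra.single_pow, ev_single]
    have : p • a = 0 := by ext; simp
    simp [this]

lemma isUnit_of_ev_ne_zero {r : TruncRing p F J} (h : ev p F r ≠ 0) : IsUnit r := by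
  rw [← isUnit_pow_iff hp.out.ne_zero, pow_prime_eq]
  exact (IsUnit.mk0 _ (pow_ne_zero _ h)).map _

lemma finrank_eq [Fintype J] :
    Module.finrank F (TruncRing p F J) = p ^ Fintype.card J := by
  classical
  rw [(AddMonoidAlgebra.coeffLinearEquiv (M := J → ZMod p) (S := F) F).finrank_eq]
  simp [ZMod.card]

variable [DecidableEq J]

variable (p F) in
/-- The truncated variable `x_j`. -/
def var (j : J) : TruncRing p F J := single (Pi.single j 1) 1 - 1

lemma ev_var (j : J) : ev p F (var p F j) = 0 := by simp [var]

lemma var_pow (j : J) : var p F j ^ p = 0 := by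
  rw [pow_prime_eq, ev_var]; simp [hp.out.ne_zero]

/-- The linear map underlying `∂/∂x_j`. -/
def pderivLinear (j : J) : TruncRing p F J →ₗ[F] TruncRing p F J :=
  (Finsupp.lsum F fun a => (primeHom p F (a j)) • AddMonoidAlgebra.lsingle (a - Pi.single j 1)) ∘ₗ
    (AddMonoidAlgebra.coeffLinearEquiv (M := J → ZMod p) (S := F) F).toLinearMap

lemma pderivLinear_single (j : J) (a : J → ZMod p) (r : F) :
    pderivLinear j (single a r) = single (a - Pi.single j 1) (primeHom p F (a j) * r) := by
  simp [pderivLinear]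

variable (p F) in
/-- The derivation `∂/∂x_j`. -/
def pderiv (j : J) : Derivation F (TruncRing p F J) (TruncRing p F J) :=
  Derivation.mk' (pderivLinear j) fun f g => by
    induction f using AddMonoidAlgebra.induction_linear with
    | zero => simp
    | add f f' hf hf' => rw [add_mul, map_add, hf, hf', map_add]; simp only [add_smul, smul_add]; abel
    | single a r =>
      induction g using AddMonoidAlgebra.induction_linear with
      | zero => simp
      | add f f' hf hf' =>
        rw [mul_add, map_add, hf, hf', map_add]; simp only [add_smul, smul_add]; abel
      | single b s =>
        have e1 : a + (b - Pi.single j 1) = a + b - Pi.single j 1 := by abel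
        have e2 : b + (a - Pi.single j 1) = a + b - Pi.single j 1 := by abel
        simp only [smul_eq_mul, pderivLinear_single, single_mul_single, e1, e2, Pi.add_apply, map_add,
          ← single_add]
        congr 1; ring

lemma pderiv_single (j : J) (a : J → ZMod p) (r : F) :
    pderiv p F j (single a r) = single (a - Pi.single j 1) (primeHom p F (a j) * r) :=
  pderivLinear_single j a r

lemma pderiv_var_self (j : J) : pderiv p F j (var p F j) = 1 := by
  rw [var, map_sub, pderiv_single, Derivation.map_one_eq_zero]; simp [one_def]

lemma pderiv_var_of_ne {i j : J} (h : i ≠ j) : pderiv p F i (var p F j) = 0 := by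
  rw [var, map_sub, pderiv_single]; simp [h]

lemma pderiv_comm (i j : J) (f : TruncRing p F J) :
    pderiv p F i (pderiv p F j f) = pderiv p F j (pderiv p F i f) := by
  by_cases hij : i = j
  · rw [hij]
  induction f using AddMonoidAlgebra.induction_linear with
  | zero => simp
  | add f f' hf hf' => simp only [map_add, hf, hf']
  | single a r =>
    simp only [pderiv_single, Pi.sub_apply, Pi.single_eq_of_ne hij, Pi.single_eq_of_ne (Ne.symm hij),
      sub_zero]
    congr 1
    · abel
    · ring

lemma iterate_pderiv_single (j : J) (a : J → ZMod p) (r : F) (k : ℕ) :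
    ∃ b, (pderiv p F j)^[k] (single a r)
      = single b ((∏ l ∈ Finset.range k, (primeHom p F (a j) - l)) * r) ∧ b j = a j - k := by
  induction k with
  | zero => exact ⟨a, by simp, by simp⟩
  | succ k ih =>
    obtain ⟨b, hb, hbj⟩ := ih
    refine ⟨b - Pi.single j 1, ?_, by simp [hbj]; ring⟩
    rw [Function.iterate_succ_apply', hb, pderiv_single, hbj, Finset.prod_range_succ]
    congr 1
    simp; ring

/-- On the group element t^a the scalar produced is a_j (a_j - 1) ⋯ (a_j - p + 1), whose factors run
through the whole prime field. -/
lemma iterate_pderiv_eq_zero (j : J) (f : TruncRing p F J) : (pderiv p F j)^[p] f = 0 := by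
  have h : (((pderiv p F j : Derivation F _ _) : TruncRing p F J →ₗ[F] TruncRing p F J) ^ p) = 0 := by
    refine linearMap_ext fun a => ?_
    rw [Module.End.pow_apply]
    obtain ⟨b, hb, -⟩ := iterate_pderiv_single (F := F) j a 1 p
    refine hb.trans ?_
    rw [Finset.prod_eq_zero (i := (a j).val) (Finset.mem_range.2 (ZMod.val_lt _))]
    · simp
    · rw [sub_eq_zero, ← map_natCast (primeHom p F), ZMod.natCast_zmod_val]
  have := LinearMap.congr_fun h f
  rwa [Module.End.pow_apply] at this

variable (p F) in
/-- Restriction to the `j`-th coordinate axis. -/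
def axis (j : J) : TruncRing p F J →ₐ[F] TruncRing p F J :=
  AddMonoidAlgebra.mapDomainAlgHom F F
    ((AddMonoidHom.single (fun _ : J => ZMod p) j).comp (Pi.evalAddMonoidHom _ j))

lemma axis_single (j : J) (a : J → ZMod p) (r : F) :
    axis p F j (single a r) = single (Pi.single j (a j)) r := by
  simp [axis]

lemma axis_var_self (j : J) : axis p F j (var p F j) = var p F j := by
  simp [var, axis_single]

lemma axis_var_of_ne {i j : J} (h : i ≠ j) : axis p F i (var p F j) = 0 := by
  simp [var, axis_single, h, one_def]

lemma ev_axis (j : J) (f : TruncRing p F J) : ev p F (axis p F j f) = ev p F f := by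
  have : (ev p F).toLinearMap ∘ₗ (axis p F j).toLinearMap = (ev p F (J := J)).toLinearMap :=
    linearMap_ext fun a => by simp [axis_single]
  exact LinearMap.congr_fun this f

lemma axis_pderiv (j : J) (f : TruncRing p F J) :
    axis p F j (pderiv p F j f) = pderiv p F j (axis p F j f) := by
  induction f using AddMonoidAlgebra.induction_linear with
  | zero => simp
  | add f f' hf hf' => simp only [map_add, hf, hf']
  | single a r => simp [pderiv_single, axis_single, Pi.single_sub]

/-- The Euler operators t_j ∂_j are simultaneously diagonal on the group elements, and their
eigenvalues separate exponents; this drives the minimal-support argument below. -/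
lemma coeff_mul_pderiv (j : J) (f : TruncRing p F J) (a : J → ZMod p) :
    (single (Pi.single j 1) 1 * pderiv p F j f).coeff a = primeHom p F (a j) * f.coeff a := by
  induction f using AddMonoidAlgebra.induction_linear with
  | zero => simp
  | add f f' hf hf' => simp only [map_add, mul_add, coeff_add, Finsupp.add_apply, hf, hf']
  | single b r =>
    rw [pderiv_single, single_mul_single, add_sub_cancel, one_mul, coeff_single, coeff_single]
    by_cases h : b = a
    · simp [h]
    · simp [h]

/-- An ideal inside the augmentation ideal that is stable under all partial derivatives is zero. -/
lemma eq_bot_of_pderiv_mem (K : Ideal (TruncRing p F J)) (hK : ∀ f ∈ K, ev p F f = 0)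
    (hd : ∀ j, ∀ f ∈ K, pderiv p F j f ∈ K) : K = ⊥ := by
  suffices h : ∀ n, ∀ f ∈ K, f.coeff.support.card = n → f = 0 from
    (Submodule.eq_bot_iff _).2 fun f hf => h _ f hf rfl
  intro n
  induction n using Nat.strong_induction_on with
  | _ n ih =>
  intro f hf hn
  by_contra hf0
  have hne : f.coeff ≠ 0 := by simpa using hf0
  obtain ⟨a, ha⟩ := Finsupp.support_nonempty_iff.2 hne
  -- This element of K has smaller support than f, since the coefficient at a is cancelled. So f is
  -- an eigenvector of every t_j ∂_j, hence a single term, and its augmentation is nonzero.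
  have key : ∀ j, single (Pi.single j 1) 1 * pderiv p F j f - primeHom p F (a j) • f = 0 := by
    intro j
    set g := single (Pi.single j 1) 1 * pderiv p F j f - primeHom p F (a j) • f with hg
    have hcoef : ∀ b, g.coeff b = (primeHom p F (b j) - primeHom p F (a j)) * f.coeff b := by
      intro b
      rw [hg, coeff_sub, Finsupp.sub_apply, coeff_mul_pderiv, coeff_smul, Finsupp.smul_apply,
        smul_eq_mul, sub_mul]
    have hgK : g ∈ K := by
      refine K.sub_mem (K.mul_mem_left _ (hd j f hf)) ?_
      rw [Algebra.smul_def]; exact K.mul_mem_left _ hf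
    refine ih _ ?_ g hgK rfl
    rw [← hn]
    refine Finset.card_lt_card ⟨fun b hb => ?_, fun h => ?_⟩
    · rw [Finsupp.mem_support_iff, hcoef] at hb
      exact Finsupp.mem_support_iff.2 (right_ne_zero_of_mul hb)
    · have := h ha
      rw [Finsupp.mem_support_iff, hcoef, sub_self, zero_mul] at this
      exact this rfl
  have hsing : f = single a (f.coeff a) := by
    ext b
    by_cases hb : b = a
    · subst hb; simp
    · rw [coeff_single, Finsupp.single_eq_of_ne hb]
      obtain ⟨j, hj⟩ := Function.ne_iff.1 hb
      have h := congrArg (fun g => g.coeff b) (key j)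
      simp only [coeff_sub, Finsupp.sub_apply, coeff_mul_pderiv, coeff_smul, Finsupp.smul_apply,
        smul_eq_mul, ← sub_mul, coeff_zero, Finsupp.zero_apply, mul_eq_zero, sub_eq_zero] at h
      exact h.resolve_left fun h' => hj ((primeHom p F).injective h')
  have := hK f hf
  rw [hsing, ev_single] at this
  exact (Finsupp.mem_support_iff.1 ha) this

end TruncRing

end TruncRing

/-- A commutative algebra that behaves like `F[x_1, …, x_n] / (x_i ^ p)` with its partial
derivatives, its augmentation and the restrictions to the coordinate axes. -/
structure TruncChart (p : ℕ) (F R : Type*) [Field F] [CommRing R] [Algebra F R] (n : ℕ) where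
  var : Fin n → R
  pderiv : Fin n → Derivation F R R
  ev : R →ₐ[F] F
  axis : Fin n → R →ₐ[F] R
  var_pow : ∀ j, var j ^ p = 0
  ev_var : ∀ j, ev (var j) = 0
  pderiv_var_self : ∀ j, pderiv j (var j) = 1
  pderiv_var_of_ne : ∀ i j, i ≠ j → pderiv i (var j) = 0
  pderiv_comm : ∀ i j f, pderiv i (pderiv j f) = pderiv j (pderiv i f)
  iterate_pderiv_eq_zero : ∀ j f, (pderiv j)^[p] f = 0
  axis_var_self : ∀ j, axis j (var j) = var j
  axis_var_of_ne : ∀ i j, i ≠ j → axis i (var j) = 0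
  ev_axis : ∀ j f, ev (axis j f) = ev f
  axis_pderiv : ∀ j f, axis j (pderiv j f) = pderiv j (axis j f)
  isUnit_of_ev_ne_zero : ∀ f, ev f ≠ 0 → IsUnit f
  eq_bot_of_pderiv_mem : ∀ K : Ideal R, (∀ f ∈ K, ev f = 0) → (∀ j, ∀ f ∈ K, pderiv j f ∈ K) → K = ⊥

/-- The chart given by the truncated polynomial ring. -/
def TruncRing.chart (p : ℕ) [Fact p.Prime] (F : Type*) [Field F] [CharP F p] (n : ℕ) :
    TruncChart p F (TruncRing p F (Fin n)) n where
  var := var p F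
  pderiv := pderiv p F
  ev := ev p F
  axis := axis p F
  var_pow := var_pow
  ev_var := ev_var
  pderiv_var_self := pderiv_var_self
  pderiv_var_of_ne _ _ := pderiv_var_of_ne
  pderiv_comm := pderiv_comm
  iterate_pderiv_eq_zero := iterate_pderiv_eq_zero
  axis_var_self := axis_var_self
  axis_var_of_ne _ _ := axis_var_of_ne
  ev_axis := ev_axis
  axis_pderiv := axis_pderiv
  isUnit_of_ev_ne_zero _ := isUnit_of_ev_ne_zero
  eq_bot_of_pderiv_mem := eq_bot_of_pderiv_mem

end RestrictedLie

namespace RestrictedLie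

/-! ### Truncated exponentials and a flat coframe with values in the Lie algebra -/

section Coframe

open scoped TensorProduct

section TensorLie

variable {F R L : Type*} [Field F] [CommRing R] [Algebra F R] [LieRing L] [LieAlgebra F L]

lemma rTensor_derivation_smul (D : Derivation F R R) (r : R) (u : R ⊗[F] L) :
    (D : R →ₗ[F] R).rTensor L (r • u) = D r • u + r • (D : R →ₗ[F] R).rTensor L u := by
  induction u using TensorProduct.induction_on with
  | zero => simp
  | add u v hu hv => simp only [smul_add, map_add, hu, hv]; abel
  | tmul s x =>
    rw [TensorProduct.smul_tmul', LinearMap.rTensor_tmul, LinearMap.rTensor_tmul,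
      TensorProduct.smul_tmul', TensorProduct.smul_tmul', ← TensorProduct.add_tmul]
    congr 1
    simp [mul_comm, add_comm]

lemma rTensor_derivation_lie (D : Derivation F R R) (u v : R ⊗[F] L) :
    (D : R →ₗ[F] R).rTensor L ⁅u, v⁆ =
      ⁅(D : R →ₗ[F] R).rTensor L u, v⁆ + ⁅u, (D : R →ₗ[F] R).rTensor L v⁆ := by
  induction u using TensorProduct.induction_on with
  | zero => simp
  | add u u' hu hu' => simp only [add_lie, map_add, hu, hu']; abel
  | tmul s x =>
    induction v using TensorProduct.induction_on with
    | zero => simp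
    | add v v' hv hv' => simp only [lie_add, map_add, hv, hv']; abel
    | tmul t y =>
      simp only [LieAlgebra.ExtendScalars.bracket_tmul, LinearMap.rTensor_tmul,
        ← TensorProduct.add_tmul]
      congr 1
      simp [mul_comm, add_comm]

lemma rTensor_algHom_smul (q : R →ₐ[F] R) (r : R) (u : R ⊗[F] L) :
    q.toLinearMap.rTensor L (r • u) = q r • q.toLinearMap.rTensor L u := by
  induction u using TensorProduct.induction_on with
  | zero => simp
  | add u v hu hv => simp only [smul_add, map_add, hu, hv]
  | tmul s x => simp [TensorProduct.smul_tmul']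

lemma ad_tmul_pow (z : L) (k : ℕ) (r : R) (x : L) :
    (LieAlgebra.ad R (R ⊗[F] L) (1 ⊗ₜ z) ^ k) (r ⊗ₜ x) = r ⊗ₜ ((LieAlgebra.ad F L z) ^ k) x := by
  induction k with
  | zero => simp
  | succ k ih =>
    rw [pow_succ', pow_succ', Module.End.mul_apply, Module.End.mul_apply, ih]
    simp

lemma ad_tmul_pow_prime {p : ℕ} (P : PMap p F L) (z : L) (u : R ⊗[F] L) :
    (LieAlgebra.ad R (R ⊗[F] L) (1 ⊗ₜ z) ^ p) u = ⁅(1 ⊗ₜ P.toFun z : R ⊗[F] L), u⁆ := by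
  induction u using TensorProduct.induction_on with
  | zero => simp
  | add u v hu hv => simp only [map_add, hu, hv, lie_add]
  | tmul r x => rw [ad_tmul_pow, ← P.ad_toFun]; simp

end TensorLie

section TruncExp

variable (p : ℕ) (F : Type*) {R M : Type*} [Field F] [CommRing R] [Algebra F R]
  [LieRing M] [LieAlgebra R M]

/-- The truncated exponential of `x ad(w)`. -/
def truncExp (x : R) (w : M) : Module.End R M :=
  ∑ k ∈ Finset.range p, algebraMap F R (k.factorial : F)⁻¹ • x ^ k • (LieAlgebra.ad R M w) ^ k

variable {p F}

lemma truncExp_apply (x : R) (w u : M) : truncExp p F x w u =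
    ∑ k ∈ Finset.range p, algebraMap F R (k.factorial : F)⁻¹ • x ^ k •
      (LieAlgebra.ad R M w ^ k) u := by
  simp [truncExp]

variable [hp : Fact p.Prime] [CharP F p]

lemma cast_factorial_ne_zero {k : ℕ} (hk : k < p) : (k.factorial : F) ≠ 0 := fun h =>
  absurd ((hp.out.dvd_factorial).1 ((CharP.cast_eq_zero_iff F p _).1 h)) (not_le.2 hk)

/-- Expand by the Leibniz rule for ad(w)^k. Terms of total degree at least p vanish with x^p, and
below degree p all factorials are invertible, so the usual computation for the exponential applies.
-/
lemma truncExp_lie {x : R} (hx : x ^ p = 0) (w u v : M) :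
    truncExp p F x w ⁅u, v⁆ = ⁅truncExp p F x w u, truncExp p F x w v⁆ := by
  set G : ℕ × ℕ → M := fun s => algebraMap F R ((s.1.factorial : F)⁻¹ * (s.2.factorial : F)⁻¹) •
    x ^ (s.1 + s.2) • ⁅(LieAlgebra.ad R M w ^ s.1) u, (LieAlgebra.ad R M w ^ s.2) v⁆ with hG
  have h1 : ⁅truncExp p F x w u, truncExp p F x w v⁆
      = ∑ s ∈ Finset.range p ×ˢ Finset.range p, G s := by
    rw [Finset.sum_product, truncExp_apply, truncExp_apply, sum_lie]
    refine Finset.sum_congr rfl fun i _ => ?_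
    rw [lie_sum]
    refine Finset.sum_congr rfl fun j _ => ?_
    simp only [hG, smul_lie, lie_smul, smul_smul, map_mul, pow_add]
    congr 1; ring
  have h2 : ∑ s ∈ Finset.range p ×ˢ Finset.range p, G s
      = ∑ s ∈ (Finset.range p ×ˢ Finset.range p).filter (fun s => s.1 + s.2 < p), G s := by
    refine (Finset.sum_filter_of_ne fun s _ hs => ?_).symm
    by_contra hlt
    refine hs ?_
    simp only [hG]
    rw [pow_eq_zero_of_le (not_lt.1 hlt) hx, zero_smul, smul_zero]
  have h3 : ∑ s ∈ (Finset.range p ×ˢ Finset.range p).filter (fun s => s.1 + s.2 < p), G s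
      = ∑ k ∈ Finset.range p, ∑ s ∈ Finset.HasAntidiagonal.antidiagonal k, G s := by
    rw [← Finset.sum_fiberwise_of_maps_to (g := fun s : ℕ × ℕ => s.1 + s.2) (t := Finset.range p)
      (fun s hs => by simpa using (Finset.mem_filter.1 hs).2)]
    refine Finset.sum_congr rfl fun k hk => Finset.sum_congr ?_ fun _ _ => rfl
    have := Finset.mem_range.1 hk
    ext s
    simp only [Finset.mem_filter, Finset.mem_product, Finset.mem_range, Finset.HasAntidiagonal.mem_antidiagonal]
    omega
  rw [h1, h2, h3, truncExp_apply]
  refine Finset.sum_congr rfl fun k hk => ?_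
  rw [LieAlgebra.ad_pow_lie, Finset.smul_sum, Finset.smul_sum]
  refine Finset.sum_congr rfl fun s hs => ?_
  have hs' := Finset.HasAntidiagonal.mem_antidiagonal.1 hs
  have hk' := Finset.mem_range.1 hk
  have h4 : ((k.choose s.1 : ℕ) : F) * (k.factorial : F)⁻¹
      = (s.1.factorial : F)⁻¹ * (s.2.factorial : F)⁻¹ := by
    have h := congrArg (Nat.cast (R := F)) (Nat.add_choose_mul_factorial_mul_factorial s.2 s.1)
    rw [add_comm s.2, hs'] at h
    push_cast at h
    have n1 := cast_factorial_ne_zero (F := F) hk'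
    have n2 := cast_factorial_ne_zero (F := F) (show s.1 < p by omega)
    have n3 := cast_factorial_ne_zero (F := F) (show s.2 < p by omega)
    field_simp
    linear_combination h
  have h5 := congrArg (algebraMap F R) h4
  rw [map_mul, map_natCast] at h5
  simp only [hG, hs', ← h5, ← Nat.cast_smul_eq_nsmul R, smul_smul]
  congr 1; ring

end TruncExp

section Differentiate

variable {p : ℕ} [hp : Fact p.Prime] {F R L : Type*} [Field F] [CharP F p] [CommRing R]
  [Algebra F R] [LieRing L] [LieAlgebra F L]

lemma rTensor_ad_pow (D : Derivation F R R) {w y : R ⊗[F] L}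
    (hw : (D : R →ₗ[F] R).rTensor L w = 0) (k : ℕ) :
    (D : R →ₗ[F] R).rTensor L ((LieAlgebra.ad R (R ⊗[F] L) w ^ k) y)
      = (LieAlgebra.ad R (R ⊗[F] L) w ^ k) ((D : R →ₗ[F] R).rTensor L y) := by
  induction k with
  | zero => rfl
  | succ k ih =>
    rw [pow_succ', Module.End.mul_apply, Module.End.mul_apply, LieAlgebra.ad_apply,
      rTensor_derivation_lie, hw, zero_lie, zero_add, ih, LieAlgebra.ad_apply]

lemma rTensor_truncExp_of_const (D : Derivation F R R) {x : R} (hx : D x = 0) {w : R ⊗[F] L}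
    (hw : (D : R →ₗ[F] R).rTensor L w = 0) (y : R ⊗[F] L) :
    (D : R →ₗ[F] R).rTensor L (truncExp p F x w y)
      = truncExp p F x w ((D : R →ₗ[F] R).rTensor L y) := by
  rw [truncExp_apply, truncExp_apply, map_sum]
  refine Finset.sum_congr rfl fun k _ => ?_
  rw [rTensor_derivation_smul, rTensor_derivation_smul, D.map_algebraMap, D.leibniz_pow, hx,
    rTensor_ad_pow D hw]
  simp

/-- The differential equation of the exponential, with an error: differentiation lowers the powers
of ad(w) by one, so the top term of `⁅w, truncExp p F x w y⁆` is not matched. -/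
lemma rTensor_truncExp (D : Derivation F R R) {x : R} (hx : D x = 1) {w y : R ⊗[F] L}
    (hw : (D : R →ₗ[F] R).rTensor L w = 0) (hy : (D : R →ₗ[F] R).rTensor L y = 0) :
    (D : R →ₗ[F] R).rTensor L (truncExp p F x w y) = ⁅w, truncExp p F x w y⁆
      - algebraMap F R ((p - 1).factorial : F)⁻¹ • x ^ (p - 1) •
        (LieAlgebra.ad R (R ⊗[F] L) w ^ p) y := by
  obtain ⟨m, rfl⟩ : ∃ m, p = m + 1 := ⟨p - 1, (Nat.sub_add_cancel hp.out.one_le).symm⟩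
  have e : ∀ k, (LieAlgebra.ad R (R ⊗[F] L) w ^ (k + 1)) y
      = ⁅w, (LieAlgebra.ad R (R ⊗[F] L) w ^ k) y⁆ := fun k => by
    rw [pow_succ', Module.End.mul_apply, LieAlgebra.ad_apply]
  have hterm : ∀ k : ℕ, (D : R →ₗ[F] R).rTensor L (algebraMap F R (k.factorial : F)⁻¹ • x ^ k •
        (LieAlgebra.ad R (R ⊗[F] L) w ^ k) y)
      = (algebraMap F R (k.factorial : F)⁻¹ * (k * x ^ (k - 1))) •
        (LieAlgebra.ad R (R ⊗[F] L) w ^ k) y := by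
    intro k
    rw [rTensor_derivation_smul, rTensor_derivation_smul, D.map_algebraMap, D.leibniz_pow, hx,
      rTensor_ad_pow D hw, hy, map_zero, smul_zero, zero_smul, zero_add, add_zero, smul_smul]
    simp
  rw [truncExp_apply, map_sum, Finset.sum_congr rfl fun k _ => hterm k, Finset.sum_range_succ',
    lie_sum, Finset.sum_range_succ]
  simp only [Nat.cast_zero, zero_mul, mul_zero, zero_smul, add_zero, Nat.add_sub_cancel, e, lie_smul,
    add_sub_cancel_right]
  refine Finset.sum_congr rfl fun k hk => ?_
  have hk' := Finset.mem_range.1 hk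
  have hk1 : ((k + 1 : ℕ) : F) ≠ 0 := fun h => by
    have := Nat.le_of_dvd (by omega) ((CharP.cast_eq_zero_iff F (m + 1) _).1 h); omega
  have h5 : algebraMap F R ((k + 1).factorial : F)⁻¹ * ((k + 1 : ℕ) : R)
      = algebraMap F R (k.factorial : F)⁻¹ := by
    rw [← map_natCast (algebraMap F R), ← map_mul, Nat.factorial_succ, Nat.cast_mul, mul_inv]
    congr 1
    field_simp
  rw [smul_smul, ← h5]
  congr 1; ring

lemma rTensor_algHom_truncExp (q : R →ₐ[F] R) {x : R} (hx : q x = 0) (w y : R ⊗[F] L) :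
    q.toLinearMap.rTensor L (truncExp p F x w y) = q.toLinearMap.rTensor L y := by
  rw [truncExp_apply, map_sum, Finset.sum_eq_single 0]
  · simp
  · intro k _ hk
    rw [rTensor_algHom_smul, rTensor_algHom_smul, map_pow, hx, zero_pow hk, zero_smul, smul_zero]
  · intro h; exact absurd (Finset.mem_range.2 hp.out.pos) h

lemma smul_truncExp {x N : R} (hx : N * x = 0) (w y : R ⊗[F] L) :
    N • truncExp p F x w y = N • y := by
  rw [truncExp_apply, Finset.smul_sum, Finset.sum_eq_single 0]
  · simp
  · intro k _ hk
    obtain ⟨k, rfl⟩ := Nat.exists_eq_succ_of_ne_zero hk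
    rw [smul_comm N, smul_smul N, Nat.succ_eq_add_one, pow_succ', ← mul_assoc, hx, zero_mul,
      zero_smul, smul_zero]
  · intro h; exact absurd (Finset.mem_range.2 hp.out.pos) h

end Differentiate


namespace TruncChart

variable {p : ℕ} [hp : Fact p.Prime] {F R L : Type*} [Field F] [CharP F p] [CommRing R]
  [Algebra F R] [LieRing L] [LieAlgebra F L] {n : ℕ} (c : TruncChart p F R n)

/-- `∂/∂x_j` on `F[x]/(x^p) ⊗ L`. -/
def pderivTensor (j : Fin n) : R ⊗[F] L →ₗ[F] R ⊗[F] L :=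
  (c.pderiv j : R →ₗ[F] R).rTensor L

/-- Restriction to the `j`-th axis on `F[x]/(x^p) ⊗ L`. -/
def axisTensor (j : Fin n) : R ⊗[F] L →ₗ[F] R ⊗[F] L :=
  (c.axis j).toLinearMap.rTensor L

/-- The polynomial `x_j ^ (p - 1) / (p - 1)!`. -/
def topVar (j : Fin n) : R :=
  algebraMap F _ ((p - 1).factorial : F)⁻¹ * c.var j ^ (p - 1)

lemma topVar_mul_var (j : Fin n) : c.topVar j * c.var j = 0 := by
  rw [topVar, mul_assoc, ← pow_succ, Nat.sub_add_cancel hp.out.one_le, c.var_pow, mul_zero]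

lemma pderiv_topVar_of_ne {i j : Fin n} (h : i ≠ j) : c.pderiv i (c.topVar j) = 0 := by
  rw [topVar, Derivation.leibniz, Derivation.map_algebraMap, Derivation.leibniz_pow,
    c.pderiv_var_of_ne _ _ h]
  simp

lemma axis_topVar (j : Fin n) : c.axis j (c.topVar j) = c.topVar j := by
  rw [topVar, map_mul, map_pow, c.axis_var_self, AlgHom.commutes]

lemma ev_topVar (j : Fin n) : c.ev (c.topVar j) = 0 := by
  have := hp.out.two_le
  rw [topVar, map_mul, map_pow, c.ev_var, zero_pow (by omega), mul_zero]

/-- The logarithmic derivative `e - x_j ^ (p - 1) / (p - 1)! e^[p]` of the truncated exponential. -/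
def logDeriv (P : PMap p F L) (j : Fin n) (e : L) : R ⊗[F] L :=
  1 ⊗ₜ e - c.topVar j • 1 ⊗ₜ P.toFun e

lemma pderivTensor_one_tmul (j : Fin n) (e : L) :
    c.pderivTensor j (1 ⊗ₜ e) = 0 := by
  simp [pderivTensor]

lemma pderivTensor_logDeriv_of_ne (P : PMap p F L) {i j : Fin n} (h : i ≠ j) (e : L) :
    c.pderivTensor i (c.logDeriv P j e) = 0 := by
  rw [logDeriv, map_sub, c.pderivTensor_one_tmul, pderivTensor, rTensor_derivation_smul,
    c.pderiv_topVar_of_ne h]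
  have := c.pderivTensor_one_tmul i (P.toFun e)
  rw [pderivTensor] at this
  rw [this]; simp

lemma axisTensor_logDeriv (P : PMap p F L) (j : Fin n) (e : L) :
    c.axisTensor j (c.logDeriv P j e) = c.logDeriv P j e := by
  rw [logDeriv, map_sub, axisTensor, rTensor_algHom_smul, c.axis_topVar]
  simp

lemma toFun_neg (P : PMap p F L) (e : L) : P.toFun (-e) = -P.toFun e := by
  have := P.smul_toFun (-1) e
  rwa [neg_one_pow_char, neg_smul, one_smul, neg_smul, one_smul] at this

/-- The p-map absorbs the truncation error, because ad(e)^p = ad(e^[p]). This makes the truncated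
exponential the gauge transformation belonging to `logDeriv`. -/
lemma pderivTensor_truncExp (P : PMap p F L) (j : Fin n) (e : L)
    {y : R ⊗[F] L} (hy : c.pderivTensor j y = 0) :
    c.pderivTensor j (truncExp p F (c.var j) (1 ⊗ₜ (-e)) y)
      = -⁅c.logDeriv P j e, truncExp p F (c.var j) (1 ⊗ₜ (-e)) y⁆ := by
  have h := rTensor_truncExp (p := p) (c.pderiv j) (c.pderiv_var_self j)
    (c.pderivTensor_one_tmul j (-e)) hy
  rw [pderivTensor, h, ad_tmul_pow_prime P, toFun_neg, smul_smul, ← topVar]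
  -- Multiplication by `topVar` kills x_j, so after it y and its truncated exponential agree.
  have h2 : c.topVar j • ⁅(1 ⊗ₜ[F] P.toFun e : R ⊗[F] L), y⁆
      = c.topVar j • ⁅(1 ⊗ₜ[F] P.toFun e : R ⊗[F] L),
        truncExp p F (c.var j) (1 ⊗ₜ (-e)) y⁆ := by
    rw [← lie_smul, ← lie_smul, smul_truncExp (c.topVar_mul_var j)]
  rw [logDeriv, sub_lie, smul_lie, TensorProduct.tmul_neg, TensorProduct.tmul_neg, neg_lie, neg_lie,
    smul_neg, h2, TensorProduct.tmul_neg]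
  abel

/-- A flat coframe on the `p`-truncated affine space with values in `L`. -/
theorem exists_flat_coframe (P : PMap p F L) (e : Fin n → L) :
    ∃ A : Fin n → R ⊗[F] L,
      (∀ i j, c.pderivTensor i (A j) - c.pderivTensor j (A i) + ⁅A i, A j⁆ = 0) ∧
      ∀ i, c.axisTensor i (A i) = c.logDeriv P i (e i) := by
  -- Add one variable x_k at a time, keeping the earlier forms independent of later variables. The
  -- new form is `logDeriv` of e_k; the old ones are transported by the truncated exponential E of
  -- -x_k e_k. E respects brackets and commutes with the other ∂_j; on the other axes x_k vanishes
  -- and E becomes the identity.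
  suffices h : ∀ m ≤ n, ∃ A : Fin n → R ⊗[F] L,
      (∀ i j : Fin n, i.1 < m → j.1 < m →
        c.pderivTensor i (A j) - c.pderivTensor j (A i) + ⁅A i, A j⁆ = 0) ∧
      (∀ i j : Fin n, i.1 < m → m ≤ j.1 → c.pderivTensor j (A i) = 0) ∧
      ∀ i : Fin n, i.1 < m → c.axisTensor i (A i) = c.logDeriv P i (e i) by
    obtain ⟨A, h1, -, h3⟩ := h n le_rfl
    exact ⟨A, fun i j => h1 i j i.2 j.2, fun i => h3 i i.2⟩
  intro m
  induction m with
  | zero => exact fun _ => ⟨0, by simp, by simp, by simp⟩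
  | succ m ih =>
    intro hm
    obtain ⟨A, h1, h2, h3⟩ := ih (by omega)
    set k : Fin n := ⟨m, hm⟩ with hk
    set E := truncExp p F (c.var k) (1 ⊗ₜ (-e k) : R ⊗[F] L) with hE
    have hEc : ∀ j : Fin n, j ≠ k → ∀ y, c.pderivTensor j (E y) = E (c.pderivTensor j y) :=
      fun j hj y => rTensor_truncExp_of_const (c.pderiv j) (c.pderiv_var_of_ne _ _ hj)
        (c.pderivTensor_one_tmul j (-e k)) y
    have hElie : ∀ y z, E ⁅y, z⁆ = ⁅E y, E z⁆ := fun y z => truncExp_lie (c.var_pow k) _ y z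
    have hEk : ∀ i : Fin n, i.1 < m → c.pderivTensor k (E (A i)) = -⁅c.logDeriv P k (e k), E (A i)⁆ :=
      fun i hi => c.pderivTensor_truncExp P k (e k) (h2 i k hi le_rfl)
    have hne : ∀ i : Fin n, i.1 < m → i ≠ k := by
      rintro i hi rfl; simp [hk] at hi
    have hcase : ∀ i : Fin n, i.1 < m + 1 → i = k ∨ i.1 < m := fun i hi => by
      rcases Nat.lt_succ_iff_lt_or_eq.1 hi with h | h
      · exact Or.inr h
      · exact Or.inl (Fin.ext h)
    have hA' : ∀ i, i ≠ k → Function.update (fun i => E (A i)) k (c.logDeriv P k (e k)) i = E (A i) :=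
      fun i hi => by rw [Function.update_of_ne hi]
    have hA'k : Function.update (fun i => E (A i)) k (c.logDeriv P k (e k)) k = c.logDeriv P k (e k) :=
      Function.update_self ..
    refine ⟨Function.update (fun i => E (A i)) k (c.logDeriv P k (e k)), ?_, ?_, ?_⟩
    · intro i j hi hj
      rcases hcase i hi with rfl | hi' <;> rcases hcase j hj with rfl | hj'
      · simp
      · rw [hA' j (hne j hj'), hA'k, hEk j hj', c.pderivTensor_logDeriv_of_ne P (hne j hj')]
        abel
      · rw [hA' i (hne i hi'), hA'k, hEk i hi', c.pderivTensor_logDeriv_of_ne P (hne i hi'),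
          ← lie_skew]
        abel
      · rw [hA' i (hne i hi'), hA' j (hne j hj'), hEc i (hne i hi'), hEc j (hne j hj'), ← hElie,
          ← map_sub, ← map_add, h1 i j hi' hj', map_zero]
    · intro i j hi hj
      have hjk : j ≠ k := by rintro rfl; simp [hk] at hj
      rcases hcase i hi with rfl | hi'
      · rw [hA'k, c.pderivTensor_logDeriv_of_ne P hjk]
      · rw [hA' i (hne i hi'), hEc j hjk, h2 i j hi' (by omega), map_zero]
    · intro i hi
      rcases hcase i hi with rfl | hi'
      · rw [hA'k, c.axisTensor_logDeriv]
      · rw [hA' i (hne i hi'), ← h3 i hi']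
        exact rTensor_algHom_truncExp (c.axis i) (c.axis_var_of_ne _ _ (hne i hi')) _ _

end TruncChart

end Coframe

end RestrictedLie

namespace RestrictedLie

/-! ### Invariant vector fields dual to the flat coframe -/

section VectorFields

open scoped TensorProduct

/-- One more bracket with z makes the sum for the (p-1)-st commutator telescope. -/
lemma iterComm_prime {F A : Type*} [Field F] (p : ℕ) [Fact p.Prime] [CharP F p]
    [Ring A] [Algebra F A] (z c : A) : iterComm z c p = z ^ p * c - c * z ^ p := by
  obtain ⟨m, hm⟩ : ∃ m, p = m + 1 := ⟨p - 1, (Nat.sub_add_cancel (Fact.out : p.Prime).one_le).symm⟩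
  have h := iterComm_prime_sub_one (F := F) p z c
  have hm' : p - 1 = m := by omega
  have e : iterComm z c p = z * iterComm z c m - iterComm z c m * z := by
    conv_lhs => rw [hm]
    rfl
  rw [hm', hm] at h
  rw [e, h, Finset.mul_sum, Finset.sum_mul]
  have h1 : ∀ k ∈ Finset.range (m + 1), z * (z ^ k * c * z ^ (m - k))
      - z ^ k * c * z ^ (m - k) * z = z ^ (k + 1) * c * z ^ (m + 1 - (k + 1))
        - z ^ k * c * z ^ (m + 1 - k) := by
    intro k hk
    have := Finset.mem_range.1 hk
    rw [show m + 1 - k = m - k + 1 by omega, show m + 1 - (k + 1) = m - k by omega, pow_succ',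
      pow_succ z (m - k)]
    simp only [mul_assoc]
  rw [← Finset.sum_sub_distrib, Finset.sum_congr rfl h1,
    Finset.sum_range_sub (fun k => z ^ k * c * z ^ (m + 1 - k)), hm]
  simp

namespace TruncChart

variable {p : ℕ} [hp : Fact p.Prime] {F R L : Type*} [Field F] [CharP F p] [CommRing R]
  [Algebra F R] [LieRing L] [LieAlgebra F L] {n : ℕ} (c : TruncChart p F R n)

/-- Lowering the order: `∂ ^ s (x ^ m f)` at the origin. -/
lemma ev_iterate_pderiv_mul (j : Fin n) (m : ℕ) : ∀ (s : ℕ) (_ : s ≤ m) (f : R),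
    c.ev ((c.pderiv j)^[s] (c.var j ^ m * f)) = if s = m then m.factorial * c.ev f else 0 := by
  induction m with
  | zero => intro s hs f; obtain rfl := Nat.le_zero.1 hs; simp
  | succ m ih =>
    intro s hs f
    cases s with
    | zero => simp [c.ev_var]
    | succ s =>
      have e : c.pderiv j (c.var j ^ (m + 1) * f)
          = c.var j ^ m * ((m + 1 : ℕ) * f + c.var j * c.pderiv j f) := by
        rw [Derivation.leibniz, Derivation.leibniz_pow, c.pderiv_var_self]
        simp only [smul_eq_mul, Nat.add_sub_cancel, nsmul_eq_mul]
        ring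
      rw [Function.iterate_succ_apply, e, ih s (by omega)]
      by_cases h : s = m
      · simp [h, c.ev_var, Nat.factorial_succ]; ring
      · simp [h]

/-- The normalisation by (p-1)! makes multiplication by `topVar` invisible at the origin to fewer
than p - 1 derivatives, while exactly p - 1 of them recover the value of f. -/
lemma ev_iterate_pderiv_topVar_mul (j : Fin n) {s : ℕ} (hs : s ≤ p - 1) (f : R) :
    c.ev ((c.pderiv j)^[s] (c.topVar j * f)) = if s = p - 1 then c.ev f else 0 := by
  have h1 : (c.pderiv j)^[s] (c.topVar j * f)
      = ((p - 1).factorial : F)⁻¹ • (c.pderiv j)^[s] (c.var j ^ (p - 1) * f) := by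
    have := (((c.pderiv j : R →ₗ[F] R) : Module.End F R) ^ s).map_smul
      ((p - 1).factorial : F)⁻¹ (c.var j ^ (p - 1) * f)
    rw [Module.End.pow_apply, Module.End.pow_apply] at this
    rw [topVar, mul_assoc, ← Algebra.smul_def]
    exact this
  have hp1 := cast_factorial_ne_zero (p := p) (F := F) (Nat.sub_lt hp.out.pos one_pos)
  rw [h1, map_smul, c.ev_iterate_pderiv_mul j _ s hs]
  split_ifs
  · rw [smul_eq_mul, inv_mul_cancel_left₀ hp1]
  · simp

/-- Evaluation at the origin on `F[x]/(x^p) ⊗ L`. -/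
def evTensor : R ⊗[F] L →ₗ[F] L :=
  (TensorProduct.lid F L).toLinearMap ∘ₗ c.ev.toLinearMap.rTensor L

lemma evTensor_tmul (r : R) (x : L) : c.evTensor (r ⊗ₜ[F] x) = c.ev r • x := by
  simp [evTensor]

lemma evTensor_smul (r : R) (u : R ⊗[F] L) : c.evTensor (r • u) = c.ev r • c.evTensor u := by
  induction u using TensorProduct.induction_on with
  | zero => simp
  | add u v hu hv => simp only [smul_add, map_add, hu, hv]
  | tmul s x => rw [TensorProduct.smul_tmul', evTensor_tmul, evTensor_tmul]; simp [mul_smul]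

lemma evTensor_axisTensor (j : Fin n) (u : R ⊗[F] L) :
    c.evTensor (c.axisTensor j u) = c.evTensor u := by
  induction u using TensorProduct.induction_on with
  | zero => simp
  | add u v hu hv => simp only [map_add, hu, hv]
  | tmul s x =>
    rw [axisTensor, LinearMap.rTensor_tmul, evTensor_tmul, evTensor_tmul]
    exact congrArg (· • x) (c.ev_axis j s)

lemma evTensor_logDeriv (P : PMap p F L) (j : Fin n) (x : L) :
    c.evTensor (c.logDeriv P j x) = x := by
  rw [logDeriv, map_sub, evTensor_smul, evTensor_tmul, c.ev_topVar]; simp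

/-- At the origin the transition matrix from the constant basis is the identity, so its determinant
has nonzero augmentation and is a unit. -/
lemma exists_basis (e : Module.Basis (Fin n) F L) (B : Fin n → R ⊗[F] L)
    (hB : ∀ i, c.evTensor (B i) = e i) :
    ∃ b : Module.Basis (Fin n) R (R ⊗[F] L), ⇑b = B := by
  set bR := Algebra.TensorProduct.basis R e
  have hrepr : ∀ (u : R ⊗[F] L) i, c.ev (bR.repr u i) = e.repr (c.evTensor u) i := by
    intro u i
    induction u using TensorProduct.induction_on with
    | zero => simp
    | add u v hu hv => simp only [map_add, Finsupp.add_apply, hu, hv]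
    | tmul s x => rw [evTensor_tmul]; simp [bR, Algebra.TensorProduct.basis_repr_tmul]
  have hdet : IsUnit (bR.det B) := by
    apply c.isUnit_of_ev_ne_zero
    have h : (c.ev : R →+* F).mapMatrix (bR.toMatrix B) = 1 := by
      ext i j
      have := hrepr (B j) i
      rw [hB] at this
      simpa [Module.Basis.toMatrix_apply, Matrix.one_apply, Finsupp.single_apply, eq_comm] using this
    have h2 := (c.ev : R →+* F).map_det (bR.toMatrix B)
    rw [h, Matrix.det_one] at h2
    rw [Module.Basis.det_apply]
    intro h3
    exact one_ne_zero (h2.symm.trans h3)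
  obtain ⟨h1, h2⟩ := (Module.Basis.is_basis_iff_det bR).2 hdet
  exact ⟨Module.Basis.mk h1 h2.ge, Module.Basis.coe_mk _ _⟩

/-- Invariant vector fields: a Lie algebra of dimension `n` acts by derivations on a chart of
dimension `n`, simply transitively. -/
theorem exists_vectorFields (P : PMap p F L) (e : Module.Basis (Fin n) F L) :
    ∃ D : L →ₗ[F] Derivation F R R,
      (∀ x y r, D ⁅x, y⁆ r = D x (D y r) - D y (D x r)) ∧
      (∀ j, ∃ m : Fin n → R, ∀ r, c.pderiv j r = ∑ k, m k * D (e k) r) ∧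
      ∀ i r, c.axis i (D (e i) r) =
        c.pderiv i (c.axis i r) + c.topVar i * c.axis i (D (P.toFun (e i)) r) := by
  obtain ⟨A, hflat, haxis⟩ := c.exists_flat_coframe P e
  obtain ⟨b, hb⟩ := c.exists_basis e A fun i => by
    rw [← c.evTensor_axisTensor i, haxis, c.evTensor_logDeriv]
  have hb' : ∀ i, ∃ b' : Module.Basis (Fin n) R (R ⊗[F] L), ⇑b' = fun j => c.axisTensor i (A j) :=
    fun i => c.exists_basis e _ fun j => by
      rw [c.evTensor_axisTensor, ← c.evTensor_axisTensor j, haxis, c.evTensor_logDeriv]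
  -- `cf x` holds the coordinates of the vector field on which the coframe takes the constant value
  -- x.
  set cf : L → Fin n → R := fun x i => b.repr (1 ⊗ₜ x) i with hcf
  have hsum : ∀ x, ∑ i, cf x i • A i = (1 ⊗ₜ x : R ⊗[F] L) := fun x => by
    rw [← hb]; exact b.sum_repr _
  have huniq : ∀ v w : Fin n → R, ∑ i, v i • A i = ∑ i, w i • A i → v = w := fun v w h => by
    apply b.equivFun.symm.injective
    rw [b.equivFun_symm_apply, b.equivFun_symm_apply, hb, h]
  have hcadd : ∀ x y i, cf (x + y) i = cf x i + cf y i := fun x y i => by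
    simp [hcf, TensorProduct.tmul_add]
  have hcsmul : ∀ (a : F) x i, cf (a • x) i = a • cf x i := fun a x i => by
    have : (1 ⊗ₜ (a • x) : R ⊗[F] L) = algebraMap F R a • (1 ⊗ₜ x) := by
      rw [algebraMap_smul, TensorProduct.tmul_smul]
    simp only [hcf]
    rw [this, map_smul, Finsupp.smul_apply, algebraMap_smul]
  let D : L →ₗ[F] Derivation F R R :=
    { toFun := fun x => ∑ i, cf x i • c.pderiv i
      map_add' := fun x y => by simp only [hcadd, add_smul, Finset.sum_add_distrib]
      map_smul' := fun a x => by
        simp only [hcsmul, RingHom.id_apply, Finset.smul_sum, smul_assoc] }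
  have hD : ∀ x r, D x r = ∑ i, cf x i * c.pderiv i r := fun x r => by
    have : D x = ∑ i, cf x i • c.pderiv i := rfl
    rw [this, ← Derivation.coeFnAddMonoidHom_apply, map_sum, Finset.sum_apply]
    rfl
  refine ⟨D, ?_, ?_, ?_⟩
  · intro x y r
    have h1 : ∀ j z, ∑ i, c.pderiv j (cf z i) • A i = - ∑ i, cf z i • c.pderivTensor j (A i) := by
      intro j z
      have h := c.pderivTensor_one_tmul j z
      rw [← hsum z, map_sum] at h
      simp only [pderivTensor, rTensor_derivation_smul, Finset.sum_add_distrib] at h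
      exact eq_neg_of_add_eq_zero_left h
    have h2 : ∀ z w, ∑ i, D z (cf w i) • A i
        = - ∑ j, ∑ i, (cf z j * cf w i) • c.pderivTensor j (A i) := by
      intro z w
      simp only [hD, Finset.sum_smul, mul_smul]
      rw [Finset.sum_comm, ← Finset.sum_neg_distrib]
      refine Finset.sum_congr rfl fun j _ => ?_
      rw [← Finset.smul_sum, h1, smul_neg, Finset.smul_sum]
    -- Differentiating ∑ cf_i A_i = 1 ⊗ x, which is constant, trades derivatives of coefficients for
    -- derivatives of the A_i; flatness turns their antisymmetrization into the bracket.
    have h3 : cf ⁅x, y⁆ = fun i => D x (cf y i) - D y (cf x i) := by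
      apply huniq
      have e1 : (1 ⊗ₜ ⁅x, y⁆ : R ⊗[F] L) = ⁅(1 ⊗ₜ x : R ⊗[F] L), (1 ⊗ₜ y : R ⊗[F] L)⁆ := by
        rw [LieAlgebra.ExtendScalars.bracket_tmul, one_mul]
      rw [hsum, e1, ← hsum x, ← hsum y, sum_lie]
      simp only [sub_smul, Finset.sum_sub_distrib, h2, lie_sum, smul_lie, lie_smul, smul_smul]
      rw [Finset.sum_comm (f := fun j i => (cf y j * cf x i) • c.pderivTensor j (A i)),
        sub_neg_eq_add, neg_add_eq_sub, ← Finset.sum_sub_distrib]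
      refine Finset.sum_congr rfl fun j _ => ?_
      rw [← Finset.sum_sub_distrib]
      refine Finset.sum_congr rfl fun i _ => ?_
      rw [mul_comm (cf y i), ← smul_sub]
      congr 1
      have := hflat j i
      rw [add_eq_zero_iff_eq_neg'] at this
      rw [this]; abel
    -- The second-order parts of the two compositions agree because partial derivatives commute.
    have h4 : ∑ i, ∑ j, cf x i * (cf y j * c.pderiv i (c.pderiv j r))
        = ∑ i, ∑ j, cf y i * (cf x j * c.pderiv i (c.pderiv j r)) := by
      rw [Finset.sum_comm]
      refine Finset.sum_congr rfl fun i _ => Finset.sum_congr rfl fun j _ => ?_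
      rw [c.pderiv_comm j i]; ring
    have h5 : ∀ z w, D z (D w r) = ∑ j, D z (cf w j) * c.pderiv j r
        + ∑ i, ∑ j, cf z i * (cf w j * c.pderiv i (c.pderiv j r)) := by
      intro z w
      rw [hD w, map_sum]
      simp only [Derivation.leibniz, smul_eq_mul, Finset.sum_add_distrib, hD z (c.pderiv _ _)]
      rw [add_comm]
      congr 1
      · refine Finset.sum_congr rfl fun j _ => mul_comm _ _
      · rw [Finset.sum_comm]
        refine Finset.sum_congr rfl fun j _ => ?_
        rw [Finset.mul_sum]
        refine Finset.sum_congr rfl fun i _ => ?_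
        ring
    rw [h5, h5, h4, hD, h3, add_sub_add_right_eq_sub, ← Finset.sum_sub_distrib]
    exact Finset.sum_congr rfl fun i _ => sub_mul _ _ _
  · intro j
    refine ⟨fun k => (Algebra.TensorProduct.basis R e).repr (A j) k, fun r => ?_⟩
    set m := fun k => (Algebra.TensorProduct.basis R e).repr (A j) k with hm
    have h1 : (fun i => ∑ k, m k * cf (e k) i) = Pi.single j 1 := by
      apply huniq
      have h2 : ∑ k, m k • (1 ⊗ₜ e k : R ⊗[F] L) = A j := by
        have := (Algebra.TensorProduct.basis R e).sum_repr (A j)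
        simpa [Algebra.TensorProduct.basis_apply] using this
      have h3 : ∑ i, (Pi.single j 1 : Fin n → R) i • A i = A j := by
        rw [Finset.sum_eq_single j] <;> simp +contextual
      rw [h3, ← h2]
      simp only [← hsum, Finset.smul_sum, Finset.sum_smul, mul_smul]
      rw [Finset.sum_comm]
    have h4 : c.pderiv j r = ∑ i, (Pi.single j 1 : Fin n → R) i * c.pderiv i r := by
      rw [Finset.sum_eq_single j] <;> simp +contextual
    rw [h4, ← h1]
    simp only [hD, Finset.mul_sum, Finset.sum_mul, mul_assoc]
    rw [Finset.sum_comm]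
  · intro i r
    obtain ⟨b', hb'⟩ := hb' i
    have hax : ∀ x, ∑ j, c.axis i (cf x j) • c.axisTensor i (A j) = (1 ⊗ₜ x : R ⊗[F] L) := by
      intro x
      have h : c.axisTensor i (1 ⊗ₜ x : R ⊗[F] L) = 1 ⊗ₜ x := by simp [axisTensor]
      rw [← hsum, map_sum] at h
      simp only [axisTensor, rTensor_algHom_smul] at h
      rw [← hsum x]; exact h
    -- On the i-th axis A_i = e_i - `topVar` e_i^[p]. Solve for e_i and compare coordinates in the
    -- restricted coframe, which is still a basis.
    have h1 : (fun j => c.axis i (cf (e i) j)) =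
        fun j => (Pi.single i 1 : Fin n → R) j + c.topVar i * c.axis i (cf (P.toFun (e i)) j) := by
      apply b'.equivFun.symm.injective
      rw [b'.equivFun_symm_apply, b'.equivFun_symm_apply, hb']
      simp only [add_smul, mul_smul, Finset.sum_add_distrib, ← Finset.smul_sum, hax]
      have h3 : ∑ j, (Pi.single i 1 : Fin n → R) j • c.axisTensor i (A j) = c.axisTensor i (A i) := by
        rw [Finset.sum_eq_single i] <;> simp +contextual
      rw [h3, haxis, logDeriv, sub_add_cancel]
    have h4 : ∑ j, (Pi.single i 1 : Fin n → R) j * c.axis i (c.pderiv j r)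
        = c.axis i (c.pderiv i r) := by
      rw [Finset.sum_eq_single i] <;> simp +contextual
    rw [hD, map_sum, ← c.axis_pderiv, ← h4, hD, map_sum, Finset.mul_sum, ← Finset.sum_add_distrib]
    refine Finset.sum_congr rfl fun j _ => ?_
    rw [map_mul, map_mul, congrFun h1 j]; ring

end TruncChart

end VectorFields

end RestrictedLie

namespace RestrictedLie

/-! ### The restricted Poincaré–Birkhoff–Witt dimension formula -/

section PBW

namespace TruncChart

variable {p : ℕ} [hp : Fact p.Prime] {F R L : Type*} [Field F] [CharP F p] [CommRing R]
  [Algebra F R] [LieRing L] [LieAlgebra F L] {n : ℕ} (c : TruncChart p F R n)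

lemma iterComm_eq_ad_pow {A : Type*} [Ring A] [Algebra F A] (ρ : L →ₗ[F] A)
    (hρ : ∀ x y, ρ ⁅x, y⁆ = ρ x * ρ y - ρ y * ρ x) (x y : L) (k : ℕ) :
    iterComm (ρ x) (ρ y) k = ρ ((LieAlgebra.ad F L x ^ k) y) := by
  induction k with
  | zero => rfl
  | succ k ih => rw [pow_succ', Module.End.mul_apply, LieAlgebra.ad_apply, hρ, ← ih]; rfl

section Extend

attribute [local instance 100] LieRing.ofAssociativeRing

/-- A representation that respects the `p`-map on a spanning set respects it everywhere. -/
lemma pow_eq_of_span_eq_top {A : Type*} [Ring A] [Algebra F A] (P : PMap p F L) (ρ : L →ₗ[F] A)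
    (hρ : ∀ x y, ρ ⁅x, y⁆ = ρ x * ρ y - ρ y * ρ x) {s : Set L} (hs : Submodule.span F s = ⊤)
    (h : ∀ x ∈ s, ρ x ^ p = ρ (P.toFun x)) (x : L) : ρ x ^ p = ρ (P.toFun x) := by
  have hx : x ∈ Submodule.span F s := by rw [hs]; trivial
  have h0 : ∀ y, ρ ((0 : F) • y) ^ p = ρ (P.toFun ((0 : F) • y)) := fun y => by
    rw [P.smul_toFun, zero_smul, map_zero, zero_pow hp.out.ne_zero, zero_pow hp.out.ne_zero,
      zero_smul, map_zero]
  induction hx using Submodule.span_induction with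
  | mem x hx => exact h x hx
  | zero => simpa using h0 0
  | add x y _ _ hx hy =>
    rw [map_add, add_pow_eq_add_sum_jacobsonS (F := F) p, hx, hy, P.add_toFun, map_add, map_add,
      map_sum]
    congr 1
    refine Finset.sum_congr rfl fun i _ => ?_
    rw [jacobsonS, jacobsonS, map_smul, map_adCoeff ρ (map_zero ρ) (map_add ρ)
      (fun x y => (hρ x y).trans (LieRing.of_associative_ring_bracket _ _).symm)]
  | smul a x _ hx => rw [map_smul, smul_pow, hx, P.smul_toFun, map_smul]

end Extend

/-- Unfold the p applications of D along the axis. Each `topVar` term is followed by too few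
derivatives to be seen at the origin, except the one from the innermost application, which is
followed by p - 1 and gives D' r; the pure term ∂^p vanishes. -/
lemma ev_pow_vectorField (D D' : Module.End F R) (j : Fin n)
    (hD : ∀ r, c.axis j (D r) = c.pderiv j (c.axis j r) + c.topVar j * c.axis j (D' r)) (r : R) :
    c.ev ((D ^ p) r) = c.ev (D' r) := by
  have key : ∀ k, k + 1 ≤ p → c.ev ((c.pderiv j)^[p - (k + 1)] (c.axis j ((D ^ (k + 1)) r)))
      = c.ev (D' r) := by
    have hstep : ∀ k, k + 1 ≤ p →
        c.ev ((c.pderiv j)^[p - (k + 1)] (c.axis j ((D ^ (k + 1)) r)))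
        = c.ev ((c.pderiv j)^[p - k] (c.axis j ((D ^ k) r)))
          + if k = 0 then c.ev (D' ((D ^ k) r)) else 0 := by
      intro k hk
      rw [pow_succ', Module.End.mul_apply, hD, iterate_map_add]
      rw [map_add]
      congr 1
      · rw [show p - k = p - (k + 1) + 1 by omega, Function.iterate_succ_apply]
      · refine (c.ev_iterate_pderiv_topVar_mul j (by omega) _).trans ?_
        rw [c.ev_axis]
        congr 1
        simp only [eq_iff_iff]; omega
    intro k
    induction k with
    | zero =>
      intro hk
      rw [hstep 0 hk, Nat.sub_zero, c.iterate_pderiv_eq_zero]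
      simp
    | succ k ih =>
      intro hk
      rw [hstep (k + 1) hk, ih (by omega)]
      simp
  have h := key (p - 1) (by have := hp.out.pos; omega)
  rw [Nat.sub_add_cancel hp.out.one_le, Nat.sub_self, Function.iterate_zero_apply, c.ev_axis] at h
  exact h

/-- The restricted enveloping algebra acts on a chart of dimension `dim L`, and no nonzero function
is killed at the origin by all of it. -/
theorem exists_envelopingAction (P : PMap p F L) (e : Module.Basis (Fin n) F L) :
    ∃ g : P.Enveloping →ₐ[F] Module.End F R, ∀ f, (∀ u, c.ev (g u f) = 0) → f = 0 := by
  obtain ⟨D, hlie, hspan, hax⟩ := c.exists_vectorFields P e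
  let ρ : L →ₗ[F] Module.End F R :=
    { toFun := fun x => (D x : R →ₗ[F] R)
      map_add' := fun x y => by rw [map_add]; rfl
      map_smul' := fun a x => by rw [map_smul]; rfl }
  have hρD : ∀ x r, ρ x r = D x r := fun _ _ => rfl
  have hρ : ∀ x y, ρ ⁅x, y⁆ = ρ x * ρ y - ρ y * ρ x := fun x y => by
    ext r; exact hlie x y r
  -- Transitivity: the fields D(e_k) generate all ∂_j over R, so the ideal generated by an L-stable
  -- set of functions vanishing at the origin is ∂-stable, hence zero.
  have hideal : ∀ S : Set R, (∀ f ∈ S, c.ev f = 0) → (∀ x, ∀ f ∈ S, ρ x f ∈ S) →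
      ∀ f ∈ S, f = 0 := by
    intro S hS hSD f hf
    have hbot : Ideal.span S = ⊥ := by
      refine c.eq_bot_of_pderiv_mem _ (fun f hf => ?_) (fun j f hf => ?_)
      · have : Ideal.span S ≤ RingHom.ker (c.ev : R →+* F) := Ideal.span_le.2 fun f hf => hS f hf
        exact this hf
      · have hst : ∀ x, ρ x f ∈ Ideal.span S := by
          intro x
          induction hf using Submodule.span_induction with
          | mem f hf => exact Ideal.subset_span (hSD x f hf)
          | zero => simp
          | add f g _ _ hf hg => rw [map_add]; exact add_mem hf hg
          | smul a f hf' hf =>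
            rw [hρD, smul_eq_mul, Derivation.leibniz]
            refine add_mem (Ideal.mul_mem_left _ _ hf) ?_
            rw [smul_eq_mul, mul_comm]
            exact Ideal.mul_mem_left _ _ hf'
        obtain ⟨m, hm⟩ := hspan j
        rw [hm]
        exact sum_mem fun k _ => Ideal.mul_mem_left _ _ (hst (e k))
    have := Ideal.subset_span hf
    rw [hbot] at this
    simpa using this
  have hpow : ∀ x, ρ x ^ p = ρ (P.toFun x) := by
    refine pow_eq_of_span_eq_top P ρ hρ e.span_eq ?_
    rintro _ ⟨i, rfl⟩
    -- E commutes with the whole action since ad(e_i)^p = ad(e_i^[p]), and its values vanish at the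
    -- origin. Its range is thus a set to which `hideal` applies.
    set E := ρ (e i) ^ p - ρ (P.toFun (e i)) with hE
    have hcomm : ∀ x, E * ρ x = ρ x * E := by
      intro x
      have h := iterComm_eq_ad_pow ρ hρ (e i) x p
      rw [iterComm_prime (F := F) p, ← P.ad_toFun, hρ] at h
      rw [hE, sub_mul, mul_sub, sub_eq_sub_iff_sub_eq_sub]
      exact h
    have hE0 : ∀ r, c.ev (E r) = 0 := by
      intro r
      rw [hE, LinearMap.sub_apply, map_sub,
        c.ev_pow_vectorField (ρ (e i)) (ρ (P.toFun (e i))) i (fun r => hax i r), sub_self]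
    rw [← sub_eq_zero]
    ext r
    refine hideal (Set.range E) ?_ ?_ _ ⟨r, rfl⟩
    · rintro _ ⟨r, rfl⟩; exact hE0 r
    · rintro x _ ⟨r, rfl⟩
      refine ⟨ρ x r, ?_⟩
      have := LinearMap.congr_fun (hcomm x) r
      exact this
  obtain ⟨g, hg⟩ := P.exists_envelopingHom ρ hρ hpow
  refine ⟨g, fun f hf => ?_⟩
  refine hideal {f | ∀ u, c.ev (g u f) = 0} ?_ ?_ f hf
  · intro f hf; simpa using hf 1
  · intro x f hf u
    have := hf (u * P.incl x)
    rwa [map_mul, Module.End.mul_apply, hg] at this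

end TruncChart

namespace PMap

variable {p : ℕ} [Fact p.Prime] {F : Type u} {L : Type v} [Field F] [CharP F p] [LieRing L]
  [LieAlgebra F L] [FiniteDimensional F L]

/-- The Poincaré–Birkhoff–Witt theorem for restricted Lie algebras, as a dimension formula. -/
theorem finrank_enveloping (P : PMap p F L) :
    Module.finrank F P.Enveloping = p ^ Module.finrank F L := by
  apply le_antisymm
  · obtain ⟨l, hn, -, hl, hlen, -⟩ := exists_list_span_eq (F := F) (⊤ : Submodule F L)
    rw [← finrank_top F P.Enveloping, ← P.monSpan_eq_top hn hl, ← finrank_top F L, ← hlen]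
    exact P.finrank_monSpan_le l
  · let c := TruncRing.chart p F (Module.finrank F L)
    obtain ⟨g, hg⟩ := c.exists_envelopingAction P (Module.finBasis F L)
    -- A function f goes to the functional u ↦ (u f)(0). It is injective because `u(L)` separates
    -- functions at the origin.
    let Φ : TruncRing p F (Fin (Module.finrank F L)) →ₗ[F] Module.Dual F P.Enveloping :=
      (LinearMap.lcomp F F g.toLinearMap) ∘ₗ
        (LinearMap.llcomp F _ _ F c.ev.toLinearMap) ∘ₗ LinearMap.applyₗ
    have hΦ : Function.Injective Φ := by
      rw [injective_iff_map_eq_zero]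
      intro f hf
      exact hg f fun u => LinearMap.congr_fun hf u
    have := LinearMap.finrank_le_finrank_of_injective hΦ
    rwa [Subspace.dual_finrank_eq, TruncRing.finrank_eq, Fintype.card_fin] at this

end PMap

end PBW

end RestrictedLie

namespace RestrictedLie

/-! ### Projective cover of a one-dimensional module via an idempotent -/

section LocalIdempotent

variable {F A : Type*} [Field F] [Ring A] [Algebra F A]

/-- An idempotent `e` such that `A e` is the projective cover of the one-dimensional module given by
the augmentation `ε`. -/
structure IsLocalIdempotent (ε : A →ₐ[F] F) (e : A) : Prop where
  mul_self : e * e = e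
  map_eq_one : ε e = 1
  exists_mul_eq : ∀ b, ε b ≠ 0 → ∃ c, c * (b * e) = e

/-- Nakayama: a proper submodule of a finite module lies in a maximal one, which also contains the
radical. -/
lemma eq_top_of_sup_jacobson {Q : Type*} [AddCommGroup Q] [Module A Q] [Module.Finite A Q]
    {N : Submodule A Q} (h : N ⊔ Module.jacobson A Q = ⊤) : N = ⊤ := by
  rcases eq_top_or_exists_le_coatom N with h1 | ⟨K, hK, hNK⟩
  · exact h1
  · refine absurd (top_le_iff.1 ?_) hK.1
    rw [← h]
    exact sup_le hNK (sInf_le hK)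

/-- Choose a minimal left ideal N among those on which ε does not vanish, and x in N with ε(x) ≠ 0.
By minimality N x = N, so right multiplication by x is bijective on the finite-dimensional N; the
solution e of e x = x is idempotent. -/
lemma exists_isLocalIdempotent [Module.Finite F A] (ε : A →ₐ[F] F) :
    ∃ e, IsLocalIdempotent ε e := by
  have : IsArtinian A A := isArtinian_of_tower F inferInstance
  obtain ⟨N, ⟨x, hxN, hx⟩, hmin⟩ := IsArtinian.set_has_minimal
    {N : Submodule A A | ∃ x ∈ N, ε x ≠ 0} ⟨⊤, 1, trivial, by simp⟩
  have hmin' : ∀ N' : Submodule A A, N' ≤ N → (∃ x ∈ N', ε x ≠ 0) → N' = N := fun N' hle h => by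
    by_contra hne
    exact hmin N' h (lt_of_le_of_ne hle hne)
  have hmap : N.map (LinearMap.toSpanSingleton A A x) = N := by
    refine hmin' _ ?_ ⟨x * x, ⟨x, hxN, by simp⟩, by simp [hx]⟩
    rintro _ ⟨y, -, rfl⟩
    exact N.smul_mem y hxN
  have hsurj : ∀ z ∈ N, ∃ y ∈ N, y * x = z := fun z hz => by
    rw [← hmap] at hz
    obtain ⟨y, hy, rfl⟩ := hz
    exact ⟨y, hy, rfl⟩
  have hker : ∀ y ∈ N, y * x = 0 → y = 0 := by
    let f : N →ₗ[F] N :=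
      { toFun := fun y => ⟨y * x, N.smul_mem y.1 hxN⟩
        map_add' := fun y z => Subtype.ext (add_mul _ _ _)
        map_smul' := fun a y => Subtype.ext (smul_mul_assoc _ _ _) }
    have : Module.Finite F N := Module.Finite.of_injective
      (N.subtype.restrictScalars F) N.injective_subtype
    have hf : Function.Injective f := LinearMap.injective_iff_surjective.2 fun z => by
      obtain ⟨y, hy, hyz⟩ := hsurj z z.2
      exact ⟨⟨y, hy⟩, Subtype.ext hyz⟩
    intro y hy hyx
    exact congrArg Subtype.val (hf (a₁ := ⟨y, hy⟩) (a₂ := 0) (Subtype.ext (by simpa [f] using hyx)))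
  obtain ⟨e, he, hex⟩ := hsurj x hxN
  have hidem : e * e = e := by
    rw [← sub_eq_zero]
    refine hker _ (N.sub_mem (N.smul_mem e he) he) ?_
    rw [sub_mul, mul_assoc, hex, hex, sub_self]
  have hone : ε e = 1 := by
    have := congrArg ε hex
    rw [map_mul] at this
    exact mul_right_cancel₀ hx (by rw [this, one_mul])
  refine ⟨e, hidem, hone, fun b hb => ?_⟩
  have hspan : Submodule.span A {b * e} = N := by
    refine hmin' _ ?_ ⟨b * e, Submodule.mem_span_singleton_self _, by simp [hone, hb]⟩
    rw [Submodule.span_singleton_le_iff_mem]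
    exact N.smul_mem b he
  rw [← hspan] at he
  exact Submodule.mem_span_singleton.1 he

namespace IsLocalIdempotent

variable {ε : A →ₐ[F] F} {e : A}

lemma mul_eq_self_of_mem (h : IsLocalIdempotent ε e) {y : A} (hy : y ∈ Submodule.span A {e}) :
    y * e = y := by
  obtain ⟨a, rfl⟩ := Submodule.mem_span_singleton.1 hy
  rw [smul_eq_mul, mul_assoc, h.mul_self]

/-- Right multiplication by `e`. -/
def proj (_h : IsLocalIdempotent ε e) : A →ₗ[A] Submodule.span A {e} :=
  (LinearMap.toSpanSingleton A A e).codRestrict _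
    fun _ => Submodule.smul_mem _ _ (Submodule.mem_span_singleton_self e)

lemma coe_proj (h : IsLocalIdempotent ε e) (a : A) : (h.proj a : A) = a * e := rfl

lemma projective (h : IsLocalIdempotent ε e) : Module.Projective A (Submodule.span A {e}) :=
  Module.Projective.of_split (Submodule.subtype _) h.proj <| by
    ext y
    simp [coe_proj, h.mul_eq_self_of_mem y.2]

lemma eq_top_of_map_ne_zero (h : IsLocalIdempotent ε e) {N : Submodule A (Submodule.span A {e})}
    {y : Submodule.span A {e}} (hy : y ∈ N) (hne : ε y ≠ 0) : N = ⊤ := by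
  obtain ⟨c, hc⟩ := h.exists_mul_eq y hne
  have he : (⟨e, Submodule.mem_span_singleton_self e⟩ : Submodule.span A {e}) ∈ N := by
    have : (⟨e, Submodule.mem_span_singleton_self e⟩ : Submodule.span A {e}) = c • y :=
      Subtype.ext (hc.symm.trans (by rw [h.mul_eq_self_of_mem y.2]; rfl))
    rw [this]; exact N.smul_mem c hy
  refine eq_top_iff.2 fun z _ => ?_
  have : z = (z : A) • (⟨e, Submodule.mem_span_singleton_self e⟩ : Submodule.span A {e}) :=
    Subtype.ext (h.mul_eq_self_of_mem z.2).symm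
  rw [this]; exact N.smul_mem _ he

/-- Every proper submodule of A e lies in ker ε. A maximal one missing x would together with x
generate everything, although ε vanishes on both. -/
lemma mem_jacobson (h : IsLocalIdempotent ε e) (x : Submodule.span A {e}) (hx : ε x = 0) :
    x ∈ Module.jacobson A (Submodule.span A {e}) := by
  rw [Module.jacobson, Submodule.mem_sInf]
  intro N hN
  have hN0 : ∀ y ∈ N, ε y = 0 := fun y hy => by
    by_contra hne
    exact hN.1 (h.eq_top_of_map_ne_zero hy hne)
  by_contra hxN
  have htop : N ⊔ Submodule.span A {x} = ⊤ := hN.2 _ (lt_of_le_of_ne le_sup_left fun heq => hxN (by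
    rw [heq]; exact Submodule.mem_sup_right (Submodule.mem_span_singleton_self x)))
  have he : (⟨e, Submodule.mem_span_singleton_self e⟩ : Submodule.span A {e}) ∈
      N ⊔ Submodule.span A {x} := by rw [htop]; trivial
  obtain ⟨y, hy, z, hz, hyz⟩ := Submodule.mem_sup.1 he
  obtain ⟨a, rfl⟩ := Submodule.mem_span_singleton.1 hz
  have h1 := congrArg (fun w : Submodule.span A {e} => ε w) hyz
  simp [hN0 y hy, hx, h.map_eq_one] at h1

section Trivial

variable {M : Type*} [AddCommGroup M] [Module A M] {τ : A →ₗ[A] M}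

lemma isProjectiveCover (h : IsLocalIdempotent ε e) (hτ : Function.Surjective τ)
    (hker : ∀ a, τ a = 0 ↔ ε a = 0) :
    IsProjectiveCover (τ ∘ₗ (Submodule.span A {e}).subtype) where
  projective := h.projective
  surjective m := by
    obtain ⟨a, rfl⟩ := hτ m
    refine ⟨h.proj a, ?_⟩
    rw [LinearMap.comp_apply, Submodule.subtype_apply, coe_proj, ← sub_eq_zero, ← map_sub, hker]
    simp [h.map_eq_one]
  ker_le x hx := h.mem_jacobson x ((hker _).1 hx)

/-- Uniqueness of projective covers: lifting in both directions gives maps that are surjective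
modulo the radical, hence surjective, so the dimensions agree. -/
lemma finrank_eq_of_isProjectiveCover [Module.Finite F A] (h : IsLocalIdempotent ε e)
    (hτ : Function.Surjective τ) (hker : ∀ a, τ a = 0 ↔ ε a = 0) {Q : Type*} [AddCommGroup Q]
    [Module F Q] [Module A Q] [IsScalarTower F A Q] [Module.Finite F Q] {π : Q →ₗ[A] M}
    (hπ : IsProjectiveCover π) :
    Module.finrank F Q = Module.finrank F (Submodule.span A {e}) := by
  have hc := h.isProjectiveCover hτ hker
  have := hπ.projective
  have := hc.projective
  have : Module.Finite A Q := Module.Finite.of_restrictScalars_finite F A Q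
  have : Module.Finite F (Submodule.span A {e}) := Module.Finite.of_injective
    ((Submodule.span A {e}).subtype.restrictScalars F) (Submodule.injective_subtype _)
  obtain ⟨f, hf⟩ := Module.projective_lifting_property _ π hc.surjective
  obtain ⟨g, hg⟩ := Module.projective_lifting_property π
    (τ ∘ₗ (Submodule.span A {e}).subtype) hπ.surjective
  have hf1 : Function.Surjective f := by
    obtain ⟨x, hx⟩ := hπ.surjective (τ 1)
    rw [← LinearMap.range_eq_top]
    refine h.eq_top_of_map_ne_zero ⟨x, rfl⟩ fun h0 => ?_
    have h1 := LinearMap.congr_fun hf x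
    rw [hx, LinearMap.comp_apply, LinearMap.comp_apply, Submodule.subtype_apply,
      (hker _).2 h0] at h1
    have := (hker 1).1 h1.symm
    simp at this
  have hg1 : Function.Surjective g := by
    rw [← LinearMap.range_eq_top]
    refine eq_top_of_sup_jacobson (top_le_iff.1 (le_trans ?_ (sup_le_sup_left hπ.ker_le _)))
    intro x _
    obtain ⟨y, hy⟩ := hc.surjective (π x)
    refine Submodule.mem_sup.2 ⟨g y, ⟨y, rfl⟩, x - g y, ?_, add_sub_cancel _ _⟩
    rw [LinearMap.mem_ker, map_sub, ← hy, ← hg, LinearMap.comp_apply, sub_self]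
  exact le_antisymm
    ((g.restrictScalars F).finrank_le_finrank_of_surjective hg1)
    ((f.restrictScalars F).finrank_le_finrank_of_surjective hf1)

end Trivial

end IsLocalIdempotent

end LocalIdempotent

namespace PMap

variable {p : ℕ} [Fact p.Prime] {F : Type u} {L : Type v} [Field F] [LieRing L]
  [LieAlgebra F L] [FiniteDimensional F L]

/-- Having maximal `0`-PIM, in terms of an idempotent that generates the projective cover. -/
lemma hasMaximalZeroPIM_iff (P : PMap p F L) {e : P.Enveloping}
    (he : IsLocalIdempotent P.augmentation e) :
    P.HasMaximalZeroPIM ↔ Module.finrank F (Submodule.span P.Enveloping {e})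
      = p ^ (Module.finrank F L - P.maxTorusDim) := by
  let τ : P.Enveloping →ₗ[P.Enveloping] P.TrivialModule :=
    { toFun := P.augmentation
      map_add' := map_add P.augmentation
      map_smul' := fun a b => map_mul P.augmentation a b }
  have hτ : Function.Surjective τ := fun r =>
    ⟨algebraMap F _ r, P.augmentation.commutes r⟩
  have hker : ∀ a, τ a = 0 ↔ P.augmentation a = 0 := fun a => Iff.rfl
  constructor
  · rintro ⟨Q, i1, i2, i3, i4, π, hπ, hQ⟩
    -- `finrank` is 0 on infinite-dimensional spaces, so the prescribed positive value forces Q to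
    -- be finite-dimensional.
    have : Module.Finite F Q := Module.finite_of_finrank_pos (by
      rw [hQ]; exact pow_pos (Fact.out : p.Prime).pos _)
    rw [← hQ, he.finrank_eq_of_isProjectiveCover hτ hker hπ]
  · intro h
    exact ⟨Submodule.span P.Enveloping {e}, inferInstance, inferInstance, inferInstance,
      inferInstance, _, he.isProjectiveCover hτ hker, h⟩

end PMap

end RestrictedLie

namespace RestrictedLie

/-! ### Multiplicativity of the dimension of the projective cover -/

section Multiplicativity

variable {F A B C : Type*} [Field F] [Ring A] [Algebra F A] [Ring B] [Algebra F B] [Ring C]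
  [Algebra F C]

lemma IsLocalIdempotent.map {εA : A →ₐ[F] F} {εC : C →ₐ[F] F} {f : A}
    (hf : IsLocalIdempotent εA f) (q : A →ₐ[F] C) (hq : Function.Surjective q)
    (hε : ∀ a, εC (q a) = εA a) : IsLocalIdempotent εC (q f) where
  mul_self := by rw [← map_mul, hf.mul_self]
  map_eq_one := by rw [hε, hf.map_eq_one]
  exists_mul_eq b hb := by
    obtain ⟨a, rfl⟩ := hq b
    obtain ⟨c, hc⟩ := hf.exists_mul_eq a (by rwa [hε] at hb)
    exact ⟨q c, by rw [← map_mul, ← map_mul, hc]⟩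

/-- An element of the power of `B e` all of whose coordinates are killed by the augmentation lies in
the radical. -/
lemma IsLocalIdempotent.mem_jacobson_pi {εB : B →ₐ[F] F} {e : B} (he : IsLocalIdempotent εB e)
    {κ : Type*} [Fintype κ] [DecidableEq κ] (w : κ → Submodule.span B {e})
    (hw : ∀ k, εB (w k) = 0) : w ∈ Module.jacobson B (κ → Submodule.span B {e}) := by
  have hsum : w = ∑ k, LinearMap.single B (fun _ => Submodule.span B {e}) k (w k) := by
    ext k
    simp [Finset.sum_apply, Pi.single_apply]
  rw [hsum]
  exact sum_mem fun k _ => Module.map_jacobson_le _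
    (Submodule.mem_map_of_mem (he.mem_jacobson (w k) (hw k)))

/-- The dimension of the projective cover of the trivial module is multiplicative along
`B → A → C`. -/
theorem finrank_span_eq_mul [Module.Finite F A] [Module.Finite F B] [Module.Finite F C]
    [Module B A] [IsScalarTower F B A] [IsScalarTower B A A]
    [Module.Projective B A] {εA : A →ₐ[F] F} {εB : B →ₐ[F] F}
    (j : B →ₐ[F] A) (q : A →ₐ[F] C) (hsmul : ∀ b a, b • a = j b * a)
    (hεj : ∀ b, εA (j b) = εB b)
    (hq : Function.Surjective q)
    (hqj : ∀ b, q (j b) = algebraMap F C (εB b))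
    {e : B} {f : A} (he : IsLocalIdempotent εB e) (hf : IsLocalIdempotent εA f)
    (hgen : ∀ a, a * j e ∈ Submodule.span F {x | ∃ b a', j b * (j e * a') = x})
    (hker : ∀ a, q a = 0 → a ∈ Submodule.span F {x | ∃ b a', εB b = 0 ∧ j b * a' = x}) :
    Module.finrank F (Submodule.span A {f}) =
      Module.finrank F (Submodule.span B {e}) * Module.finrank F (Submodule.span C {q f}) := by
  let rf : A →ₗ[B] A :=
    { toFun := fun a => a * f
      map_add' := fun a b => add_mul a b f
      map_smul' := fun b a => smul_mul_assoc b a f }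
  set Q : Submodule B A := LinearMap.range rf with hQ
  have hQmem : ∀ a, a * f ∈ Q := fun a => ⟨a, rfl⟩
  have hQf : ∀ y ∈ Q, y * f = y := by
    rintro _ ⟨a, rfl⟩
    change a * f * f = a * f
    rw [mul_assoc, hf.mul_self]
  -- Q = A f is a direct summand of the B-projective module A, split by right multiplication by f.
  have hproj : Module.Projective B Q := Module.Projective.of_split Q.subtype rf.rangeRestrict <| by
    ext y
    exact hQf y y.2
  have hfinB : Module.Finite F (Submodule.span B {e}) := Module.Finite.of_injective
    ((Submodule.span B {e}).subtype.restrictScalars F) (Submodule.injective_subtype _)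
  have hfinQ : Module.Finite F Q := Module.Finite.of_injective
    (Q.subtype.restrictScalars F) (Submodule.injective_subtype _)
  have : Module.Finite B Q := Module.Finite.of_restrictScalars_finite F B Q
  have : Module.Finite B (Submodule.span B {e}) := Module.Finite.of_restrictScalars_finite F B _
  have hrank : Module.finrank F (Submodule.span A {f}) = Module.finrank F Q := by
    have h : (Submodule.span A {f}).restrictScalars F = Q.restrictScalars F := by
      ext y
      simp only [Submodule.restrictScalars_mem, Submodule.mem_span_singleton, hQ, LinearMap.mem_range]
      rfl
    exact congrArg (fun W : Submodule F A => Module.finrank F W) h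
  rw [hrank]
  -- the coinvariants of `A f`
  have hfinC : Module.Finite F (Submodule.span C {q f}) := Module.Finite.of_injective
    ((Submodule.span C {q f}).subtype.restrictScalars F) (Submodule.injective_subtype _)
  let β := Module.finBasis F (Submodule.span C {q f})
  have hqQ : ∀ y ∈ Q, q y ∈ Submodule.span C {q f} := fun y hy => by
    rw [← hQf y hy, map_mul]
    exact Submodule.smul_mem _ (q y) (Submodule.mem_span_singleton_self _)
  let qQ : Q →ₗ[F] Submodule.span C {q f} :=
    { toFun := fun y => ⟨q y, hqQ y y.2⟩
      map_add' := fun y z => Subtype.ext (map_add q _ _)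
      map_smul' := fun a y => Subtype.ext (map_smul q a _) }
  have hqQsmul : ∀ (b : B) (y : Q), qQ (b • y) = εB b • qQ y := fun b y => Subtype.ext <| by
    change q (b • (y : A)) = εB b • q y
    rw [hsmul, map_mul, hqj, Algebra.smul_def]
  have hqQsurj : Function.Surjective qQ := by
    rintro ⟨z, hz⟩
    obtain ⟨d, rfl⟩ := Submodule.mem_span_singleton.1 hz
    obtain ⟨a, rfl⟩ := hq d
    exact ⟨⟨a * f, hQmem a⟩, Subtype.ext (map_mul q a f)⟩
  choose y₀ hy₀ using fun i => hqQsurj (β i)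
  -- Multiplying the lifts by e leaves their images unchanged, as ε(e) = 1, and makes e • y_i = y_i,
  -- so that e in the i-th summand is sent to y_i.
  set y : Fin (Module.finrank F (Submodule.span C {q f})) → Q := fun i => e • y₀ i with hy
  have hqy : ∀ i, qQ (y i) = β i := fun i => by
    rw [hy, hqQsmul, he.map_eq_one, one_smul, hy₀]
  have hey : ∀ i, e • y i = y i := fun i => by rw [hy, smul_smul, he.mul_self]
  -- `B e ⊗ coinvariants → A f`
  let φ : (Fin (Module.finrank F (Submodule.span C {q f})) → Submodule.span B {e}) →ₗ[B] Q :=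
    ∑ i, (LinearMap.toSpanSingleton B Q (y i)) ∘ₗ (Submodule.span B {e}).subtype ∘ₗ
      LinearMap.proj i
  have hφ : ∀ w, φ w = ∑ i, (w i : B) • y i := fun w => by simp [φ]
  have hφsurj : Function.Surjective φ := by
    rw [← LinearMap.range_eq_top]
    refine eq_top_of_sup_jacobson (eq_top_iff.2 fun x _ => ?_)
    have hjac : ∀ (b : B) (z : Q), εB b = 0 → b • (e • z) ∈ Module.jacobson B Q := by
      intro b z hb
      have h := Module.map_jacobson_le
        ((LinearMap.toSpanSingleton B Q z) ∘ₗ (Submodule.span B {e}).subtype)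
        (Submodule.mem_map_of_mem (he.mem_jacobson
          ⟨b * e, Submodule.smul_mem _ b (Submodule.mem_span_singleton_self e)⟩ (by simp [hb])))
      rw [smul_smul]
      exact h
    -- Since c (j(e) f) = f for some c, every a in Q is (a c) j(e) f, and `hgen` moves e to the
    -- left. So Q is generated by e Q over B.
    have hQe : ∀ a : A, a ∈ Q →
        a ∈ Submodule.span F {x | ∃ (b : B) (z : Q), b • (e • (z : A)) = x} := by
      intro a ha
      obtain ⟨c, hc⟩ := hf.exists_mul_eq (j e) (by rw [hεj, he.map_eq_one]; exact one_ne_zero)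
      have ha' : a = (LinearMap.mulRight F f) ((a * c) * j e) := by
        rw [LinearMap.mulRight_apply, mul_assoc, mul_assoc, hc, hQf a ha]
      rw [ha']
      have h := Submodule.mem_map_of_mem (f := LinearMap.mulRight F f) (hgen (a * c))
      rw [Submodule.map_span] at h
      refine Submodule.span_mono ?_ h
      rintro _ ⟨_, ⟨b, a', rfl⟩, rfl⟩
      refine ⟨b, ⟨a' * f, hQmem a'⟩, ?_⟩
      simp only [hsmul, LinearMap.mulRight_apply, mul_assoc]
    -- An element killed by q lies in B⁺ Q, where B⁺ = ker ε_B. As Q = B e Q, it is a combination of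
    -- images of elements b e with ε_B(b) = 0, which are radical in B e.
    have hkerjac : ∀ z : Q, qQ z = 0 → z ∈ Module.jacobson B Q := by
      intro z hz
      have h1 := hker z (congrArg Subtype.val hz)
      have h2 := Submodule.mem_map_of_mem (f := LinearMap.mulRight F f) h1
      rw [LinearMap.mulRight_apply, hQf z z.2, Submodule.map_span] at h2
      have h3 : (z : A) ∈ ((Module.jacobson B Q).map Q.subtype).restrictScalars F := by
        refine Submodule.span_le.2 ?_ h2
        rintro _ ⟨_, ⟨b, a', hb, rfl⟩, rfl⟩
        have h4 := hQe (a' * f) (hQmem a')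
        have h5 : LinearMap.mulLeft F (j b) (a' * f) ∈
            ((Module.jacobson B Q).map Q.subtype).restrictScalars F := by
          have h6 := Submodule.mem_map_of_mem (f := LinearMap.mulLeft F (j b)) h4
          rw [Submodule.map_span] at h6
          refine Submodule.span_le.2 ?_ h6
          rintro _ ⟨_, ⟨b', z', rfl⟩, rfl⟩
          refine ⟨(b * b') • (e • z'), hjac _ _ (by rw [map_mul, hb, zero_mul]), ?_⟩
          rw [LinearMap.mulLeft_apply, ← hsmul, mul_smul]
          rfl
        rw [LinearMap.mulLeft_apply, ← mul_assoc] at h5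
        exact h5
      obtain ⟨z', hz', hzz⟩ := h3
      rwa [← Subtype.ext hzz]
    refine Submodule.mem_sup.2 ⟨∑ i, (β.repr (qQ x) i) • y i, sum_mem fun i _ => ?_, x - _,
      hkerjac _ ?_, add_sub_cancel _ _⟩
    · refine ⟨Pi.single i ⟨(β.repr (qQ x) i) • e, ?_⟩, ?_⟩
      · exact Submodule.smul_of_tower_mem _ _ (Submodule.mem_span_singleton_self e)
      · rw [hφ, Finset.sum_eq_single i]
        · rw [Pi.single_eq_same, smul_assoc, hey]
        · intro k _ hk
          rw [Pi.single_eq_of_ne hk]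
          exact zero_smul _ _
        · simp
    · rw [map_sub, map_sum]
      simp only [map_smul, hqy]
      rw [β.sum_repr, sub_self]
  -- Projectivity of Q lifts the coordinates of `qQ`, viewed in the trivial module B ⧸ m, to maps
  -- ψ_i : Q → B e. Then ψ ∘ φ is the identity modulo the radical, so it is surjective by Nakayama
  -- and injective by dimension.
  have hφinj : Function.Injective φ := by
    let m : Submodule B B := LinearMap.ker
      ({ toFun := εB, map_add' := map_add εB, map_smul' := fun b b' => map_mul εB b b' } :
        B →ₛₗ[(εB : B →+* F)] F)
    have hm : ∀ b, b ∈ m ↔ εB b = 0 := fun b => LinearMap.mem_ker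
    let θ : Submodule.span B {e} →ₗ[B] B ⧸ m := m.mkQ ∘ₗ (Submodule.span B {e}).subtype
    have hθ : Function.Surjective θ := by
      intro z
      obtain ⟨b, rfl⟩ := m.mkQ_surjective z
      refine ⟨he.proj b, (Submodule.Quotient.eq m).2 ((hm _).2 ?_)⟩
      simp [he.coe_proj, he.map_eq_one]
    let lam : Fin (Module.finrank F (Submodule.span C {q f})) → Q →ₗ[B] B ⧸ m := fun i =>
      { toFun := fun z => m.mkQ (algebraMap F B (β.repr (qQ z) i))
        map_add' := fun z z' => by simp
        map_smul' := fun b z => by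
          rw [hqQsmul]
          refine (Submodule.Quotient.eq m).2 ((hm _).2 ?_)
          simp }
    choose ψ hψ using fun i => Module.projective_lifting_property θ (lam i) hθ
    have hψε : ∀ i z, εB (ψ i z) = β.repr (qQ z) i := by
      intro i z
      have h := LinearMap.congr_fun (hψ i) z
      have h' := (hm _).1 ((Submodule.Quotient.eq m).1 h)
      rw [map_sub, AlgHom.commutes, sub_eq_zero] at h'
      exact h'
    have hsurj : Function.Surjective ((LinearMap.pi ψ) ∘ₗ φ) := by
      rw [← LinearMap.range_eq_top]
      refine eq_top_of_sup_jacobson (eq_top_iff.2 fun w _ => ?_)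
      refine Submodule.mem_sup.2 ⟨_, ⟨w, rfl⟩, w - _, he.mem_jacobson_pi _ fun k => ?_,
        add_sub_cancel _ _⟩
      rw [Pi.sub_apply, LinearMap.comp_apply, LinearMap.pi_apply, Submodule.coe_sub, map_sub, hψε,
        hφ, map_sum, map_sum, Finset.sum_apply', Finset.sum_eq_single k]
      · rw [hqQsmul, hqy, map_smul]
        simp
      · intro i _ hi
        rw [hqQsmul, hqy, map_smul]
        simp [hi]
      · simp
    have hinj := LinearMap.injective_iff_surjective.2
      (show Function.Surjective (((LinearMap.pi ψ) ∘ₗ φ).restrictScalars F) from hsurj)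
    intro w w' hww
    exact hinj (congrArg (LinearMap.pi ψ) hww)
  have h := (LinearEquiv.ofBijective (φ.restrictScalars F) ⟨hφinj, hφsurj⟩).finrank_eq
  rw [← h, Module.finrank_pi_fintype]
  simp [mul_comm]

end Multiplicativity

end RestrictedLie

/-! ### The sequence u(I) → u(L) → u(L/I) of a p-ideal -/

namespace RestrictedLie
namespace PMap

variable {p : ℕ} [Fact p.Prime] {F : Type u} {L : Type v} [Field F] [CharP F p] [LieRing L]
  [LieAlgebra F L]

lemma exists_restrictHom (P : PMap p F L) (I : LieIdeal F L) (hI : P.IsPIdeal I) :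
    ∃ j : (P.restrict I hI).Enveloping →ₐ[F] P.Enveloping,
      ∀ x : I, j ((P.restrict I hI).incl x) = P.incl x :=
  (P.restrict I hI).exists_envelopingHom (P.incl ∘ₗ I.toSubmodule.subtype)
    (fun x y => P.incl_lie x y) (fun x => P.incl_pow x)

lemma exists_quotientHom (P : PMap p F L) (I : LieIdeal F L) (hI : P.IsPIdeal I) :
    ∃ q : P.Enveloping →ₐ[F] (P.quotient I hI).Enveloping,
      ∀ x : L, q (P.incl x) = (P.quotient I hI).incl (LieSubmodule.Quotient.mk x) :=
  P.exists_envelopingHom ((P.quotient I hI).incl ∘ₗ I.toSubmodule.mkQ)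
    (fun x y => (P.quotient I hI).incl_lie (LieSubmodule.Quotient.mk x) (LieSubmodule.Quotient.mk y))
    (fun x => (P.quotient I hI).incl_pow (LieSubmodule.Quotient.mk x))

lemma mul_mem_of_incl_mul_mem (P : PMap p F L) (W : Submodule F P.Enveloping)
    (h : ∀ x, ∀ w ∈ W, P.incl x * w ∈ W) (a : P.Enveloping) : ∀ w ∈ W, a * w ∈ W := by
  have ha : a ∈ Algebra.adjoin F (Set.range P.incl) := by rw [P.adjoin_range_incl]; trivial
  induction ha using Algebra.adjoin_induction with
  | mem a ha => obtain ⟨x, rfl⟩ := ha; exact h x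
  | algebraMap r =>
    intro w hw
    rw [← Algebra.smul_def]; exact W.smul_mem r hw
  | add a b _ _ ha hb => intro w hw; rw [add_mul]; exact add_mem (ha w hw) (hb w hw)
  | mul a b _ _ ha hb => intro w hw; rw [mul_assoc]; exact ha _ (hb w hw)

section Ideal

variable (P : PMap p F L) (I : LieIdeal F L) (hI : P.IsPIdeal I)
  {j : (P.restrict I hI).Enveloping →ₐ[F] P.Enveloping}
  {q : P.Enveloping →ₐ[F] (P.quotient I hI).Enveloping}

lemma augmentation_restrictHom (hj : ∀ x : I, j ((P.restrict I hI).incl x) = P.incl x)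
    (b : (P.restrict I hI).Enveloping) :
    P.augmentation (j b) = (P.restrict I hI).augmentation b := by
  have h : P.augmentation.comp j = (P.restrict I hI).augmentation :=
    (P.restrict I hI).envelopingHom_ext fun x => by
      rw [AlgHom.comp_apply, hj, augmentation_incl, augmentation_incl]
  exact DFunLike.congr_fun h b

lemma augmentation_quotientHom
    (hq : ∀ x : L, q (P.incl x) = (P.quotient I hI).incl (LieSubmodule.Quotient.mk x))
    (a : P.Enveloping) : (P.quotient I hI).augmentation (q a) = P.augmentation a := by
  have h : (P.quotient I hI).augmentation.comp q = P.augmentation :=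
    P.envelopingHom_ext fun x => by
      rw [AlgHom.comp_apply, hq, augmentation_incl, augmentation_incl]
  exact DFunLike.congr_fun h a

lemma quotientHom_surjective
    (hq : ∀ x : L, q (P.incl x) = (P.quotient I hI).incl (LieSubmodule.Quotient.mk x)) :
    Function.Surjective q := by
  rw [← AlgHom.range_eq_top, eq_top_iff, ← (P.quotient I hI).adjoin_range_incl, Algebra.adjoin_le_iff]
  rintro _ ⟨x, rfl⟩
  obtain ⟨x, rfl⟩ := LieSubmodule.Quotient.surjective_mk' I x
  exact ⟨P.incl x, hq x⟩

lemma quotientHom_restrictHom (hj : ∀ x : I, j ((P.restrict I hI).incl x) = P.incl x)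
    (hq : ∀ x : L, q (P.incl x) = (P.quotient I hI).incl (LieSubmodule.Quotient.mk x))
    (b : (P.restrict I hI).Enveloping) :
    q (j b) = algebraMap F _ ((P.restrict I hI).augmentation b) := by
  have h : q.comp j = (Algebra.ofId F _).comp (P.restrict I hI).augmentation :=
    (P.restrict I hI).envelopingHom_ext fun x => by
      have h0 : (LieSubmodule.Quotient.mk (x : L) : L ⧸ I) = 0 :=
        (LieSubmodule.Quotient.mk_eq_zero' (N := I)).2 x.2
      rw [AlgHom.comp_apply, hj, hq, AlgHom.comp_apply, augmentation_incl, map_zero, h0, map_zero]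
  exact DFunLike.congr_fun h b

/-- ad(x) is a derivation and maps the generators I into I, so it preserves the subalgebra that they
generate. -/
lemma exists_commutator_eq (hj : ∀ x : I, j ((P.restrict I hI).incl x) = P.incl x) (x : L)
    (b : (P.restrict I hI).Enveloping) : ∃ b', P.incl x * j b - j b * P.incl x = j b' := by
  have hb : b ∈ Algebra.adjoin F (Set.range (P.restrict I hI).incl) := by
    rw [(P.restrict I hI).adjoin_range_incl]; trivial
  induction hb using Algebra.adjoin_induction with
  | mem b hb =>
    obtain ⟨y, rfl⟩ := hb
    refine ⟨(P.restrict I hI).incl ⟨⁅x, (y : L)⁆, lie_mem_right F L I x y y.2⟩, ?_⟩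
    rw [hj, hj, P.incl_lie]
  | algebraMap r => exact ⟨0, by rw [AlgHom.commutes, Algebra.commutes, sub_self, map_zero]⟩
  | add a b _ _ ha hb =>
    obtain ⟨a', ha'⟩ := ha
    obtain ⟨b', hb'⟩ := hb
    exact ⟨a' + b', by rw [map_add, map_add, ← ha', ← hb', mul_add, add_mul]; abel⟩
  | mul a b _ _ ha hb =>
    obtain ⟨a', ha'⟩ := ha
    obtain ⟨b', hb'⟩ := hb
    refine ⟨a' * b + a * b', ?_⟩
    rw [map_mul, map_add, map_mul, map_mul, ← ha', ← hb']
    noncomm_ring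

/-- A derivation satisfies de = (de) e + e (de) on an idempotent e. Hence the span of B e A is
stable under left multiplication by L; it contains e. -/
lemma mul_idempotent_mem_span (hj : ∀ x : I, j ((P.restrict I hI).incl x) = P.incl x)
    {e : (P.restrict I hI).Enveloping} (he : e * e = e) (a : P.Enveloping) :
    a * j e ∈ Submodule.span F {x | ∃ b a', j b * (j e * a') = x} := by
  refine P.mul_mem_of_incl_mul_mem _ (fun x w hw => ?_) a _
    (Submodule.subset_span ⟨1, 1, by simp⟩)
  obtain ⟨d, hd⟩ := P.exists_commutator_eq I hI hj x e
  have hd' : j d = j d * j e + j e * j d := by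
    rw [← hd]
    conv_lhs => rw [← he, map_mul]
    noncomm_ring
  have hxe : P.incl x * j e = j e * P.incl x + j d * j e + j e * j d := by
    rw [add_assoc, ← hd', ← hd]; abel
  induction hw using Submodule.span_induction with
  | mem w hw =>
    obtain ⟨b, a', rfl⟩ := hw
    obtain ⟨b', hb'⟩ := P.exists_commutator_eq I hI hj x b
    have hxb : P.incl x * j b = j b * P.incl x + j b' := by rw [← hb']; abel
    have e1 : P.incl x * (j b * (j e * a')) = j b * (j e * (P.incl x * a'))
        + j (b * d) * (j e * a') + j b * (j e * (j d * a')) + j b' * (j e * a') := by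
      calc P.incl x * (j b * (j e * a')) = (P.incl x * j b) * (j e * a') := by
            simp only [mul_assoc]
        _ = j b * ((P.incl x * j e) * a') + j b' * (j e * a') := by
            rw [hxb]; simp only [add_mul, mul_assoc]
        _ = _ := by rw [hxe, map_mul]; simp only [add_mul, mul_add, mul_assoc]
    rw [e1]
    exact add_mem (add_mem (add_mem (Submodule.subset_span ⟨b, _, rfl⟩)
      (Submodule.subset_span ⟨b * d, _, rfl⟩)) (Submodule.subset_span ⟨b, _, rfl⟩))
      (Submodule.subset_span ⟨b', _, rfl⟩)
  | zero => simp
  | add w w' _ _ hw hw' => rw [mul_add]; exact add_mem hw hw'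
  | smul r w _ hw => rw [mul_smul_comm]; exact Submodule.smul_mem _ r hw

/-- A homomorphism from `u(L)` that kills `I` factors through `u(L/I)`. -/
lemma eq_zero_of_quotientHom_eq_zero
    (hq : ∀ x : L, q (P.incl x) = (P.quotient I hI).incl (LieSubmodule.Quotient.mk x))
    {A : Type*} [Ring A] [Algebra F A] (Λ : P.Enveloping →ₐ[F] A) (hΛ : ∀ x ∈ I, Λ (P.incl x) = 0)
    {a : P.Enveloping} (ha : q a = 0) : Λ a = 0 := by
  have hρI : I.toSubmodule ≤ LinearMap.ker (Λ.toLinearMap ∘ₗ P.incl) := fun x hx => hΛ x hx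
  obtain ⟨g, hg⟩ := (P.quotient I hI).exists_envelopingHom (I.toSubmodule.liftQ _ hρI)
    (fun x y => by
      obtain ⟨x, rfl⟩ := LieSubmodule.Quotient.surjective_mk' I x
      obtain ⟨y, rfl⟩ := LieSubmodule.Quotient.surjective_mk' I y
      have h := congrArg Λ (P.incl_lie x y)
      rw [map_sub, map_mul, map_mul] at h
      exact h)
    (fun x => by
      obtain ⟨x, rfl⟩ := LieSubmodule.Quotient.surjective_mk' I x
      have h := congrArg Λ (P.incl_pow x)
      rw [map_pow] at h
      exact h)
  have hgq : g.comp q = Λ := P.envelopingHom_ext fun x => by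
    rw [AlgHom.comp_apply, hq, hg]; rfl
  rw [← hgq, AlgHom.comp_apply, ha, map_zero]

/-- The span B⁺ A, with B⁺ the augmentation ideal of B = `u(I)` and A = `u(L)`, is a left ideal
because commutators with L preserve B⁺. I annihilates the quotient A / B⁺ A, so the action there
factors through `u(L/I)` and an element of ker q kills the class of 1. -/
lemma mem_span_of_quotientHom_eq_zero (hj : ∀ x : I, j ((P.restrict I hI).incl x) = P.incl x)
    (hq : ∀ x : L, q (P.incl x) = (P.quotient I hI).incl (LieSubmodule.Quotient.mk x))
    {a : P.Enveloping} (ha : q a = 0) :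
    a ∈ Submodule.span F {x | ∃ b a', (P.restrict I hI).augmentation b = 0 ∧ j b * a' = x} := by
  set W := Submodule.span F {x | ∃ b a', (P.restrict I hI).augmentation b = 0 ∧ j b * a' = x} with hW
  have hstab := P.mul_mem_of_incl_mul_mem W fun x w hw => by
    induction hw using Submodule.span_induction with
    | mem w hw =>
      obtain ⟨b, a', hb, rfl⟩ := hw
      obtain ⟨b', hb'⟩ := P.exists_commutator_eq I hI hj x b
      have hb0 : (P.restrict I hI).augmentation b' = 0 := by
        rw [← P.augmentation_restrictHom I hI hj, ← hb', map_sub, map_mul, map_mul, mul_comm, sub_self]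
      have e1 : P.incl x * (j b * a') = j b * (P.incl x * a') + j b' * a' := by
        rw [← hb']; noncomm_ring
      rw [e1]
      exact add_mem (Submodule.subset_span ⟨b, _, hb, rfl⟩) (Submodule.subset_span ⟨b', _, hb0, rfl⟩)
    | zero => simp
    | add w w' _ _ hw hw' => rw [mul_add]; exact add_mem hw hw'
    | smul r w _ hw => rw [mul_smul_comm]; exact Submodule.smul_mem _ r hw
  let K : Submodule P.Enveloping P.Enveloping :=
    { W with smul_mem' := fun c x hx => hstab c x hx }
  have hΛ : ∀ x ∈ I, Algebra.lsmul F F (P.Enveloping ⧸ K) (P.incl x) = 0 := by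
    intro x hx
    refine LinearMap.ext fun m => ?_
    obtain ⟨m, rfl⟩ := K.mkQ_surjective m
    have hm : P.incl x * m ∈ K := Submodule.subset_span
      ⟨(P.restrict I hI).incl ⟨x, hx⟩, m, augmentation_incl _ _, by rw [hj]⟩
    change P.incl x • K.mkQ m = 0
    rw [← map_smul, smul_eq_mul, Submodule.mkQ_apply]
    exact (Submodule.Quotient.mk_eq_zero K).2 hm
  have h1 := P.eq_zero_of_quotientHom_eq_zero I hI hq _ hΛ ha
  have h2 : a • K.mkQ 1 = 0 := LinearMap.congr_fun h1 (K.mkQ 1)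
  rw [← map_smul, smul_eq_mul, mul_one, Submodule.mkQ_apply] at h2
  exact (Submodule.Quotient.mk_eq_zero K).1 h2

lemma monSpan_le_range (hj : ∀ x : I, j ((P.restrict I hI).incl x) = P.incl x) {l : List L}
    (hl : ∀ x ∈ l, x ∈ I) : P.monSpan l ≤ Subalgebra.toSubmodule j.range := by
  induction l with
  | nil =>
    have : P.monSpan [] = 1 := rfl
    rw [this, Submodule.one_le]
    exact one_mem j.range
  | cons x l ih =>
    have e : P.monSpan (x :: l) = P.powSpan x * P.monSpan l := by simp [monSpan]
    rw [e]
    have hmul : Subalgebra.toSubmodule j.range * Subalgebra.toSubmodule j.range ≤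
        Subalgebra.toSubmodule j.range := Submodule.mul_le.2 fun _ ha _ hb => j.range.mul_mem ha hb
    refine (mul_le_mul' ?_ (ih fun y hy => hl y (List.mem_cons_of_mem _ hy))).trans hmul
    refine Submodule.span_le.2 ?_
    rintro _ ⟨a, -, rfl⟩
    exact ⟨(P.restrict I hI).incl ⟨x, hl x (by simp)⟩ ^ a, by simp [hj]⟩

variable [FiniteDimensional F L]

/-- `u(L)` is projective over `u(I)`. -/
lemma projective_enveloping [Module (P.restrict I hI).Enveloping P.Enveloping]
    [IsScalarTower F (P.restrict I hI).Enveloping P.Enveloping]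
    (hj : ∀ x : I, j ((P.restrict I hI).incl x) = P.incl x)
    (hsmul : ∀ (b : (P.restrict I hI).Enveloping) (a : P.Enveloping), b • a = j b * a) :
    Module.Projective (P.restrict I hI).Enveloping P.Enveloping := by
  classical
  obtain ⟨W, hW⟩ := I.toSubmodule.exists_isCompl
  obtain ⟨l, hn, hmem, hl, -, hl0⟩ := exists_list_span_eq I.toSubmodule
  obtain ⟨l', hn', -, hl', hlen', -⟩ := exists_list_span_eq W
  have htop := P.monSpan_append_eq_top hW hn hn' hl0 hl hl'
  obtain ⟨s, hs, hspan⟩ := P.exists_monSpan_eq_span l'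
  let φ : (s → (P.restrict I hI).Enveloping) →ₗ[(P.restrict I hI).Enveloping] P.Enveloping :=
    Fintype.linearCombination _ (fun x : s => (x : P.Enveloping))
  have hsurj : Function.Surjective φ := by
    rw [← LinearMap.range_eq_top, eq_top_iff]
    have h1 : (⊤ : Submodule F P.Enveloping) ≤ (LinearMap.range φ).restrictScalars F := by
      rw [← htop, monSpan_append, hspan]
      refine Submodule.mul_le.2 fun a ha y hy => ?_
      obtain ⟨b, rfl⟩ := P.monSpan_le_range I hI hj hmem ha
      change j b * y ∈ LinearMap.range φ
      rw [← hsmul]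
      refine Submodule.smul_mem _ b ?_
      have h2 : (Submodule.span F (s : Set P.Enveloping)) ≤ (LinearMap.range φ).restrictScalars F :=
        Submodule.span_le.2 fun x hx => ⟨Pi.single ⟨x, hx⟩ 1, by
          rw [Fintype.linearCombination_apply_single, one_smul]⟩
      exact h2 hy
    exact fun x _ => h1 trivial
  -- Monomials in a complement of I give at most p^(dim L - dim I) generators over `u(I)`. By PBW
  -- the surjection φ leaves no room for a kernel, so `u(L)` is even free.
  have hdim : Module.finrank F (s → (P.restrict I hI).Enveloping) = Module.finrank F P.Enveloping := by
    apply le_antisymm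
    · rw [Module.finrank_pi_fintype, Finset.sum_const, Finset.card_univ, Fintype.card_coe,
        finrank_enveloping, finrank_enveloping, smul_eq_mul]
      refine (Nat.mul_le_mul_right _ hs).trans ?_
      rw [hlen', ← pow_add, ← Submodule.finrank_add_eq_of_isCompl hW, add_comm]
      rfl
    · exact LinearMap.finrank_le_finrank_of_surjective (f := φ.restrictScalars F) hsurj
  have hinj : Function.Injective φ :=
    (LinearMap.injective_iff_surjective_of_finrank_eq_finrank (f := φ.restrictScalars F) hdim).2 hsurj
  exact Module.Projective.of_equiv (LinearEquiv.ofBijective φ ⟨hinj, hsurj⟩)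

end Ideal

variable [FiniteDimensional F L]

/-- The dimensions of the projective covers of the trivial modules of `I`, `L` and `L/I`. -/
theorem exists_isLocalIdempotent_finrank_eq_mul (P : PMap p F L) (I : LieIdeal F L)
    (hI : P.IsPIdeal I) :
    ∃ (e : (P.restrict I hI).Enveloping) (f : P.Enveloping) (g : (P.quotient I hI).Enveloping),
      IsLocalIdempotent (P.restrict I hI).augmentation e ∧ IsLocalIdempotent P.augmentation f ∧
      IsLocalIdempotent (P.quotient I hI).augmentation g ∧
      Module.finrank F (Submodule.span P.Enveloping {f}) =
        Module.finrank F (Submodule.span (P.restrict I hI).Enveloping {e}) *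
          Module.finrank F (Submodule.span (P.quotient I hI).Enveloping {g}) := by
  obtain ⟨e, he⟩ := exists_isLocalIdempotent (P.restrict I hI).augmentation
  obtain ⟨f, hf⟩ := exists_isLocalIdempotent P.augmentation
  obtain ⟨j, hj⟩ := P.exists_restrictHom I hI
  obtain ⟨q, hq⟩ := P.exists_quotientHom I hI
  let _ : Module (P.restrict I hI).Enveloping P.Enveloping := Module.compHom _ j.toRingHom
  have hsmul : ∀ (b : (P.restrict I hI).Enveloping) (a : P.Enveloping), b • a = j b * a :=
    fun _ _ => rfl
  have : IsScalarTower F (P.restrict I hI).Enveloping P.Enveloping :=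
    ⟨fun r b a => by rw [hsmul, hsmul, map_smul, smul_mul_assoc]⟩
  have : IsScalarTower (P.restrict I hI).Enveloping P.Enveloping P.Enveloping :=
    ⟨fun b a a' => by rw [hsmul, hsmul, smul_eq_mul, smul_eq_mul, mul_assoc]⟩
  have := P.projective_enveloping I hI hj hsmul
  have hqs := P.quotientHom_surjective I hI hq
  exact ⟨e, f, q f, he, hf, hf.map q hqs (P.augmentation_quotientHom I hI hq),
    finrank_span_eq_mul j q hsmul (P.augmentation_restrictHom I hI hj) hqs
      (P.quotientHom_restrictHom I hI hj hq) he hf (P.mul_idempotent_mem_span I hI hj he.mul_self)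
      (fun a ha => P.mem_span_of_quotientHom_eq_zero I hI hj hq ha)⟩

end PMap
end RestrictedLie

/-! ### A torus bounds the projective cover of the trivial module -/

namespace RestrictedLie
namespace PMap

open Polynomial

variable {p : ℕ} [Fact p.Prime] {F : Type u} {L : Type v} [Field F] [LieRing L]
  [LieAlgebra F L]

lemma toFun_zero (P : PMap p F L) : P.toFun 0 = 0 := by
  have := P.smul_toFun 0 0
  rwa [zero_smul, zero_pow (Fact.out : p.Prime).ne_zero, zero_smul] at this

lemma mem_pSpan (P : PMap p F L) {S : Set L} {x : L} :
    x ∈ P.pSpan S ↔ ∀ K : LieSubalgebra F L, S ⊆ K → P.IsPSubalgebra K → x ∈ K := by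
  rw [pSpan, ← SetLike.mem_coe, LieSubalgebra.coe_sInf]
  simp only [Set.mem_iInter, Set.mem_ofPred_eq, and_imp, SetLike.mem_coe]

lemma subset_pSpan (P : PMap p F L) (S : Set L) : S ⊆ P.pSpan S := fun _ hx =>
  P.mem_pSpan.2 fun _ hK _ => hK hx

lemma pSpan_le (P : PMap p F L) {S : Set L} {K : LieSubalgebra F L} (hS : S ⊆ K)
    (hK : P.IsPSubalgebra K) : P.pSpan S ≤ K := sInf_le ⟨hS, hK⟩

lemma isPSubalgebra_pSpan (P : PMap p F L) (S : Set L) : P.IsPSubalgebra (P.pSpan S) :=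
  fun x hx => P.mem_pSpan.2 fun K hS hK => hK x (P.mem_pSpan.1 hx K hS hK)

/-- In every restricted representation, a semisimple element is a multiple of its square by a
polynomial in itself. -/
lemma IsSemisimpleElement.exists_aeval {P : PMap p F L} {t : L} (ht : P.IsSemisimpleElement t)
    {A : Type*} [Ring A] [Algebra F A] (ρ : L →ₗ[F] A)
    (hlie : ∀ x y, ρ ⁅x, y⁆ = ρ x * ρ y - ρ y * ρ x) (hpow : ∀ x, ρ x ^ p = ρ (P.toFun x)) :
    ∃ f : F[X], ρ t = aeval (ρ t) (X ^ 2 * f) := by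
  -- The elements represented in ρ(t)² F[ρ(t)] form a p-subalgebra. It contains t^[p] because p ≥ 2,
  -- hence also t.
  let K : LieSubalgebra F L :=
    { carrier := {y | ∃ f : F[X], ρ y = aeval (ρ t) (X ^ 2 * f)}
      add_mem' := by
        rintro x y ⟨f, hf⟩ ⟨g, hg⟩
        exact ⟨f + g, by rw [map_add, hf, hg, ← map_add, mul_add]⟩
      zero_mem' := ⟨0, by simp⟩
      smul_mem' := by
        rintro c x ⟨f, hf⟩
        exact ⟨c • f, by rw [map_smul, hf, ← map_smul, mul_smul_comm]⟩
      lie_mem' := by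
        rintro x y ⟨f, hf⟩ ⟨g, hg⟩
        refine ⟨0, ?_⟩
        rw [hlie, hf, hg, ← map_mul, ← map_mul, mul_comm, sub_self, mul_zero, map_zero] }
  have h2 := (Fact.out : p.Prime).two_le
  refine P.pSpan_le (K := K) ?_ ?_ ht
  · rintro _ rfl
    refine ⟨X ^ (p - 2), ?_⟩
    rw [← pow_add, Nat.add_sub_cancel' h2, ← hpow, map_pow, aeval_X]
  · rintro x ⟨f, hf⟩
    refine ⟨(X ^ 2) ^ (p - 1) * f ^ p, ?_⟩
    have hp : p = p - 1 + 1 := by omega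
    rw [← hpow, hf, ← map_pow, ← mul_assoc, ← pow_succ', ← hp, mul_pow]

lemma IsSemisimpleElement.exists_ad (P : PMap p F L) {t : L} (ht : P.IsSemisimpleElement t) :
    ∃ f : F[X], LieAlgebra.ad F L t = aeval (LieAlgebra.ad F L t) (X ^ 2 * f) :=
  ht.exists_aeval (LieAlgebra.ad F L : L →ₗ[F] Module.End F L)
    (fun x y => LinearMap.ext fun z => lie_lie x y z)
    (fun x => LinearMap.ext fun y => (P.ad_toFun x y).symm)

lemma commute_aeval {A : Type*} [Ring A] [Algebra F A] {a b : A} (h : Commute a b) (f : F[X]) :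
    Commute a (aeval b f) := by
  have hb : aeval b f ∈ Algebra.adjoin F {b} := aeval_mem_adjoin_singleton F b
  generalize aeval b f = c at hb
  induction hb using Algebra.adjoin_induction with
  | mem x hx => rw [Set.mem_singleton_iff.1 hx]; exact h
  | algebraMap r => exact (Algebra.commutes r a).symm
  | add x y _ _ hx hy => exact hx.add_right hy
  | mul x y _ _ hx hy => exact hx.mul_right hy

/-- If x = x² f(x) in `u(L)`, then 1 - x f(x) is annihilated by x and has augmentation 1. The
product of these commuting factors serves for the whole list. -/
lemma exists_augmentation_eq_one (P : PMap p F L) {l : List L}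
    (hss : ∀ x ∈ l, P.IsSemisimpleElement x) (hcomm : ∀ x ∈ l, ∀ y ∈ l, ⁅x, y⁆ = 0) :
    ∃ g : P.Enveloping, P.augmentation g = 1 ∧ ∀ x ∈ l, P.incl x * g = 0 := by
  induction l with
  | nil => exact ⟨1, map_one _, by simp⟩
  | cons x l ih =>
    obtain ⟨g, hg1, hg⟩ := ih (fun y hy => hss y (List.mem_cons_of_mem _ hy))
      fun y hy z hz => hcomm y (List.mem_cons_of_mem _ hy) z (List.mem_cons_of_mem _ hz)
    obtain ⟨f, hf⟩ := (hss x List.mem_cons_self).exists_aeval P.incl P.incl_lie P.incl_pow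
    refine ⟨(1 - aeval (P.incl x) (X * f)) * g, ?_, fun y hy => ?_⟩
    · rw [map_mul, hg1, map_sub, map_one, map_mul (aeval (P.incl x)), map_mul P.augmentation, aeval_X,
        augmentation_incl, zero_mul, sub_zero, mul_one]
    · rcases List.mem_cons.1 hy with rfl | hy'
      · have h1 : P.incl y * aeval (P.incl y) (X * f) = P.incl y := by
          conv_rhs => rw [hf]
          rw [pow_two, mul_assoc, map_mul _ X (X * f), aeval_X]
        rw [← mul_assoc, mul_sub, h1, mul_one, sub_self, zero_mul]
      · have hc : Commute (P.incl y) (P.incl x) := by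
          refine sub_eq_zero.1 ?_
          rw [← P.incl_lie, hcomm y hy x List.mem_cons_self, map_zero]
        have hc' : Commute (P.incl y) (1 - aeval (P.incl x) (X * f)) :=
          (Commute.one_right _).sub_right (commute_aeval hc _)
        rw [← mul_assoc, hc'.eq, mul_assoc, hg y hy', mul_zero]

/-- Applied to g, every monomial of positive degree vanishes, so only constants survive. -/
lemma mul_mem_span_of_mem_monSpan (P : PMap p F L) {l : List L} {g : P.Enveloping}
    (hg : ∀ x ∈ l, P.incl x * g = 0) : P.monSpan l ≤
      (Submodule.span F {g}).comap (LinearMap.mulRight F g) := by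
  induction l with
  | nil =>
    rw [monSpan, List.map_nil, List.prod_nil, Submodule.one_le, Submodule.mem_comap]
    simp [Submodule.mem_span_singleton_self]
  | cons x l ih =>
    rw [monSpan, List.map_cons, List.prod_cons]
    refine Submodule.mul_le.2 fun a ha b hb => ?_
    obtain ⟨r, hr⟩ := Submodule.mem_span_singleton.1
      (ih (fun y hy => hg y (List.mem_cons_of_mem _ hy)) hb)
    rw [LinearMap.mulRight_apply] at hr
    rw [Submodule.mem_comap, LinearMap.mulRight_apply, mul_assoc, ← hr, mul_smul_comm]
    refine Submodule.smul_mem _ r ?_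
    induction ha using Submodule.span_induction with
    | mem a ha =>
      obtain ⟨n, -, rfl⟩ := ha
      cases n with
      | zero => simp [Submodule.mem_span_singleton_self]
      | succ n =>
        change P.incl x ^ (n + 1) * g ∈ _
        rw [pow_succ, mul_assoc, hg x List.mem_cons_self, mul_zero]
        exact zero_mem _
    | zero => simp
    | add a b _ _ ha hb => rw [add_mul]; exact add_mem ha hb
    | smul c a _ ha => rw [smul_mul_assoc]; exact Submodule.smul_mem _ c ha

variable [FiniteDimensional F L]

/-- With T g = 0, only monomials in a complement of T are needed to span `u(L)` g. Right
multiplication by e maps `u(L)` g onto `u(L)` e, because g has augmentation 1 and so c g e = e for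
some c. -/
lemma IsTorus.finrank_span_le {P : PMap p F L} {T : LieSubalgebra F L} (hT : P.IsTorus T)
    {e : P.Enveloping} (he : IsLocalIdempotent P.augmentation e) :
    Module.finrank F (Submodule.span P.Enveloping {e})
      ≤ p ^ (Module.finrank F L - Module.finrank F T) := by
  obtain ⟨W, hW⟩ := T.toSubmodule.exists_isCompl
  obtain ⟨l, hn, hmem, hl, -, -⟩ := exists_list_span_eq T.toSubmodule
  obtain ⟨l', hn', -, hl', hlen', hl0⟩ := exists_list_span_eq W
  have htop := P.monSpan_append_eq_top hW.symm hn' hn hl0 hl' hl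
  obtain ⟨g, hg1, hg⟩ := P.exists_augmentation_eq_one (l := l) (fun x hx => hT.2.2 x (hmem x hx))
    (fun x hx y hy => by
      have := hT.2.1
      exact congrArg Subtype.val (LieModule.IsTrivial.trivial (⟨x, hmem x hx⟩ : T)
        (⟨y, hmem y hy⟩ : T)))
  have hgA : ∀ a : P.Enveloping, ∃ m ∈ P.monSpan l', m * g = a * g := by
    have h1 : (⊤ : Submodule F P.Enveloping) ≤
        ((P.monSpan l').map (LinearMap.mulRight F g)).comap (LinearMap.mulRight F g) := by
      rw [← htop, monSpan_append]
      refine Submodule.mul_le.2 fun a ha b hb => ?_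
      obtain ⟨r, hr⟩ := Submodule.mem_span_singleton.1 (P.mul_mem_span_of_mem_monSpan hg hb)
      rw [LinearMap.mulRight_apply] at hr
      refine ⟨r • a, Submodule.smul_mem _ r ha, ?_⟩
      rw [LinearMap.mulRight_apply, LinearMap.mulRight_apply, mul_assoc, ← hr, smul_mul_assoc,
        mul_smul_comm]
    exact fun a => h1 (Submodule.mem_top (x := a))
  obtain ⟨c, hc⟩ := he.exists_mul_eq g (by rw [hg1]; exact one_ne_zero)
  let ψ : P.monSpan l' →ₗ[F] Submodule.span P.Enveloping {e} :=
    he.proj.restrictScalars F ∘ₗ LinearMap.mulRight F g ∘ₗ (P.monSpan l').subtype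
  have hψ : Function.Surjective ψ := by
    intro y
    obtain ⟨m, hm, hmg⟩ := hgA (y * c)
    refine ⟨⟨m, hm⟩, Subtype.ext ?_⟩
    change m * g * e = y
    rw [hmg, mul_assoc, mul_assoc, hc, he.mul_eq_self_of_mem y.2]
  have := P.finite_monSpan l'
  refine (LinearMap.finrank_le_finrank_of_surjective hψ).trans ((P.finrank_monSpan_le l').trans ?_)
  rw [hlen', ← Submodule.finrank_add_eq_of_isCompl hW]
  exact Nat.pow_le_pow_right (Fact.out : p.Prime).pos (Nat.le_sub_of_add_le' le_rfl)

lemma isTorus_bot (P : PMap p F L) : P.IsTorus ⊥ := by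
  refine ⟨fun x hx => ?_, ⟨fun x y => Subtype.ext ?_⟩, fun x hx => ?_⟩
  · rw [LieSubalgebra.mem_bot] at hx ⊢
    rw [hx, P.toFun_zero]
  · rw [LieSubalgebra.coe_bracket, (LieSubalgebra.mem_bot _).1 x.2, zero_lie]; rfl
  · rw [LieSubalgebra.mem_bot] at hx
    rw [hx]; exact zero_mem _

lemma bddAbove_finrank_torus (P : PMap p F L) :
    BddAbove {n | ∃ T : LieSubalgebra F L, P.IsTorus T ∧ Module.finrank F T = n} :=
  ⟨Module.finrank F L, by rintro _ ⟨T, -, rfl⟩; exact Submodule.finrank_le T.toSubmodule⟩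

lemma IsTorus.finrank_le {P : PMap p F L} {T : LieSubalgebra F L} (hT : P.IsTorus T) :
    Module.finrank F T ≤ P.maxTorusDim :=
  le_csSup P.bddAbove_finrank_torus ⟨T, hT, rfl⟩

lemma exists_isTorus_finrank_eq (P : PMap p F L) :
    ∃ T : LieSubalgebra F L, P.IsTorus T ∧ Module.finrank F T = P.maxTorusDim :=
  Nat.sSup_mem (s := {n | ∃ T : LieSubalgebra F L, P.IsTorus T ∧ Module.finrank F T = n})
    ⟨_, ⊥, P.isTorus_bot, rfl⟩ P.bddAbove_finrank_torus

lemma finrank_span_le_pow (P : PMap p F L) {e : P.Enveloping}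
    (he : IsLocalIdempotent P.augmentation e) :
    Module.finrank F (Submodule.span P.Enveloping {e})
      ≤ p ^ (Module.finrank F L - P.maxTorusDim) := by
  obtain ⟨T, hT, h⟩ := P.exists_isTorus_finrank_eq
  rw [← h]
  exact hT.finrank_span_le he

end PMap
end RestrictedLie

/-! ### The p-map on commuting elements and the largest torus of an abelian p-subalgebra -/

namespace RestrictedLie
namespace PMap

open Polynomial

variable {p : ℕ} [Fact p.Prime] {F : Type u} {L : Type v} [Field F] [LieRing L]
  [LieAlgebra F L]

lemma lie_toFun_eq_zero (P : PMap p F L) {x y : L} (h : ⁅x, y⁆ = 0) : ⁅P.toFun x, y⁆ = 0 := by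
  have hp : p = p - 1 + 1 := by have := (Fact.out : p.Prime).pos; omega
  rw [P.ad_toFun, hp, pow_succ, Module.End.mul_apply, LieAlgebra.ad_apply, h, map_zero]

lemma adCoeff_succ_eq_zero {x y : L} (h : ⁅x, y⁆ = 0) : ∀ n j, adCoeff x y (n + 1) j = 0
  | 0, 0 => by rw [adCoeff, adCoeff, ← lie_skew, h, neg_zero]
  | 0, 0 + 1 => by simp [adCoeff]
  | 0, j + 1 + 1 => by simp [adCoeff]
  | n + 1, 0 => by rw [adCoeff, adCoeff_succ_eq_zero h n 0, lie_zero]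
  | n + 1, j + 1 => by
    rw [adCoeff, adCoeff_succ_eq_zero h n (j + 1), adCoeff_succ_eq_zero h n j, lie_zero, lie_zero,
      add_zero]

lemma toFun_add_of_lie_eq_zero (P : PMap p F L) {x y : L} (h : ⁅x, y⁆ = 0) :
    P.toFun (x + y) = P.toFun x + P.toFun y := by
  have hp : p - 1 = p - 2 + 1 := by have := (Fact.out : p.Prime).two_le; omega
  rw [P.add_toFun, Finset.sum_eq_zero, add_zero]
  intro i _
  rw [jacobsonS, hp, adCoeff_succ_eq_zero h, smul_zero]

/-- The centralizer of a set. -/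
def setCentralizer (F : Type u) [Field F] [LieAlgebra F L] (S : Set L) : LieSubalgebra F L where
  carrier := {x | ∀ y ∈ S, ⁅x, y⁆ = 0}
  add_mem' hx hy z hz := by rw [add_lie, hx z hz, hy z hz, add_zero]
  zero_mem' z _ := zero_lie z
  smul_mem' c x hx z hz := by rw [smul_lie, hx z hz, smul_zero]
  lie_mem' {x y} hx hy z hz := by rw [lie_lie, hx z hz, hy z hz, lie_zero, lie_zero, sub_zero]

lemma isPSubalgebra_setCentralizer (P : PMap p F L) (S : Set L) :
    P.IsPSubalgebra (setCentralizer F S) := fun _ hx y hy => P.lie_toFun_eq_zero (hx y hy)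

/-- Centralizers are p-subalgebras: the centralizer of S contains the p-span of S, and then so does
the centralizer of that p-span. -/
lemma lie_eq_zero_of_mem_pSpan (P : PMap p F L) {S : Set L} (hS : ∀ x ∈ S, ∀ y ∈ S, ⁅x, y⁆ = 0)
    {x y : L} (hx : x ∈ P.pSpan S) (hy : y ∈ P.pSpan S) : ⁅x, y⁆ = 0 := by
  have h1 : P.pSpan S ≤ setCentralizer F S :=
    P.pSpan_le (fun x hx => hS x hx) (P.isPSubalgebra_setCentralizer S)
  have h2 : P.pSpan S ≤ setCentralizer F (P.pSpan S : Set L) :=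
    P.pSpan_le (fun x hx y hy => by rw [← lie_skew, h1 hy x hx, neg_zero])
      (P.isPSubalgebra_setCentralizer _)
  exact h2 hx y hy

/-- A subspace with vanishing brackets, as a Lie subalgebra. -/
def abelianSubalgebra (W : Submodule F L) (hW : ∀ x ∈ W, ∀ y ∈ W, ⁅x, y⁆ = 0) :
    LieSubalgebra F L :=
  { W with lie_mem' := fun hx hy => (hW _ hx _ hy).symm ▸ W.zero_mem }

section Commuting

variable (P : PMap p F L)

lemma toFun_mem_span_image {s : Set L}
    (hs : ∀ x ∈ Submodule.span F s, ∀ y ∈ Submodule.span F s, ⁅x, y⁆ = 0) {x : L}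
    (hx : x ∈ Submodule.span F s) : P.toFun x ∈ Submodule.span F (P.toFun '' s) := by
  induction hx using Submodule.span_induction with
  | mem x hx => exact Submodule.subset_span ⟨x, hx, rfl⟩
  | zero => rw [P.toFun_zero]; exact zero_mem _
  | add x y hx hy ihx ihy =>
    rw [P.toFun_add_of_lie_eq_zero (hs x hx y hy)]; exact add_mem ihx ihy
  | smul c x _ ih => rw [P.smul_toFun]; exact Submodule.smul_mem _ _ ih

variable [FiniteDimensional F L]

/-- On commuting elements the p-map is p-semilinear, so the images of a basis span. The span is
taken because over an imperfect field the image need not be a subspace. -/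
lemma finrank_span_image_toFun_le {V : Submodule F L} (hV : ∀ x ∈ V, ∀ y ∈ V, ⁅x, y⁆ = 0) :
    Module.finrank F (Submodule.span F (P.toFun '' V)) ≤ Module.finrank F V := by
  classical
  obtain ⟨l, -, -, hl, hlen, -⟩ := exists_list_span_eq V
  have hle : Submodule.span F (P.toFun '' V) ≤
      Submodule.span F ((l.map P.toFun).toFinset : Set L) := by
    refine Submodule.span_le.2 ?_
    rintro _ ⟨x, hx, rfl⟩
    rw [← hl] at hV
    have := P.toFun_mem_span_image hV (hl.symm ▸ hx : x ∈ Submodule.span F {x | x ∈ l})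
    refine Submodule.span_mono ?_ this
    rintro _ ⟨y, hy, rfl⟩
    simpa using ⟨y, hy, rfl⟩
  refine (Submodule.finrank_mono hle).trans ((finrank_span_finset_le_card _).trans ?_)
  rw [← hlen, ← List.length_map (f := P.toFun)]
  exact List.toFinset_card_le _

/-- An abelian subspace spanned by its `p`-th powers consists of semisimple elements. -/
lemma isSemisimpleElement_of_le_span {W : Submodule F L} (hW : ∀ x ∈ W, ∀ y ∈ W, ⁅x, y⁆ = 0)
    (hWW : ∀ x ∈ W, P.toFun x ∈ W) (hle : W ≤ Submodule.span F (P.toFun '' W)) {t : L} (ht : t ∈ W) :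
    P.IsSemisimpleElement t := by
  -- The p-th powers of the orbit span V lie in the p-subalgebra generated by t^[p], so it suffices
  -- that they span V. A loss of dimension on V could not be compensated on a complement of V in W,
  -- yet W is spanned by its p-th powers.
  set V := Submodule.span F (Set.range fun k : ℕ => P.toFun^[k] t) with hVdef
  have hVW : V ≤ W := by
    refine Submodule.span_le.2 ?_
    rintro _ ⟨k, rfl⟩
    induction k with
    | zero => exact ht
    | succ k ih =>
      change P.toFun^[k + 1] t ∈ W
      rw [Function.iterate_succ_apply']; exact hWW _ ih
  have himage : P.toFun '' (Set.range fun k : ℕ => P.toFun^[k] t) =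
      Set.range fun k : ℕ => P.toFun^[k + 1] t := by
    rw [← Set.range_comp]
    congr 1
    funext k
    exact (Function.iterate_succ_apply' _ _ _).symm
  have hVc : ∀ x ∈ V, ∀ y ∈ V, ⁅x, y⁆ = 0 := fun x hx y hy => hW x (hVW hx) y (hVW hy)
  have hφV : Submodule.span F (P.toFun '' V) ≤
      Submodule.span F (Set.range fun k : ℕ => P.toFun^[k + 1] t) := by
    refine Submodule.span_le.2 ?_
    rintro _ ⟨x, hx, rfl⟩
    rw [← himage]
    exact P.toFun_mem_span_image hVc hx
  have hφVV : Submodule.span F (P.toFun '' V) ≤ V := hφV.trans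
    (Submodule.span_mono (by rintro _ ⟨k, rfl⟩; exact ⟨k + 1, rfl⟩))
  obtain ⟨Q, hQ⟩ := V.exists_isCompl
  have hsup : V ⊔ Q ⊓ W = W := by
    rw [← sup_inf_assoc_of_le Q hVW, hQ.sup_eq_top, top_inf_eq]
  have hinf : V ⊓ (Q ⊓ W) = ⊥ := by rw [← inf_assoc, hQ.inf_eq_bot, bot_inf_eq]
  have hdim := Submodule.finrank_sup_add_finrank_inf_eq V (Q ⊓ W)
  rw [hsup, hinf, finrank_bot, add_zero] at hdim
  have hle2 : W ≤ Submodule.span F (P.toFun '' V) ⊔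
      Submodule.span F (P.toFun '' ((Q ⊓ W : Submodule F L) : Set L)) := by
    refine hle.trans (Submodule.span_le.2 ?_)
    rintro _ ⟨x, hx, rfl⟩
    have hx' : x ∈ V ⊔ Q ⊓ W := by rw [hsup]; exact hx
    obtain ⟨y, hy, z, hz, rfl⟩ := Submodule.mem_sup.1 hx'
    rw [P.toFun_add_of_lie_eq_zero (hW y (hVW hy) z hz.2)]
    exact add_mem (Submodule.mem_sup_left (Submodule.subset_span ⟨y, hy, rfl⟩))
      (Submodule.mem_sup_right (Submodule.subset_span ⟨z, hz, rfl⟩))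
  have h1 := (Submodule.finrank_mono hle2).trans (Submodule.finrank_add_le_finrank_add_finrank _ _)
  have h2 := P.finrank_span_image_toFun_le (V := Q ⊓ W) fun x hx y hy => hW x hx.2 y hy.2
  have h3 : Submodule.span F (P.toFun '' V) = V :=
    Submodule.eq_of_le_of_finrank_le hφVV (by omega)
  have h4 : V ≤ (P.pSpan {P.toFun t}).toSubmodule := by
    rw [← h3]
    refine hφV.trans (Submodule.span_le.2 ?_)
    rintro _ ⟨k, rfl⟩
    induction k with
    | zero => exact P.subset_pSpan _ rfl
    | succ k ih =>
      change P.toFun^[k + 1 + 1] t ∈ P.pSpan _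
      rw [Function.iterate_succ_apply']; exact P.isPSubalgebra_pSpan _ _ ih
  exact h4 (Submodule.subset_span ⟨0, rfl⟩)

lemma span_image_toFun_mono : Monotone fun V : Submodule F L => Submodule.span F (P.toFun '' V) :=
  fun _ _ h => Submodule.span_mono (Set.image_mono h)

/-- An abelian `p`-subalgebra has a largest torus, into which some power of the `p`-map maps it. -/
lemma exists_isTorus_iterate_mem {C : LieSubalgebra F L} (hC : P.IsPSubalgebra C)
    (hab : ∀ x ∈ C, ∀ y ∈ C, ⁅x, y⁆ = 0) :
    ∃ (T : LieSubalgebra F L) (N : ℕ), P.IsTorus T ∧ T ≤ C ∧ (∀ x ∈ C, P.toFun^[N] x ∈ T) ∧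
      ∀ T' : LieSubalgebra F L, P.IsTorus T' → T' ≤ C → T' ≤ T := by
  -- The torus is the stable term of the descending chain C ⊇ S(C) ⊇ S²(C) ⊇ ….
  let S : Submodule F L → Submodule F L := fun V => Submodule.span F (P.toFun '' V)
  have hS : Monotone S := P.span_image_toFun_mono
  have hSC : S C.toSubmodule ≤ C.toSubmodule :=
    Submodule.span_le.2 (by rintro _ ⟨x, hx, rfl⟩; exact hC x hx)
  have hanti : Antitone fun k => S^[k] C.toSubmodule := hS.antitone_iterate_of_map_le hSC
  obtain ⟨N, hN⟩ := IsArtinian.monotone_stabilizes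
    (⟨fun k => OrderDual.toDual (S^[k] C.toSubmodule), fun _ _ h => hanti h⟩ :
      ℕ →o (Submodule F L)ᵒᵈ)
  have hSW : S (S^[N] C.toSubmodule) = S^[N] C.toSubmodule := by
    rw [← Function.iterate_succ_apply' S]
    exact (hN (N + 1) (Nat.le_succ N)).symm
  set W := S^[N] C.toSubmodule with hWdef
  have hWC : W ≤ C.toSubmodule := hanti (Nat.zero_le N)
  have hWab : ∀ x ∈ W, ∀ y ∈ W, ⁅x, y⁆ = 0 := fun x hx y hy => hab x (hWC hx) y (hWC hy)
  have hWφ : ∀ x ∈ W, P.toFun x ∈ W := fun x hx => hSW ▸ Submodule.subset_span ⟨x, hx, rfl⟩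
  refine ⟨abelianSubalgebra W hWab, N, ⟨hWφ, ⟨fun x y => Subtype.ext (hWab x x.2 y y.2)⟩, fun x hx =>
    P.isSemisimpleElement_of_le_span hWab hWφ hSW.ge hx⟩, hWC, fun x hx => ?_,
    fun T' hT' hT'C => ?_⟩
  · have h : ∀ k, P.toFun^[k] x ∈ S^[k] C.toSubmodule := by
      intro k
      induction k with
      | zero => exact hx
      | succ k ih =>
        rw [Function.iterate_succ_apply', Function.iterate_succ_apply']
        exact Submodule.subset_span ⟨_, ih, rfl⟩
    exact h N
  -- Each t in T' lies in the p-subalgebra generated by t^[p], hence in S(T'). Iterating puts T'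
  -- inside every term of the chain.
  · have hT'S : T'.toSubmodule ≤ S T'.toSubmodule := by
      intro t ht
      have hle : S T'.toSubmodule ≤ C.toSubmodule := (hS hT'C).trans hSC
      have hST : S T'.toSubmodule ≤ T'.toSubmodule :=
        Submodule.span_le.2 (by rintro _ ⟨x, hx, rfl⟩; exact hT'.1 x hx)
      have hK := P.pSpan_le
        (K := abelianSubalgebra (S T'.toSubmodule) fun x hx y hy => hab x (hle hx) y (hle hy))
        (S := {P.toFun t})
        (by rintro _ rfl; exact Submodule.subset_span ⟨t, ht, rfl⟩)
        (fun x hx => Submodule.subset_span ⟨x, hST hx, rfl⟩)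
      exact hK (hT'.2.2 t ht)
    have h : ∀ k, T'.toSubmodule ≤ S^[k] C.toSubmodule := by
      intro k
      induction k with
      | zero => exact hT'C
      | succ k ih =>
        rw [Function.iterate_succ_apply']
        exact hT'S.trans (hS ih)
    exact h N

end Commuting

end PMap
end RestrictedLie

/-! ### Additivity of the maximal torus dimension -/

namespace RestrictedLie
namespace PMap

open Polynomial

section Morphisms

variable {p : ℕ} [Fact p.Prime] {F : Type u} {L L' : Type*} [Field F] [LieRing L]
  [LieAlgebra F L] [LieRing L'] [LieAlgebra F L'] {P : PMap p F L} {P' : PMap p F L'}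
  {f : L →ₗ⁅F⁆ L'}

lemma IsPSubalgebra.comap (hf : ∀ x, f (P.toFun x) = P'.toFun (f x)) {K : LieSubalgebra F L'}
    (hK : P'.IsPSubalgebra K) : P.IsPSubalgebra (K.comap f) := fun x hx => by
  rw [LieSubalgebra.mem_comap, hf]; exact hK _ hx

lemma IsPSubalgebra.map (hf : ∀ x, f (P.toFun x) = P'.toFun (f x)) {K : LieSubalgebra F L}
    (hK : P.IsPSubalgebra K) : P'.IsPSubalgebra (K.map f) := by
  rintro _ ⟨x, hx, rfl⟩
  exact ⟨P.toFun x, hK x hx, hf x⟩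

lemma IsSemisimpleElement.map (hf : ∀ x, f (P.toFun x) = P'.toFun (f x)) {x : L}
    (hx : P.IsSemisimpleElement x) : P'.IsSemisimpleElement (f x) := by
  refine P.pSpan_le (K := (P'.pSpan {P'.toFun (f x)}).comap f) ?_
    (IsPSubalgebra.comap hf (P'.isPSubalgebra_pSpan _)) hx
  rintro _ rfl
  change f (P.toFun x) ∈ P'.pSpan {P'.toFun (f x)}
  rw [hf]
  exact P'.subset_pSpan _ rfl

lemma IsTorus.lie_eq_zero {T : LieSubalgebra F L} (hT : P.IsTorus T) {x y : L} (hx : x ∈ T)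
    (hy : y ∈ T) : ⁅x, y⁆ = 0 := by
  have := hT.2.1
  exact congrArg Subtype.val (LieModule.IsTrivial.trivial (⟨x, hx⟩ : T) (⟨y, hy⟩ : T))

lemma IsTorus.map (hf : ∀ x, f (P.toFun x) = P'.toFun (f x)) {T : LieSubalgebra F L}
    (hT : P.IsTorus T) : P'.IsTorus (T.map f) := by
  refine ⟨IsPSubalgebra.map hf hT.1, ⟨?_⟩, ?_⟩
  · rintro ⟨_, x, hx, rfl⟩ ⟨_, y, hy, rfl⟩
    refine Subtype.ext ((f.map_lie x y).symm.trans ?_)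
    rw [hT.lie_eq_zero hx hy, map_zero]; rfl
  · rintro _ ⟨x, hx, rfl⟩
    exact (hT.2.2 x hx).map hf

lemma IsTorus.comap (hf : ∀ x, f (P.toFun x) = P'.toFun (f x)) (hinj : Function.Injective f)
    {T : LieSubalgebra F L'} (hT : P'.IsTorus T) : P.IsTorus (T.comap f) := by
  refine ⟨IsPSubalgebra.comap hf hT.1, ⟨fun x y => Subtype.ext (hinj ?_)⟩, fun x hx => ?_⟩
  · refine (f.map_lie x y).trans ?_
    exact (hT.lie_eq_zero x.2 y.2).trans (map_zero f).symm
  · obtain ⟨y, hy, hyx⟩ := P'.pSpan_le (K := (P.pSpan {P.toFun x}).map f)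
      (by rintro _ rfl; exact ⟨P.toFun x, P.subset_pSpan _ rfl, hf x⟩)
      (IsPSubalgebra.map hf (P.isPSubalgebra_pSpan _)) (hT.2.2 _ hx)
    have h : y = x := hinj hyx
    rw [h] at hy
    exact hy

end Morphisms

variable {p : ℕ} [Fact p.Prime] {F : Type u} {L : Type v} [Field F] [LieRing L]
  [LieAlgebra F L]

/-- The quotient map by an ideal. -/
def mkLie (I : LieIdeal F L) : L →ₗ⁅F⁆ L ⧸ I :=
  { I.toSubmodule.mkQ with map_lie' := rfl }

/-- The inclusion of an ideal. -/
def inclLie (I : LieIdeal F L) : I →ₗ⁅F⁆ L :=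
  { I.toSubmodule.subtype with map_lie' := rfl }

lemma mkLie_eq_zero (I : LieIdeal F L) {x : L} : mkLie I x = 0 ↔ x ∈ I :=
  Submodule.Quotient.mk_eq_zero I.toSubmodule

/-- Modulo an ideal that contains all brackets `[t, c]`, an element may be corrected so as to
centralize commuting semisimple elements. -/
lemma exists_sub_mem_lie_eq_zero (P : PMap p F L) (I : LieIdeal F L) {l : List L}
    (hss : ∀ t ∈ l, P.IsSemisimpleElement t) (hcomm : ∀ s ∈ l, ∀ t ∈ l, ⁅s, t⁆ = 0) {x : L}
    (hx : ∀ t ∈ l, ⁅t, x⁆ ∈ I) : ∃ c, c - x ∈ I ∧ ∀ t ∈ l, ⁅t, c⁆ = 0 := by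
  induction l with
  | nil => exact ⟨x, by simp, by simp⟩
  | cons t l ih =>
    obtain ⟨c, hcx, hc⟩ := ih (fun s hs => hss s (List.mem_cons_of_mem _ hs))
      (fun s hs r hr => hcomm s (List.mem_cons_of_mem _ hs) r (List.mem_cons_of_mem _ hr))
      fun s hs => hx s (List.mem_cons_of_mem _ hs)
    obtain ⟨f, hf⟩ := (hss t List.mem_cons_self).exists_ad P
    set D := LieAlgebra.ad F L t with hD
    have hDc : D c ∈ I := by
      have h1 : D c = ⁅t, x⁆ + ⁅t, c - x⁆ := by rw [← lie_add, add_sub_cancel]; rfl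
      rw [h1]
      exact add_mem (hx t List.mem_cons_self) (lie_mem_right F L I _ _ hcx)
    have hfI : ∀ g ∈ Algebra.adjoin F {D}, ∀ y ∈ I, g y ∈ I := by
      intro g hg
      induction hg using Algebra.adjoin_induction with
      | mem g hg =>
        rw [Set.mem_singleton_iff.1 hg]
        exact fun y hy => lie_mem_right F L I _ _ hy
      | algebraMap r => exact fun y hy => I.smul_mem r hy
      | add g h _ _ hg hh => exact fun y hy => add_mem (hg y hy) (hh y hy)
      | mul g h _ _ hg hh => exact fun y hy => hg _ (hh y hy)
    -- Since D = D² f(D), subtracting f(D) D c makes the result killed by D. The correction lies in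
    -- I because D c does, and it commutes with the conditions already achieved.
    refine ⟨c - aeval D f (D c), ?_, fun s hs => ?_⟩
    · rw [sub_right_comm]
      exact sub_mem hcx (hfI _ (aeval_mem_adjoin_singleton F D) _ hDc)
    · rcases List.mem_cons.1 hs with rfl | hs'
      · have h2 : D (aeval D f (D c)) = D c := by
          conv_rhs => rw [hf]
          rw [pow_two, mul_assoc, mul_comm X f, map_mul, map_mul, aeval_X]; rfl
        change D (c - aeval D f (D c)) = 0
        rw [map_sub, h2, sub_self]
      · have hcom : Commute (LieAlgebra.ad F L s) D := by
          refine LinearMap.ext fun y => ?_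
          change ⁅s, ⁅t, y⁆⁆ = ⁅t, ⁅s, y⁆⁆
          rw [leibniz_lie, hcomm s hs t List.mem_cons_self, zero_lie, zero_add]
        have h3 : LieAlgebra.ad F L s (aeval D f (D c)) = aeval D f (D (LieAlgebra.ad F L s c)) := by
          have h4 := LinearMap.congr_fun ((commute_aeval hcom f).mul_right hcom).eq c
          exact h4
        change LieAlgebra.ad F L s (c - aeval D f (D c)) = 0
        rw [map_sub, h3, LieAlgebra.ad_apply, hc s hs', map_zero, map_zero, sub_zero]

/-- Descend through the iterates: each is semisimple, so it lies in any p-subalgebra containing its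
p-th power. -/
lemma IsTorus.mem_of_iterate_mem {P : PMap p F L} {T K : LieSubalgebra F L} (hT : P.IsTorus T)
    (hK : P.IsPSubalgebra K) {x : L} (hx : x ∈ T) (N : ℕ) (hN : P.toFun^[N] x ∈ K) : x ∈ K := by
  induction N with
  | zero => exact hN
  | succ N ih =>
    rw [Function.iterate_succ_apply'] at hN
    have hT' : ∀ k, P.toFun^[k] x ∈ T := by
      intro k
      induction k with
      | zero => exact hx
      | succ k ih => rw [Function.iterate_succ_apply']; exact hT.1 _ ih
    exact ih (P.pSpan_le (by rintro _ rfl; exact hN) hK (hT.2.2 _ (hT' N)))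

variable [FiniteDimensional F L]

/-- The dimension of a subspace is that of its image plus that of its trace on the kernel. -/
lemma finrank_map_mkLie_add (I : LieIdeal F L) (T : LieSubalgebra F L) :
    Module.finrank F (T.map (mkLie I)) + Module.finrank F (T.comap (inclLie I)) =
      Module.finrank F T := by
  let f : T →ₗ[F] L ⧸ I := I.toSubmodule.mkQ ∘ₗ T.toSubmodule.subtype
  have h := LinearMap.finrank_range_add_finrank_ker f
  have h1 : LinearMap.range f = (T.map (mkLie I)).toSubmodule := by
    rw [LinearMap.range_comp, Submodule.range_subtype]; rfl
  have h2 : (LinearMap.ker f).map T.toSubmodule.subtype =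
      (T.comap (inclLie I)).toSubmodule.map I.toSubmodule.subtype := by
    ext x
    constructor
    · rintro ⟨y, hy, rfl⟩
      exact ⟨⟨y, (mkLie_eq_zero I).1 hy⟩, y.2, rfl⟩
    · rintro ⟨y, hy, rfl⟩
      exact ⟨⟨y, hy⟩, (mkLie_eq_zero I).2 y.2, rfl⟩
  have h3 := Submodule.finrank_map_subtype_eq T.toSubmodule (LinearMap.ker f)
  have h4 := Submodule.finrank_map_subtype_eq I.toSubmodule (T.comap (inclLie I)).toSubmodule
  rw [h2, h4] at h3
  rw [h1] at h
  exact (congrArg _ h3).trans h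

variable (P : PMap p F L) (I : LieIdeal F L) (hI : P.IsPIdeal I)

lemma maxTorusDim_le_add :
    P.maxTorusDim ≤ (P.restrict I hI).maxTorusDim + (P.quotient I hI).maxTorusDim := by
  obtain ⟨T, hT, h⟩ := P.exists_isTorus_finrank_eq
  rw [← h, ← finrank_map_mkLie_add I T, add_comm]
  exact add_le_add
    (IsTorus.comap (P := P.restrict I hI) (fun _ => rfl) Subtype.val_injective hT).finrank_le
    (IsTorus.map (P' := P.quotient I hI) (fun _ => rfl) hT).finrank_le

/-- A torus of largest dimension between T₀ and the preimage K of T₁ must map onto T₁: an element of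
K that centralizes it has an iterated p-th power inside it, since otherwise the torus could be
enlarged. -/
lemma add_le_maxTorusDim :
    (P.restrict I hI).maxTorusDim + (P.quotient I hI).maxTorusDim ≤ P.maxTorusDim := by
  obtain ⟨T₀, hT₀, h₀⟩ := (P.restrict I hI).exists_isTorus_finrank_eq
  obtain ⟨T₁, hT₁, h₁⟩ := (P.quotient I hI).exists_isTorus_finrank_eq
  have hf₀ : ∀ x, inclLie I ((P.restrict I hI).toFun x) = P.toFun (inclLie I x) := fun _ => rfl
  have hf₁ : ∀ x, mkLie I (P.toFun x) = (P.quotient I hI).toFun (mkLie I x) := fun _ => rfl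
  set K := T₁.comap (mkLie I) with hKdef
  have hK : P.IsPSubalgebra K := IsPSubalgebra.comap hf₁ hT₁.1
  have hIK : ∀ x ∈ I, x ∈ K := fun x hx => by
    rw [hKdef, LieSubalgebra.mem_comap, (mkLie_eq_zero I).2 hx]; exact zero_mem _
  let D : Set ℕ := {n | ∃ T : LieSubalgebra F L,
    (P.IsTorus T ∧ T₀.map (inclLie I) ≤ T ∧ T ≤ K) ∧ Module.finrank F T = n}
  have hDne : D.Nonempty := ⟨_, T₀.map (inclLie I), ⟨hT₀.map hf₀, le_rfl, by
    rintro _ ⟨x, -, rfl⟩; exact hIK _ x.2⟩, rfl⟩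
  have hDbdd : BddAbove D := ⟨Module.finrank F L, by
    rintro _ ⟨T, -, rfl⟩; exact Submodule.finrank_le T.toSubmodule⟩
  obtain ⟨T, ⟨hT, hT₀T, hTK⟩, hTD⟩ := Nat.sSup_mem hDne hDbdd
  have hmax : ∀ T' : LieSubalgebra F L, P.IsTorus T' → T ≤ T' → T' ≤ K → T' ≤ T := by
    intro T' hT' hTT' hT'K
    have h := le_csSup hDbdd ⟨T', ⟨hT', hT₀T.trans hTT', hT'K⟩, rfl⟩
    rw [← hTD] at h
    exact (Submodule.eq_of_le_of_finrank_le (S₁ := T.toSubmodule) (S₂ := T'.toSubmodule) hTT' h).ge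
  -- Brackets of T with a lift x of y ∈ T₁ fall into I because T₁ is abelian; this permits the
  -- correction of x to an element c centralizing T.
  have himage : T₁ ≤ T.map (mkLie I) := by
    intro y hy
    obtain ⟨x, rfl⟩ := I.toSubmodule.mkQ_surjective y
    change mkLie I x ∈ T₁ at hy
    change mkLie I x ∈ T.map (mkLie I)
    obtain ⟨l, -, hmem, hl, -, -⟩ := exists_list_span_eq T.toSubmodule
    obtain ⟨c, hcx, hc⟩ := P.exists_sub_mem_lie_eq_zero I (l := l) (x := x)
      (fun t ht => hT.2.2 t (hmem t ht)) (fun s hs t ht => hT.lie_eq_zero (hmem s hs) (hmem t ht))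
      (fun t ht => (mkLie_eq_zero I).1 (by
        rw [LieHom.map_lie]; exact hT₁.lie_eq_zero (hTK (hmem t ht)) hy))
    have hTc : ∀ t ∈ T, ⁅t, c⁆ = 0 := by
      have h1 : T.toSubmodule ≤ (setCentralizer F {c}).toSubmodule := by
        rw [← hl]
        exact Submodule.span_le.2 fun t ht y hy => by rw [Set.mem_singleton_iff.1 hy]; exact hc t ht
      exact fun t ht => h1 ht c rfl
    have hcx' : mkLie I c = mkLie I x := by
      rw [← sub_eq_zero, ← map_sub]; exact (mkLie_eq_zero I).2 hcx
    have hcK : c ∈ K := by rw [hKdef, LieSubalgebra.mem_comap, hcx']; exact hy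
    set C := P.pSpan (insert c (T : Set L)) with hCdef
    have hCab : ∀ y ∈ C, ∀ z ∈ C, ⁅y, z⁆ = 0 := fun y hy z hz => by
      refine P.lie_eq_zero_of_mem_pSpan ?_ hy hz
      rintro a (rfl | ha) b (rfl | hb)
      · exact lie_self _
      · rw [← lie_skew, hTc b hb, neg_zero]
      · exact hTc a ha
      · exact hT.lie_eq_zero ha hb
    have hCK : C ≤ K := P.pSpan_le (Set.insert_subset hcK hTK) hK
    have hTC : T ≤ C := fun t ht => P.subset_pSpan _ (Set.mem_insert_of_mem c ht)
    obtain ⟨T', N, hT', hT'C, hN, hlarge⟩ :=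
      P.exists_isTorus_iterate_mem (P.isPSubalgebra_pSpan (insert c (T : Set L))) hCab
    have hcT : P.toFun^[N] c ∈ T :=
      hmax T' hT' (hlarge T hT hTC) (hT'C.trans hCK) (hN c (P.subset_pSpan _ (Set.mem_insert c _)))
    have hiter : ∀ k, mkLie I (P.toFun^[k] c) = (P.quotient I hI).toFun^[k] (mkLie I c) := by
      intro k
      induction k with
      | zero => rfl
      | succ k ih => rw [Function.iterate_succ_apply', Function.iterate_succ_apply', hf₁, ih]
    refine hT₁.mem_of_iterate_mem (IsPSubalgebra.map hf₁ hT.1) hy N ?_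
    rw [← hcx', ← hiter]
    exact ⟨_, hcT, rfl⟩
  have hT₀' : T₀ ≤ T.comap (inclLie I) := fun x hx => hT₀T ⟨x, hx, rfl⟩
  refine le_trans ?_ hT.finrank_le
  rw [← h₀, ← h₁, ← finrank_map_mkLie_add I T, add_comm]
  exact add_le_add (Submodule.finrank_mono (s := T₁.toSubmodule) himage)
    (Submodule.finrank_mono (s := T₀.toSubmodule) hT₀')

/-- The maximal torus dimension is additive. -/
theorem maxTorusDim_eq_add :
    P.maxTorusDim = (P.restrict I hI).maxTorusDim + (P.quotient I hI).maxTorusDim :=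
  le_antisymm (P.maxTorusDim_le_add I hI) (P.add_le_maxTorusDim I hI)

lemma maxTorusDim_le_finrank : P.maxTorusDim ≤ Module.finrank F L := by
  obtain ⟨T, -, h⟩ := P.exists_isTorus_finrank_eq
  rw [← h]; exact Submodule.finrank_le T.toSubmodule

end PMap
end RestrictedLie

end

/-! ### The equivalence -/

theorem mainTheorem9 {F : Type u} [Field F] {p : ℕ} [Fact p.Prime] [CharP F p]
    {L : Type v} [LieRing L] [LieAlgebra F L] [FiniteDimensional F L]
    (P : RestrictedLie.PMap p F L) (I : LieIdeal F L) (hI : P.IsPIdeal I) :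
    P.HasMaximalZeroPIM ↔
      (P.restrict I hI).HasMaximalZeroPIM ∧ (P.quotient I hI).HasMaximalZeroPIM := by
  obtain ⟨e, f, g, he, hf, hg, hmul⟩ := P.exists_isLocalIdempotent_finrank_eq_mul I hI
  rw [P.hasMaximalZeroPIM_iff hf, (P.restrict I hI).hasMaximalZeroPIM_iff he,
    (P.quotient I hI).hasMaximalZeroPIM_iff hg, hmul]
  -- The subtractions are truncated; additivity of the exponents uses that MT never exceeds the
  -- dimension.
  have hd : Module.finrank F L - P.maxTorusDim =
      (Module.finrank F I - (P.restrict I hI).maxTorusDim) +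
        (Module.finrank F (L ⧸ I) - (P.quotient I hI).maxTorusDim) := by
    have h1 := P.maxTorusDim_eq_add I hI
    have h2 := (P.restrict I hI).maxTorusDim_le_finrank
    have h3 := (P.quotient I hI).maxTorusDim_le_finrank
    have h4 : Module.finrank F (L ⧸ I) + Module.finrank F I = Module.finrank F L :=
      I.toSubmodule.finrank_quotient_add_finrank
    omega
  rw [hd, pow_add]
  have hle1 := (P.restrict I hI).finrank_span_le_pow he
  have hle2 := (P.quotient I hI).finrank_span_le_pow hg
  have hpos : ∀ n, 0 < p ^ n := fun n => pow_pos (Fact.out : p.Prime).pos n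
  refine ⟨fun h => ?_, fun h => by rw [h.1, h.2]⟩
  -- Equality of the products forces equality in both upper bounds; the first factor is nonzero
  -- because the product is a power of p.
  refine (mul_eq_mul_iff_eq_and_eq_of_pos hle1 hle2 (Nat.pos_of_ne_zero fun h0 => ?_) (hpos _)).1 h
  rw [h0, zero_mul] at h
  exact (Nat.mul_pos (hpos _) (hpos _)).ne h
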